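/- **Theorem.** Let $S=(s_1,\dots,s_n)$ and $T=(t_1,\dots,t_n)$ be two valid configurations of $n$ points in the plane, i.e. the open unit discs centred at the points of $S$ are pairwise disjoint, and so are those centred at the points of $T$. Let $M$ be a bijection (matching) between $S$ and $T$. A translation $v\in\mathbb R^2$ is called *valid* if the elements $s\in S$ can be ordered as $s_{\sigma(1)},\dots,s_{\sigma(n)}$ so that, for each $i=1,\dots,n$, the open unit disc can be translated along the straight segment from $s_{\sigma(i)}$ to $M(s_{\sigma(i)})+v$ without ever meeting one of the open unit discs centred at the points $s_{\sigma(j)}$ with $j>i$ (discs not yet moved) or $M(s_{\sigma(j)})+v$ with $j<i$ (discs already moved). Such an order is called an itinerary for $v$. Let $Q\subseteq\mathbb R^2$ be the set of all valid translations. Then $Q$ can be computed from $(S,T,M)$ in $O(n^6)$ time on a real RAM, in the following sense. The machine has unit-cost $+,-,\times,/,\sqrt{\ }$ and comparisons on real numbers, unit-cost addition, truncated subtraction and comparison on natural numbers (used as array indices and counters), integer constants, and no conversion from reals to integers. There are one program, independent of $n$ and of the instance, and a constant $C$ such that, for every $n\ge 0$ and every instance $(S,T,M)$ with $n$ discs,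 the program halts after at most $C(n^6+1)$ steps and outputs a finite list of nonempty, pairwise disjoint cells whose union is exactly $Q$, such that all translations in one cell have the same itineraries. Here a cell is a set $$\{(x,y) : x\in I,\ y\in J(x)\},$$ where $I$ is a single point or an open (possibly unbounded) interval, and either $J(x)=\{f(x)\}$ for all $x\in I$, or $J(x)$ is for all $x\in I$ the open interval $(f(x),g(x))$, $(f(x),\infty)$, $(-\infty,g(x))$ or $(-\infty,\infty)$; the graphs of $f,g$ are each a piece of a non-vertical line or of the upper or lower half of a circle defined over all of $I$, with $f<g$ on $I$ when both occur in an interval $(f(x),g(x))$. Each cell is output explicitly, by its type and the real parameters of $I$, $f$ and $g$. -/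

import Mathlib

namespace DiscReconfig

/-! ### Labeled instances, itineraries and valid translations -/

/-- The Euclidean plane. -/
abbrev Plane := EuclideanSpace ℝ (Fin 2)

/-- The open unit disc centred at `c`. Collisions are tested on open discs: discs may touch,
but they may not overlap. -/
def unitDisc (c : Plane) : Set Plane := Metric.ball c 1

/-- A configuration of `n` unit discs, given by their centres, is valid if no two of the discs
overlap. -/
def ValidConfiguration {n : ℕ} (X : Fin n → Plane) : Prop :=
  ∀ i j, i ≠ j → Disjoint (unitDisc (X i)) (unitDisc (X j))

/-- A labeled instance: valid start and target configurations of `n` points each, and a matching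
between them; the disc that starts at `S i` has the target position `T (M i)`. -/
structure LabeledInstance (n : ℕ) where
  S : Fin n → Plane
  T : Fin n → Plane
  M : Fin n ≃ Fin n
  valid_S : ValidConfiguration S
  valid_T : ValidConfiguration T

/-- A unit disc that is translated along the segment from `a` to `b` does not collide with the
unit disc placed at `c`. -/
def CollisionFree (a b c : Plane) : Prop :=
  ∀ t ∈ Set.Icc (0 : ℝ) 1, Disjoint (unitDisc (AffineMap.lineMap a b t)) (unitDisc c)

/-- Moving the discs one by one, in the order `σ 0, σ 1, …`, each along a straight segment
from its start position to its target position translated by `v`, is a collision-free itinerary: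
the moving disc collides neither with a disc that has not moved yet, nor with a disc that has
already been moved. -/
def IsItinerary {n : ℕ} (I : LabeledInstance n) (v : Plane) (σ : Fin n ≃ Fin n) : Prop :=
  ∀ i : Fin n,
    (∀ j, i < j →
      CollisionFree (I.S (σ i)) (I.T (I.M (σ i)) + v) (I.S (σ j))) ∧
    (∀ j, j < i →
      CollisionFree (I.S (σ i)) (I.T (I.M (σ i)) + v) (I.T (I.M (σ j)) + v))

/-- The region `Q` of all valid translations. -/
def validTranslations {n : ℕ} (I : LabeledInstance n) : Set Plane :=
  {v | ∃ σ : Fin n ≃ Fin n, IsItinerary I v σ}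

/-! ### A real RAM

Structured programs over finitely many variables and arrays that hold natural numbers (used for
indices and counters) or exact real numbers. Every operation and every memory access has unit
cost. Natural numbers support addition, truncated subtraction and comparison; real numbers
support `+ - * /`, square root and comparison. There is no conversion (such as rounding) from
reals to natural numbers, and the only constants are integers. -/

/-- The memory: variables `nvar i`, `rvar i` and array entries `narr a i`, `rarr a i`. -/
structure State where
  nvar : ℕ → ℕ
  rvar : ℕ → ℝ
  narr : ℕ → ℕ → ℕ
  rarr : ℕ → ℕ → ℝ

/-- Expressions with natural number values. -/
inductive NExpr where
  | const (k : ℕ)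
  | var (i : ℕ)
  | get (a : ℕ) (e : NExpr)
  | add (e₁ e₂ : NExpr)
  | sub (e₁ e₂ : NExpr)

/-- Expressions with real values. -/
inductive RExpr where
  | const (k : ℤ)
  | var (i : ℕ)
  | get (a : ℕ) (e : NExpr)
  | add (e₁ e₂ : RExpr)
  | sub (e₁ e₂ : RExpr)
  | mul (e₁ e₂ : RExpr)
  | div (e₁ e₂ : RExpr)
  | sqrt (e : RExpr)

/-- Tests. -/
inductive BExpr where
  | nle (e₁ e₂ : NExpr)
  | rle (e₁ e₂ : RExpr)
  | not (b : BExpr)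
  | and (b₁ b₂ : BExpr)

def NExpr.eval (s : State) : NExpr → ℕ
  | .const k => k
  | .var i => s.nvar i
  | .get a e => s.narr a (e.eval s)
  | .add e₁ e₂ => e₁.eval s + e₂.eval s
  | .sub e₁ e₂ => e₁.eval s - e₂.eval s

noncomputable def RExpr.eval (s : State) : RExpr → ℝ
  | .const k => (k : ℝ)
  | .var i => s.rvar i
  | .get a e => s.rarr a (e.eval s)
  | .add e₁ e₂ => e₁.eval s + e₂.eval s
  | .sub e₁ e₂ => e₁.eval s - e₂.eval s
  | .mul e₁ e₂ => e₁.eval s * e₂.eval s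
  | .div e₁ e₂ => e₁.eval s / e₂.eval s
  | .sqrt e => Real.sqrt (e.eval s)

def BExpr.holds (s : State) : BExpr → Prop
  | .nle e₁ e₂ => e₁.eval s ≤ e₂.eval s
  | .rle e₁ e₂ => e₁.eval s ≤ e₂.eval s
  | .not b => ¬ b.holds s
  | .and b₁ b₂ => b₁.holds s ∧ b₂.holds s

/-- The cost of an expression: its number of constants, memory accesses and operations. -/
def NExpr.cost : NExpr → ℕ
  | .const _ => 1
  | .var _ => 1
  | .get _ e => e.cost + 1
  | .add e₁ e₂ => e₁.cost + e₂.cost + 1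
  | .sub e₁ e₂ => e₁.cost + e₂.cost + 1

/-- The cost of an expression: its number of constants, memory accesses and operations. -/
def RExpr.cost : RExpr → ℕ
  | .const _ => 1
  | .var _ => 1
  | .get _ e => e.cost + 1
  | .add e₁ e₂ => e₁.cost + e₂.cost + 1
  | .sub e₁ e₂ => e₁.cost + e₂.cost + 1
  | .mul e₁ e₂ => e₁.cost + e₂.cost + 1
  | .div e₁ e₂ => e₁.cost + e₂.cost + 1
  | .sqrt e => e.cost + 1

/-- The cost of an expression: its number of constants, memory accesses and operations. -/
def BExpr.cost : BExpr → ℕ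
  | .nle e₁ e₂ => e₁.cost + e₂.cost + 1
  | .rle e₁ e₂ => e₁.cost + e₂.cost + 1
  | .not b => b.cost + 1
  | .and b₁ b₂ => b₁.cost + b₂.cost + 1

/-- Programs. -/
inductive Prog where
  | skip
  | setN (i : ℕ) (e : NExpr)
  | setR (i : ℕ) (e : RExpr)
  | putN (a : ℕ) (idx e : NExpr)
  | putR (a : ℕ) (idx : NExpr) (e : RExpr)
  | seq (p q : Prog)
  | ite (b : BExpr) (p q : Prog)
  | loop (b : BExpr) (p : Prog)

def State.setN (s : State) (i x : ℕ) : State :=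
  { s with nvar := Function.update s.nvar i x }

noncomputable def State.setR (s : State) (i : ℕ) (x : ℝ) : State :=
  { s with rvar := Function.update s.rvar i x }

def State.putN (s : State) (a i x : ℕ) : State :=
  { s with narr := Function.update s.narr a (Function.update (s.narr a) i x) }

noncomputable def State.putR (s : State) (a i : ℕ) (x : ℝ) : State :=
  { s with rarr := Function.update s.rarr a (Function.update (s.rarr a) i x) }

/-- `Exec p s t s'`: started in the state `s`, the program `p` halts in the state `s'` after
exactly `t` steps. -/
inductive Exec : Prog → State → ℕ → State → Prop where
  | skip (s : State) : Exec .skip s 1 s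
  | setN (s : State) (i : ℕ) (e : NExpr) :
      Exec (.setN i e) s (e.cost + 1) (s.setN i (e.eval s))
  | setR (s : State) (i : ℕ) (e : RExpr) :
      Exec (.setR i e) s (e.cost + 1) (s.setR i (e.eval s))
  | putN (s : State) (a : ℕ) (idx e : NExpr) :
      Exec (.putN a idx e) s (idx.cost + e.cost + 1) (s.putN a (idx.eval s) (e.eval s))
  | putR (s : State) (a : ℕ) (idx : NExpr) (e : RExpr) :
      Exec (.putR a idx e) s (idx.cost + e.cost + 1) (s.putR a (idx.eval s) (e.eval s))
  | seq {p q : Prog} {s s' s'' : State} {t t' : ℕ} :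
      Exec p s t s' → Exec q s' t' s'' → Exec (.seq p q) s (t + t') s''
  | iteTrue {b : BExpr} {p q : Prog} {s s' : State} {t : ℕ} :
      b.holds s → Exec p s t s' → Exec (.ite b p q) s (b.cost + 1 + t) s'
  | iteFalse {b : BExpr} {p q : Prog} {s s' : State} {t : ℕ} :
      ¬ b.holds s → Exec q s t s' → Exec (.ite b p q) s (b.cost + 1 + t) s'
  | loopStop {b : BExpr} {p : Prog} {s : State} :
      ¬ b.holds s → Exec (.loop b p) s (b.cost + 1) s
  | loopStep {b : BExpr} {p : Prog} {s s' s'' : State} {t t' : ℕ} :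
      b.holds s → Exec p s t s' → Exec (.loop b p) s' t' s'' →
      Exec (.loop b p) s (b.cost + 1 + t + t') s''

/-! ### Planar cells of constant description complexity -/

/-- An `x`-monotone curve: a non-vertical line `y = p x + q`, or the upper or the lower half of
the circle of radius `r` centred at `(p, q)`. -/
inductive Curve where
  | line (p q : ℝ)
  | upper (p q r : ℝ)
  | lower (p q r : ℝ)

/-- The ordinate of the curve at the abscissa `x`. -/
noncomputable def Curve.height (x : ℝ) : Curve → ℝ
  | .line p q => p * x + q
  | .upper p q r => q + Real.sqrt (r ^ 2 - (x - p) ^ 2)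
  | .lower p q r => q - Real.sqrt (r ^ 2 - (x - p) ^ 2)

/-- The abscissas over which the curve is defined. -/
def Curve.domain : Curve → Set ℝ
  | .line _ _ => Set.univ
  | .upper p _ r => {x | |x - p| ≤ r}
  | .lower p _ r => {x | |x - p| ≤ r}

/-- A single point, or an open interval with a lower end, an upper end, both or none. -/
inductive Span (α : Type) where
  | single (a : α)
  | between (a b : α)
  | above (a : α)
  | below (b : α)
  | all

def Span.map {α β : Type} (f : α → β) : Span α → Span β
  | .single a => .single (f a)
  | .between a b => .between (f a) (f b)
  | .above a => .above (f a)
  | .below b => .below (f b)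
  | .all => .all

/-- The objects that delimit the span. -/
def Span.ends {α : Type} : Span α → Set α
  | .single a => {a}
  | .between a b => {a, b}
  | .above a => {a}
  | .below b => {b}
  | .all => ∅

def Span.toSet : Span ℝ → Set ℝ
  | .single a => {a}
  | .between a b => Set.Ioo a b
  | .above a => Set.Ioi a
  | .below b => Set.Iio b
  | .all => Set.univ

/-- A cell: its abscissas range over `xs`, and over each abscissa its ordinates lie on a given
curve, or strictly between two given curves, or strictly above or below a given curve, or are
arbitrary. So a cell is a point, an open segment or arc, or an open (possibly unbounded)
vertical trapezoid whose floor and ceiling are line segments or circular arcs. -/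
structure Cell where
  xs : Span ℝ
  ys : Span Curve

/-- The set of the points of a cell. -/
def Cell.toSet (c : Cell) : Set Plane :=
  {v | v 0 ∈ c.xs.toSet ∧ v 1 ∈ (c.ys.map (Curve.height (v 0))).toSet}

/-- A cell is proper if it has some abscissa and, over each of its abscissas, the curves that
delimit it are defined and the range of its ordinates is not empty. -/
def Cell.IsProper (c : Cell) : Prop :=
  c.xs.toSet.Nonempty ∧
    ∀ x ∈ c.xs.toSet,
      (∀ γ ∈ c.ys.ends, x ∈ γ.domain) ∧ (c.ys.map (Curve.height x)).toSet.Nonempty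

/-! ### Input and output conventions -/

/-- The initial memory for the instance `I`: the number `n` in the variable `nvar 0`, the
coordinates of the start positions in the arrays `rarr 0` and `rarr 1`, those of the target
positions in `rarr 2` and `rarr 3`, the matching in `narr 0`, and zeros everywhere else. -/
noncomputable def inputState {n : ℕ} (I : LabeledInstance n) : State where
  nvar i := if i = 0 then n else 0
  rvar _ := 0
  narr a i := if h : i < n then (if a = 0 then (I.M ⟨i, h⟩ : ℕ) else 0) else 0
  rarr a i :=
    if h : i < n then
      match a with
      | 0 => I.S ⟨i, h⟩ 0
      | 1 => I.S ⟨i, h⟩ 1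
      | 2 => I.T ⟨i, h⟩ 0
      | 3 => I.T ⟨i, h⟩ 1
      | _ => 0
    else 0

def decodeSpan {α : Type} (tag : ℕ) (a b : α) : Span α :=
  match tag with
  | 0 => .single a
  | 1 => .between a b
  | 2 => .above a
  | 3 => .below b
  | _ => .all

def decodeCurve (tag : ℕ) (p q r : ℝ) : Curve :=
  match tag with
  | 0 => .line p q
  | 1 => .upper p q r
  | _ => .lower p q r

/-- The number of cells that are reported in a final memory. -/
def outputCount (s : State) : ℕ := s.nvar 1

/-- The cell number `k` that is reported in a final memory: the `k`-th entries of the arrays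
`narr 1`, …, `narr 4` and `rarr 4`, …, `rarr 11` give the shape of the cell, the types of its
curves, and their real parameters. -/
def outputCell (s : State) (k : ℕ) : Cell where
  xs := decodeSpan (s.narr 1 k) (s.rarr 4 k) (s.rarr 5 k)
  ys := decodeSpan (s.narr 2 k)
    (decodeCurve (s.narr 3 k) (s.rarr 6 k) (s.rarr 7 k) (s.rarr 8 k))
    (decodeCurve (s.narr 4 k) (s.rarr 9 k) (s.rarr 10 k) (s.rarr 11 k))

/-- The list of cells reported in the final memory `s` is an explicit description of the region
of valid translations of `I`: the cells are proper and pairwise disjoint, their union is exactly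
that region, and all the translations of one cell have the same collision-free itineraries. -/
structure ReportsValidTranslations {n : ℕ} (I : LabeledInstance n) (s : State) : Prop where
  proper : ∀ k < outputCount s, (outputCell s k).IsProper
  disjoint : ∀ k < outputCount s, ∀ l < outputCount s, k ≠ l →
    Disjoint (outputCell s k).toSet (outputCell s l).toSet
  union_eq : ⋃ k ∈ Set.Iio (outputCount s), (outputCell s k).toSet = validTranslations I
  same_itineraries : ∀ k < outputCount s, ∀ v ∈ (outputCell s k).toSet,
    ∀ w ∈ (outputCell s k).toSet, ∀ σ : Fin n ≃ Fin n, IsItinerary I v σ ↔ IsItinerary I w σ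

end DiscReconfig

/-!
# Computing the valid translations on a real RAM

For a fixed translation `v`, the disc `b` blocks the disc `a` if `a` cannot be moved before `b`,
because `a` would run into the start position of `b`, or `b` into the target position of `a`
(`Coords.Blocks`). An itinerary is an order of the discs in which no disc is blocked by a later one
(`isItinerary_iff`), and such an order exists exactly if one can remove all discs, one after the
other, each time a disc that no remaining disc blocks (`orderable_erase_iff`). With a counter for the
discs that block each disc, this greedy test takes `O(n ^ 2)` time (`testValid_spec`).

Whether `b` blocks `a` depends only on the sides on which `v` lies of ten curves: a moving disc hits
a fixed one if the relative motion ends in the disc of radius `2` around the difference of their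
centres, or between the two tangents to this disc and beyond the chord through their points of
contact (`collisionFree_iff`, `hits_congr`).

All these curves are lines and half circles. Half circles are prolonged by horizontal rays, and
a vertical line is represented by the abscissa of an event, so that one has `m = O(n ^ 2)` graphs of
functions on all of `ℝ` (`TotalCurve`). Two of them change their order only at eleven candidate
abscissas, their events (`TotalCurve.sign_eq_of_event`). Hence each curve has `11 m` events.

The plane is cut into cells. Each cell lies on a curve `d`, or between `d` and its neighbour above
or below; over the abscissas, it is either a single event of `d`, or reaches from an event of `d` (or
from `-∞`) to the next event of `d` and its neighbour. So a cell has an address: a curve, an event of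
this curve, and one of six modes. There are `O(m ^ 2) = O(n ^ 4)` addresses; with a canonical choice
among coinciding curves and events, each point has exactly one (`Arrangement.exists_addr`,
`Arrangement.Addr.unique`). The points with one address lie on the same side of all curves, so that
the same discs block each other there (`Scene.blocks_iff`).

The program runs through all addresses. For each of them it finds a sample point, decides whether
the address is in use, determines the end of the cell and tests the sample point for validity, with
a constant number of passes over the curves or over the rows of events, and one greedy removal
(`sample_spec`, `testAddress_spec`, `findNext_spec`, `testValid_spec`). This takes `O(m + n ^ 2)`
time for each address, which gives `O(n ^ 6)` altogether. No search structure is needed: the sample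
point is moved towards the left end of the cell, past one event after the other.

The program is written in a language of counted loops (`FProg`). Its programs denote functions on
memories (`FProg.den`), they compile to the real RAM, and the running time of the compiled program is
a power of the size whose exponent is read off the nesting of the loops (`FProg.exec_compile`).
Correctness is proved for the denotation, with invariants (`FProg.for_rule`) and with lists of the
variables and arrays that a program may write.
-/

namespace DiscReconfig

/-! ### A language of counted loops -/

/-- Programs all of whose loops are counted: `count i b p` runs `p` with the variable `nvar i`
counting from `0` up to the value of `nvar b`. -/
inductive FProg where
  | skip
  | setN (i : ℕ) (e : NExpr)
  | setR (i : ℕ) (e : RExpr)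
  | putN (a : ℕ) (idx e : NExpr)
  | putR (a : ℕ) (idx : NExpr) (e : RExpr)
  | seq (p q : FProg)
  | ite (b : BExpr) (p q : FProg)
  | count (i b : ℕ) (p : FProg)

namespace FProg

infixr:60 " ;; " => FProg.seq

open Classical in
/-- The state transformer that a program denotes. -/
noncomputable def den : FProg → State → State
  | skip, s => s
  | setN i e, s => s.setN i (e.eval s)
  | setR i e, s => s.setR i (e.eval s)
  | putN a idx e, s => s.putN a (idx.eval s) (e.eval s)
  | putR a idx e, s => s.putR a (idx.eval s) (e.eval s)
  | seq p q, s => q.den (p.den s)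
  | ite b p q, s => if b.holds s then p.den s else q.den s
  | .count i b p, s =>
      (fun s' => (p.den s').setN i ((p.den s').nvar i + 1))^[s.nvar b] (s.setN i 0)

/-- The translation into the language of the real RAM. -/
def compile : FProg → Prog
  | skip => .skip
  | setN i e => .setN i e
  | setR i e => .setR i e
  | putN a idx e => .putN a idx e
  | putR a idx e => .putR a idx e
  | seq p q => .seq p.compile q.compile
  | ite b p q => .ite b p.compile q.compile
  | .count i b p => .seq (.setN i (.const 0))
      (.loop (.not (.nle (.var b) (.var i)))
        (.seq p.compile (.setN i (.add (.var i) (.const 1)))))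

/-- The natural number variables that a program may write. -/
def wN : FProg → List ℕ
  | setN i _ => [i]
  | seq p q => p.wN ++ q.wN
  | ite _ p q => p.wN ++ q.wN
  | .count i _ p => i :: p.wN
  | _ => []

/-- The real variables that a program may write. -/
def wR : FProg → List ℕ
  | setR i _ => [i]
  | seq p q => p.wR ++ q.wR
  | ite _ p q => p.wR ++ q.wR
  | .count _ _ p => p.wR
  | _ => []

/-- The arrays of natural numbers that a program may write. -/
def wNA : FProg → List ℕ
  | putN a _ _ => [a]
  | seq p q => p.wNA ++ q.wNA
  | ite _ p q => p.wNA ++ q.wNA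
  | .count _ _ p => p.wNA
  | _ => []

/-- The arrays of real numbers that a program may write. -/
def wRA : FProg → List ℕ
  | putR a _ _ => [a]
  | seq p q => p.wRA ++ q.wRA
  | ite _ p q => p.wRA ++ q.wRA
  | .count _ _ p => p.wRA
  | _ => []

/-- The variables that bound the loops of a program. -/
def bounds : FProg → List ℕ
  | seq p q => p.bounds ++ q.bounds
  | ite _ p q => p.bounds ++ q.bounds
  | .count _ b p => b :: p.bounds
  | _ => []

/-- No loop body writes the counter or the bound of its loop. -/
def wf : FProg → Bool
  | seq p q => p.wf && q.wf
  | ite _ p q => p.wf && q.wf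
  | .count i b p => p.wf && !(p.wN.contains i) && !(p.wN.contains b) && !(i == b)
  | _ => true

/-- The exponent of the running time, when the loop bound `nvar b` has order `N ^ w b`. -/
def deg (w : ℕ → ℕ) : FProg → ℕ
  | seq p q => max (p.deg w) (q.deg w)
  | ite _ p q => max (p.deg w) (q.deg w)
  | .count _ b p => w b + p.deg w
  | _ => 0

end FProg

section projections
variable (s : State) (i j a k x : ℕ) (r : ℝ)

@[simp] theorem State.setN_nvar : (s.setN i x).nvar j = if j = i then x else s.nvar j := by
  simp [State.setN, Function.update_apply]
@[simp] theorem State.setN_rvar : (s.setN i x).rvar = s.rvar := rfl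
@[simp] theorem State.setN_narr : (s.setN i x).narr = s.narr := rfl
@[simp] theorem State.setN_rarr : (s.setN i x).rarr = s.rarr := rfl
@[simp] theorem State.setR_rvar : (s.setR i r).rvar j = if j = i then r else s.rvar j := by
  simp [State.setR, Function.update_apply]
@[simp] theorem State.setR_nvar : (s.setR i r).nvar = s.nvar := rfl
@[simp] theorem State.setR_narr : (s.setR i r).narr = s.narr := rfl
@[simp] theorem State.setR_rarr : (s.setR i r).rarr = s.rarr := rfl
@[simp] theorem State.putN_narr : (s.putN a i x).narr j =
    if j = a then Function.update (s.narr a) i x else s.narr j := by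
  simp [State.putN, Function.update_apply]
@[simp] theorem State.putN_nvar : (s.putN a i x).nvar = s.nvar := rfl
@[simp] theorem State.putN_rvar : (s.putN a i x).rvar = s.rvar := rfl
@[simp] theorem State.putN_rarr : (s.putN a i x).rarr = s.rarr := rfl
@[simp] theorem State.putR_rarr : (s.putR a i r).rarr j =
    if j = a then Function.update (s.rarr a) i r else s.rarr j := by
  simp [State.putR, Function.update_apply]
@[simp] theorem State.putR_nvar : (s.putR a i r).nvar = s.nvar := rfl
@[simp] theorem State.putR_rvar : (s.putR a i r).rvar = s.rvar := rfl
@[simp] theorem State.putR_narr : (s.putR a i r).narr = s.narr := rfl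

end projections

namespace FProg

section rules
variable (s : State)

@[simp] theorem den_skip : den skip s = s := by rw [den]
@[simp] theorem den_setN (i e) : den (setN i e) s = s.setN i (e.eval s) := by rw [den]
@[simp] theorem den_setR (i e) : den (setR i e) s = s.setR i (e.eval s) := by rw [den]
@[simp] theorem den_putN (a i e) :
    den (putN a i e) s = s.putN a (i.eval s) (e.eval s) := by rw [den]
@[simp] theorem den_putR (a i e) :
    den (putR a i e) s = s.putR a (i.eval s) (e.eval s) := by rw [den]
@[simp] theorem den_seq (p q) : den (p ;; q) s = den q (den p s) := by rw [den]
theorem den_ite_pos {b : BExpr} (p q) {s} (h : b.holds s) : den (ite b p q) s = den p s := by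
  rw [den, if_pos h]
theorem den_ite_neg {b : BExpr} (p q) {s} (h : ¬ b.holds s) : den (ite b p q) s = den q s := by
  rw [den, if_neg h]

end rules

theorem den_nvar {p : FProg} {j : ℕ} (h : p.wN.contains j = false) (s : State) :
    (p.den s).nvar j = s.nvar j := by
  induction p generalizing s with
  | setN i e => simp_all [wN]
  | seq p q hp hq => simp [wN] at h hp hq; simp [hp h.1, hq h.2]
  | ite b p q hp hq =>
    simp [wN] at h hp hq
    by_cases hb : b.holds s
    · rw [den_ite_pos _ _ hb, hp h.1]
    · rw [den_ite_neg _ _ hb, hq h.2]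
  | count i b p hp =>
    simp [wN] at h hp
    rw [den]
    refine Function.Iterate.rec (fun s' : State => s'.nvar j = s.nvar j) ?_ ?_ _
    · simp [h.1]
    · intro s' hs'; simp [h.1, hp h.2, hs']
  | _ => simp

theorem den_rvar {p : FProg} {j : ℕ} (h : p.wR.contains j = false) (s : State) :
    (p.den s).rvar j = s.rvar j := by
  induction p generalizing s with
  | setR i e => simp_all [wR]
  | seq p q hp hq => simp [wR] at h hp hq; simp [hp h.1, hq h.2]
  | ite b p q hp hq =>
    simp [wR] at h hp hq
    by_cases hb : b.holds s
    · rw [den_ite_pos _ _ hb, hp h.1]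
    · rw [den_ite_neg _ _ hb, hq h.2]
  | count i b p hp =>
    simp [wR] at h hp
    rw [den]
    refine Function.Iterate.rec (fun s' : State => s'.rvar j = s.rvar j) ?_ ?_ _
    · simp
    · intro s' hs'; simp [hp h, hs']
  | _ => simp

theorem den_narr {p : FProg} {j : ℕ} (h : p.wNA.contains j = false) (s : State) :
    (p.den s).narr j = s.narr j := by
  induction p generalizing s with
  | putN a i e => simp_all [wNA]
  | seq p q hp hq => simp [wNA] at h hp hq; simp [hp h.1, hq h.2]
  | ite b p q hp hq =>
    simp [wNA] at h hp hq
    by_cases hb : b.holds s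
    · rw [den_ite_pos _ _ hb, hp h.1]
    · rw [den_ite_neg _ _ hb, hq h.2]
  | count i b p hp =>
    simp [wNA] at h hp
    rw [den]
    refine Function.Iterate.rec (fun s' : State => s'.narr j = s.narr j) ?_ ?_ _
    · simp
    · intro s' hs'; simp [hp h, hs']
  | _ => simp

theorem den_rarr {p : FProg} {j : ℕ} (h : p.wRA.contains j = false) (s : State) :
    (p.den s).rarr j = s.rarr j := by
  induction p generalizing s with
  | putR a i e => simp_all [wRA]
  | seq p q hp hq => simp [wRA] at h hp hq; simp [hp h.1, hq h.2]
  | ite b p q hp hq =>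
    simp [wRA] at h hp hq
    by_cases hb : b.holds s
    · rw [den_ite_pos _ _ hb, hp h.1]
    · rw [den_ite_neg _ _ hb, hq h.2]
  | count i b p hp =>
    simp [wRA] at h hp
    rw [den]
    refine Function.Iterate.rec (fun s' : State => s'.rarr j = s.rarr j) ?_ ?_ _
    · simp
    · intro s' hs'; simp [hp h, hs']
  | _ => simp

/-- The two states agree on everything that the program does not write. -/
structure Agree (p : FProg) (s s' : State) : Prop where
  nvar : ∀ j, p.wN.contains j = false → s'.nvar j = s.nvar j
  rvar : ∀ j, p.wR.contains j = false → s'.rvar j = s.rvar j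
  narr : ∀ j, p.wNA.contains j = false → s'.narr j = s.narr j
  rarr : ∀ j, p.wRA.contains j = false → s'.rarr j = s.rarr j

theorem agree_den (p : FProg) (s : State) : Agree p s (p.den s) :=
  ⟨fun _ h => den_nvar h s, fun _ h => den_rvar h s, fun _ h => den_narr h s,
    fun _ h => den_rarr h s⟩

/-- The invariant rule for counted loops. Besides the invariant `P`, the body may use that the
counter has the right value and that nothing outside the variables of the loop has changed. -/
theorem for_rule {i b : ℕ} {p : FProg} (hwf : (FProg.count i b p).wf = true) (s : State)
    (P : ℕ → State → Prop) (h0 : P 0 (s.setN i 0))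
    (hstep : ∀ k < s.nvar b, ∀ s', P k s' → s'.nvar i = k → Agree (.count i b p) s s' →
      P (k + 1) ((p.den s').setN i (k + 1))) :
    P (s.nvar b) ((FProg.count i b p).den s) := by
  simp [wf] at hwf
  obtain ⟨⟨⟨-, hi⟩, -⟩, -⟩ := hwf
  have key : ∀ k ≤ s.nvar b, ∀ s', s' = (fun s' => (p.den s').setN i
      ((p.den s').nvar i + 1))^[k] (s.setN i 0) →
      P k s' ∧ s'.nvar i = k ∧ Agree (.count i b p) s s' := by
    intro k
    induction k with
    | zero =>
      rintro - s' rfl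
      refine ⟨h0, by simp, ⟨fun j hj => ?_, fun j _ => by simp, fun j _ => by simp,
        fun j _ => by simp⟩⟩
      simp [wN] at hj
      simp [hj.1]
    | succ k ih =>
      rintro hk s' rfl
      obtain ⟨h1, h2, h3⟩ := ih (by omega) _ rfl
      rw [Function.iterate_succ_apply']
      set s₁ := (fun s' => (p.den s').setN i ((p.den s').nvar i + 1))^[k] (s.setN i 0)
      have e : (p.den s₁).nvar i = k := by rw [den_nvar (by simpa using hi), h2]
      simp only [e]
      refine ⟨hstep k (by omega) s₁ h1 h2 h3, by simp, ⟨fun j hj => ?_, fun j hj => ?_,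
        fun j hj => ?_, fun j hj => ?_⟩⟩
      · have := h3.nvar j hj
        simp [wN] at hj
        rw [State.setN_nvar, if_neg hj.1, den_nvar (by simpa using hj.2), this]
      · have := h3.rvar j hj
        simp only [wR] at hj
        rw [State.setN_rvar, den_rvar hj, this]
      · have := h3.narr j hj
        simp only [wNA] at hj
        rw [State.setN_narr, den_narr hj, this]
      · have := h3.rarr j hj
        simp only [wRA] at hj
        rw [State.setN_rarr, den_rarr hj, this]
  rw [den]
  exact (key _ le_rfl _ rfl).1

/-- The running time of a well-formed program whose loop bounds are not modified: polynomial in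
`N`, with the exponent `deg` and a factor that depends on the program only. -/
theorem exec_compile (w : ℕ → ℕ) (A : ℕ) (p : FProg) (hwf : p.wf = true)
    (hb : ∀ b ∈ p.bounds, p.wN.contains b = false) :
    ∃ c, ∀ (s : State) (N : ℕ), 1 ≤ N → (∀ b ∈ p.bounds, s.nvar b ≤ A * N ^ w b) →
      ∃ t, Exec p.compile s t (p.den s) ∧ t ≤ c * N ^ p.deg w := by
  induction p with
  | skip => exact ⟨1, fun s N _ _ => ⟨_, by rw [den_skip]; exact .skip s, by simp [deg]⟩⟩
  | setN i e =>
    exact ⟨e.cost + 1, fun s N _ _ => ⟨_, by rw [den_setN]; exact .setN s i e, by simp [deg]⟩⟩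
  | setR i e =>
    exact ⟨e.cost + 1, fun s N _ _ => ⟨_, by rw [den_setR]; exact .setR s i e, by simp [deg]⟩⟩
  | putN a i e =>
    exact ⟨i.cost + e.cost + 1, fun s N _ _ =>
      ⟨_, by rw [den_putN]; exact .putN s a i e, by simp [deg]⟩⟩
  | putR a i e =>
    exact ⟨i.cost + e.cost + 1, fun s N _ _ =>
      ⟨_, by rw [den_putR]; exact .putR s a i e, by simp [deg]⟩⟩
  | seq p q hp hq =>
    simp only [wf, Bool.and_eq_true] at hwf
    simp [bounds, wN] at hb
    obtain ⟨c, hc⟩ := hp hwf.1 (fun b h => by simpa using (hb b (.inl h)).1)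
    obtain ⟨c', hc'⟩ := hq hwf.2 (fun b h => by simpa using (hb b (.inr h)).2)
    refine ⟨c + c', fun s N hN hs => ?_⟩
    obtain ⟨t, h, ht⟩ := hc s N hN (fun b h => hs b (by simp [bounds, h]))
    obtain ⟨t', h', ht'⟩ := hc' (p.den s) N hN (fun b h => by
      rw [den_nvar (by simpa using (hb b (.inr h)).1)]; exact hs b (by simp [bounds, h]))
    refine ⟨t + t', ?_, ?_⟩
    · rw [den_seq]; exact .seq h h'
    · calc t + t' ≤ c * N ^ p.deg w + c' * N ^ q.deg w := by omega
        _ ≤ c * N ^ (p ;; q).deg w + c' * N ^ (p ;; q).deg w := by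
          gcongr <;> first | exact hN | simp [deg]
        _ = _ := by ring
  | ite b p q hp hq =>
    simp only [wf, Bool.and_eq_true] at hwf
    simp [bounds, wN] at hb
    obtain ⟨c, hc⟩ := hp hwf.1 (fun b h => by simpa using (hb b (.inl h)).1)
    obtain ⟨c', hc'⟩ := hq hwf.2 (fun b h => by simpa using (hb b (.inr h)).2)
    refine ⟨b.cost + 1 + c + c', fun s N hN hs => ?_⟩
    have h1 : 1 ≤ N ^ (FProg.ite b p q).deg w := Nat.one_le_pow _ _ hN
    by_cases hbs : b.holds s
    · obtain ⟨t, h, ht⟩ := hc s N hN (fun b h => hs b (by simp [bounds, h]))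
      refine ⟨_, by rw [den_ite_pos _ _ hbs]; exact .iteTrue hbs h, ?_⟩
      have : N ^ p.deg w ≤ N ^ (FProg.ite b p q).deg w := Nat.pow_le_pow_right hN (by simp [deg])
      nlinarith [Nat.zero_le c', Nat.mul_le_mul_left c this, Nat.mul_le_mul_left (b.cost + 1) h1,
        Nat.zero_le (c' * N ^ (FProg.ite b p q).deg w)]
    · obtain ⟨t, h, ht⟩ := hc' s N hN (fun b h => hs b (by simp [bounds, h]))
      refine ⟨_, by rw [den_ite_neg _ _ hbs]; exact .iteFalse hbs h, ?_⟩
      have : N ^ q.deg w ≤ N ^ (FProg.ite b p q).deg w := Nat.pow_le_pow_right hN (by simp [deg])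
      nlinarith [Nat.zero_le c, Nat.mul_le_mul_left c' this, Nat.mul_le_mul_left (b.cost + 1) h1,
        Nat.zero_le (c * N ^ (FProg.ite b p q).deg w)]
  | count i b p hp =>
    simp [wf] at hwf
    obtain ⟨⟨⟨hwf, hi⟩, hbw⟩, hib⟩ := hwf
    simp [bounds, wN] at hb
    obtain ⟨c, hc⟩ := hp hwf (fun b h => by simpa using (hb.2 b h).2)
    refine ⟨7 + A * (9 + c), fun s N hN hs => ?_⟩
    let step : State → State := fun s' => (p.den s').setN i ((p.den s').nvar i + 1)
    have key : ∀ j : ℕ, ∀ s' : State, s'.nvar i + j = s.nvar b →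
        (∀ b' ∈ b :: p.bounds, s'.nvar b' = s.nvar b') →
        ∃ t, Exec (.loop (.not (.nle (.var b) (.var i)))
          (.seq p.compile (.setN i (.add (.var i) (.const 1))))) s' t (step^[j] s') ∧
          t ≤ 5 + j * (9 + c * N ^ p.deg w) := by
      intro j
      induction j with
      | zero =>
        intro s' h1 h2
        refine ⟨_, .loopStop ?_, ?_⟩
        · have := h2 b (by simp)
          simp [BExpr.holds, NExpr.eval]; omega
        · simp [BExpr.cost, NExpr.cost]
      | succ j ih =>
        intro s' h1 h2
        obtain ⟨t, h, ht⟩ := hc s' N hN (fun b' h => by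
          rw [h2 b' (by simp [h])]; exact hs b' (by simp [bounds, h]))
        have e : (p.den s').nvar i = s'.nvar i := den_nvar (by simpa using hi) s'
        obtain ⟨t', h', ht'⟩ := ih (step s') (by simp [step, e]; omega) (by
          intro b' hb'
          have hne : b' ≠ i := by
            rcases List.mem_cons.1 hb' with rfl | hb'
            · exact fun h => hib h.symm
            · exact (hb.2 b' hb').1
          have hw : p.wN.contains b' = false := by
            rcases List.mem_cons.1 hb' with rfl | hb'
            · simpa using hbw
            · simpa using (hb.2 b' hb').2
          simp only [step, State.setN_nvar, if_neg hne]
          rw [den_nvar hw, h2 b' hb'])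
        refine ⟨_, .loopStep ?_ (.seq h (.setN _ _ _)) h', ?_⟩
        · have := h2 b (by simp)
          simp [BExpr.holds, NExpr.eval]; omega
        · simp only [BExpr.cost, NExpr.cost]
          rw [Nat.add_mul]
          omega
    obtain ⟨t, h, ht⟩ := key (s.nvar b) (s.setN i 0) (by simp) (by
      intro b' hb'
      have hne : b' ≠ i := by
        rcases List.mem_cons.1 hb' with rfl | hb'
        · exact fun h => hib h.symm
        · exact (hb.2 b' hb').1
      simp [hne])
    refine ⟨_, by rw [den]; exact .seq (.setN _ _ _) h, ?_⟩
    simp only [NExpr.cost, deg]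
    have h1 : 1 ≤ N ^ w b := Nat.one_le_pow _ _ hN
    have h2 : 1 ≤ N ^ p.deg w := Nat.one_le_pow _ _ hN
    have h3 := hs b (by simp [bounds])
    have h4 : 1 ≤ N ^ (w b + p.deg w) := Nat.one_le_pow _ _ hN
    calc 1 + 1 + t ≤ 7 + s.nvar b * (9 + c * N ^ p.deg w) := by omega
      _ ≤ 7 * N ^ (w b + p.deg w) + A * N ^ w b * (9 * N ^ p.deg w + c * N ^ p.deg w) := by
        gcongr <;> omega
      _ = _ := by rw [pow_add]; ring

end FProg

/-! ### Arrangements of total functions and the addresses of points -/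

/-- An arrangement of the graphs of `m` functions. Row `d` of the table `ev` lists the abscissas
at which `f d` may change its order relative to another function: eleven candidates for each of
the functions. -/
structure Arrangement where
  m : ℕ
  f : ℕ → ℝ → ℝ
  ev : ℕ → ℕ → ℝ
  pos : 0 < m
  /-- The order of `f d` and `f e` changes only at the eleven candidates of the pair. -/
  sep : ∀ d < m, ∀ e < m, ∀ a b, a ≤ b → (∀ t < 11, ¬ (a ≤ ev d (11 * e + t) ∧
    ev d (11 * e + t) ≤ b)) → SignType.sign (f e a - f d a) = SignType.sign (f e b - f d b)

theorem sign_pos_iff {a b σ : ℝ} (h : SignType.sign a = SignType.sign b) :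
    0 < σ * a ↔ 0 < σ * b := by
  rw [← sign_eq_one_iff, ← sign_eq_one_iff, sign_mul, sign_mul, h]

theorem sign_zero_iff {a b : ℝ} (h : SignType.sign a = SignType.sign b) : a = 0 ↔ b = 0 := by
  rw [← sign_eq_zero_iff, h, sign_eq_zero_iff]

namespace Arrangement
variable (A : Arrangement)

/-- The length of the rows of the table of events. -/
def K : ℕ := 11 * A.m

/-- The row `d` has no event in the closed interval `[a, b]`. -/
def Quiet (d : ℕ) (a b : ℝ) : Prop := ∀ k < A.K, ¬ (a ≤ A.ev d k ∧ A.ev d k ≤ b)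

variable {A}

theorem Quiet.sign_eq {d : ℕ} {a b : ℝ} (h : A.Quiet d a b) (hd : d < A.m) (hab : a ≤ b)
    {e : ℕ} (he : e < A.m) :
    SignType.sign (A.f e a - A.f d a) = SignType.sign (A.f e b - A.f d b) :=
  A.sep d hd e he a b hab fun t ht => h _ (by unfold K; omega)

variable (A)

/-- Among the functions that take the same value at `X`, the first one is canonical. -/
def Canon (d : ℕ) (X : ℝ) : Prop := ∀ e < d, A.f e X ≠ A.f d X

/-- Over the abscissa `X`, the canonical neighbour of the graph number `d` on its side `σ`
(`1` is above, `-1` is below, `0` is neither) has the number `c`; here `c = d` says that there is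
none. -/
def Next (σ : ℝ) (d c : ℕ) (X : ℝ) : Prop :=
  (c ≠ d → c < A.m ∧ 0 < σ * (A.f c X - A.f d X)) ∧
    ∀ e < A.m, 0 < σ * (A.f e X - A.f d X) →
      c ≠ d ∧ (0 < σ * (A.f e X - A.f c X) ∨ (A.f e X = A.f c X ∧ c ≤ e))

variable {A}

theorem Next.unique {σ : ℝ} {d c c' : ℕ} {X : ℝ} (h : A.Next σ d c X) (h' : A.Next σ d c' X) :
    c = c' := by
  by_cases hc : c = d
  · by_cases hc' : c' = d
    · rw [hc, hc']
    · exact absurd hc (h.2 c' (h'.1 hc').1 (h'.1 hc').2).1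
  · obtain ⟨hc', h1⟩ := h'.2 c (h.1 hc).1 (h.1 hc).2
    obtain ⟨-, h2⟩ := h.2 c' (h'.1 hc').1 (h'.1 hc').2
    rcases h1 with h1 | h1
    · rcases h2 with h2 | h2
      · nlinarith
      · rw [h2.1] at h1; simp at h1
    · rcases h2 with h2 | h2
      · rw [h1.1] at h2; simp at h2
      · exact le_antisymm h2.2 h1.2

/-- A canonical neighbour persists as long as no event of the two graphs happens. -/
theorem Next.of_sign_eq {σ : ℝ} {d c : ℕ} {X X' : ℝ} (h : A.Next σ d c X)
    (hd : ∀ e < A.m, SignType.sign (A.f e X - A.f d X) = SignType.sign (A.f e X' - A.f d X'))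
    (hc : ∀ e < A.m, SignType.sign (A.f e X - A.f c X) = SignType.sign (A.f e X' - A.f c X')) :
    A.Next σ d c X' := by
  refine ⟨fun hcd => ⟨(h.1 hcd).1, (sign_pos_iff (hd c (h.1 hcd).1)).1 (h.1 hcd).2⟩,
    fun e he he' => ?_⟩
  obtain ⟨h1, h2⟩ := h.2 e he ((sign_pos_iff (hd e he)).2 he')
  refine ⟨h1, h2.imp (sign_pos_iff (hc e he)).1 fun h3 => ⟨?_, h3.2⟩⟩
  exact sub_eq_zero.1 ((sign_zero_iff (hc e he)).1 (sub_eq_zero.2 h3.1))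

theorem Next.lt {σ : ℝ} {d c : ℕ} {X : ℝ} (h : A.Next σ d c X) (hd : d < A.m) : c < A.m := by
  by_cases hc : c = d
  · exact hc ▸ hd
  · exact (h.1 hc).1

theorem Next.eq_of_zero {d c : ℕ} {X : ℝ} (h : A.Next 0 d c X) : c = d := by
  by_contra hc
  simpa using (h.1 hc).2

theorem Canon.of_sign_eq {d : ℕ} {X X' : ℝ} (h : A.Canon d X) (hdm : d < A.m)
    (hd : ∀ e < A.m, SignType.sign (A.f e X - A.f d X) = SignType.sign (A.f e X' - A.f d X')) :
    A.Canon d X' := by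
  intro e he h'
  exact h e he (sub_eq_zero.1 ((sign_zero_iff (hd e (he.trans hdm))).2 (sub_eq_zero.2 h')))

theorem Quiet.next_iff {σ : ℝ} {d c : ℕ} {a b : ℝ} (h : A.Quiet d a b) (h' : A.Quiet c a b)
    (hd : d < A.m) (hc : c < A.m) (hab : a ≤ b) : A.Next σ d c a ↔ A.Next σ d c b :=
  ⟨fun H => H.of_sign_eq (fun _ he => h.sign_eq hd hab he) (fun _ he => h'.sign_eq hc hab he),
    fun H => H.of_sign_eq (fun _ he => (h.sign_eq hd hab he).symm)
      (fun _ he => (h'.sign_eq hc hab he).symm)⟩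

theorem Quiet.canon_iff {d : ℕ} {a b : ℝ} (h : A.Quiet d a b)
    (hd : d < A.m) (hab : a ≤ b) : A.Canon d a ↔ A.Canon d b :=
  ⟨fun H => H.of_sign_eq hd (fun _ he => h.sign_eq hd hab he),
    fun H => H.of_sign_eq hd (fun _ he => (h.sign_eq hd hab he).symm)⟩

variable (A)

/-- The point `(X, Y)` lies in the cell with the address `(d, k, ρ, σ)`: on the graph `d`
(for `σ = 0`) or between this graph and its neighbour `c` on the side `σ`, at the abscissa
`ev d k` (for `ρ = 0`) or strictly to the right of it, before any further event of the two graphs;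
the index `k = K` stands for the abscissa `-∞`. The last two conditions make the address unique:
`k` is the first index of its event, and a cell that starts at an event of its lower graph is
addressed through this graph. -/
structure Addr (d k : ℕ) (ρ σ : ℝ) (c : ℕ) (X Y : ℝ) : Prop where
  d_lt : d < A.m
  k_le : k ≤ A.K
  canon : A.Canon d X
  next : A.Next σ d c X
  on_graph : σ = 0 → Y = A.f d X
  gap : σ ≠ 0 → 0 < σ * (Y - A.f d X)
  gap' : σ ≠ 0 → c ≠ d → σ * (Y - A.f c X) < 0
  start : ρ = 0 → k < A.K ∧ X = A.ev d k
  right : ρ ≠ 0 → (k < A.K → A.ev d k < X) ∧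
    ∀ j < A.K, (A.ev d j ≤ X → k < A.K ∧ A.ev d j ≤ A.ev d k) ∧
      (A.ev c j ≤ X → k < A.K ∧ A.ev c j ≤ A.ev d k)
  first : k < A.K → ∀ j < k, A.ev d j ≠ A.ev d k
  own : σ = -1 → c ≠ d → k < A.K ∧ ∀ j < A.K, A.ev c j ≠ A.ev d k

/-- The values of `ρ` and `σ` that occur in addresses. -/
def Mode (ρ σ : ℝ) : Prop := (ρ = 0 ∨ ρ = 1) ∧ (σ = -1 ∨ σ = 0 ∨ σ = 1)

variable {A}

theorem Canon.unique {d d' : ℕ} {X : ℝ} (h : A.Canon d X) (h' : A.Canon d' X)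
    (he : A.f d X = A.f d' X) : d = d' := by
  rcases lt_trichotomy d d' with hl | hl | hl
  · exact absurd he (h' d hl)
  · exact hl
  · exact absurd he.symm (h d' hl)

/-- If `c` is the neighbour above `d`, then `d` is the neighbour below `c`: the gap between two
graphs can be addressed through each of them. -/
theorem Next.flip {d c : ℕ} {X : ℝ} (h : A.Next 1 d c X) (hd : d < A.m) (hcan : A.Canon d X)
    (hcd : c ≠ d) : A.Canon c X ∧ A.Next (-1) c d X := by
  have h1 := h.1 hcd
  refine ⟨fun e he h' => ?_, fun _ => ⟨hd, by linarith [h1.2]⟩, fun e he he' => ⟨hcd.symm, ?_⟩⟩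
  · have := h.2 e (he.trans h1.1) (by rw [h']; exact h1.2)
    rcases this.2 with h2 | h2
    · rw [h'] at h2; simp at h2
    · omega
  · rcases lt_trichotomy (A.f e X) (A.f d X) with hl | hl | hl
    · left; linarith
    · right; exact ⟨hl, by by_contra hlt; exact hcan e (by omega) hl⟩
    · exfalso
      rcases (h.2 e he (by linarith)).2 with h2 | h2
      · linarith
      · linarith [h2.1]

/-- A point has at most one position relative to the graphs, up to the exchange of the floor and
the ceiling. -/
theorem Addr.position {d k ρ σ c X Y d' k' ρ' σ' c'} (h : A.Addr d k ρ σ c X Y)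
    (h' : A.Addr d' k' ρ' σ' c' X Y) (hm : Mode ρ σ) (hm' : Mode ρ' σ') :
    (σ = σ' ∧ d = d' ∧ c = c') ∨ (σ = 1 ∧ σ' = -1 ∧ c = d' ∧ d = c' ∧ c ≠ d) ∨
      (σ = -1 ∧ σ' = 1 ∧ c = d' ∧ d = c' ∧ c ≠ d) := by
  have mixed : ∀ {d k ρ c d' k' ρ' σ' c'}, A.Addr d k ρ 0 c X Y →
      A.Addr d' k' ρ' σ' c' X Y → σ' ≠ 0 → False := by
    intro d k ρ c d' k' ρ' σ' c' h h' hs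
    have hY := h.on_graph rfl
    have h1 := h'.gap hs
    rw [hY] at h1
    obtain ⟨hc, h2⟩ := h'.next.2 d h.d_lt h1
    have h3 := h'.gap' hs hc
    rw [hY] at h3
    rcases h2 with h2 | h2
    · linarith
    · rw [h2.1] at h3; simp at h3
  have noless : ∀ {d k ρ c d' k' ρ' σ c'}, A.Addr d k ρ σ c X Y →
      A.Addr d' k' ρ' σ c' X Y → σ ≠ 0 → ¬ 0 < σ * (A.f d' X - A.f d X) := by
    intro d k ρ c d' k' ρ' σ c' h h' hs hlt
    obtain ⟨hc, h2⟩ := h.next.2 d' h'.d_lt hlt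
    have h3 := h.gap' hs hc
    have h4 := h'.gap hs
    rcases h2 with h2 | h2
    · nlinarith
    · rw [h2.1] at h4; linarith
  have same : ∀ {d k ρ c d' k' ρ' σ c'}, A.Addr d k ρ σ c X Y →
      A.Addr d' k' ρ' σ c' X Y → σ ≠ 0 → d = d' := by
    intro d k ρ c d' k' ρ' σ c' h h' hs
    refine h.canon.unique h'.canon ?_
    have h1 := noless h h' hs
    have h2 := noless h' h hs
    have : σ * (A.f d' X - A.f d X) = 0 := by nlinarith
    rcases mul_eq_zero.1 this with h3 | h3
    · exact absurd h3 hs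
    · linarith
  have opp : ∀ {d k ρ c d' k' ρ' c'}, A.Addr d k ρ 1 c X Y →
      A.Addr d' k' ρ' (-1) c' X Y → c = d' ∧ d = c' ∧ c ≠ d := by
    intro d k ρ c d' k' ρ' c' h h'
    have g := h.gap (by norm_num)
    have g' := h'.gap (by norm_num)
    obtain ⟨hcd, h1⟩ := h.next.2 d' h'.d_lt (by linarith)
    have g2 := h.gap' (by norm_num) hcd
    obtain ⟨hcd', h1'⟩ := h'.next.2 d h.d_lt (by linarith)
    have g2' := h'.gap' (by norm_num) hcd'
    obtain ⟨hcan, hflip⟩ := h.next.flip h.d_lt h.canon hcd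
    have e : A.f c X = A.f d' X := by
      rcases h1 with h1 | h1
      · exfalso
        rcases (h'.next.2 c (h.next.1 hcd).1 (by linarith)).2 with h2 | h2
        · linarith
        · linarith [h2.1]
      · exact h1.1.symm
    have ec := hcan.unique h'.canon e
    subst ec
    exact ⟨rfl, hflip.unique h'.next, hcd⟩
  rcases hm.2 with rfl | rfl | rfl <;> rcases hm'.2 with rfl | rfl | rfl
  · have := same h h' (by norm_num); subst this
    exact .inl ⟨rfl, rfl, h.next.unique h'.next⟩
  · exact (mixed h' h (by norm_num)).elim
  · obtain ⟨h1, h2, h3⟩ := opp h' h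
    exact .inr (.inr ⟨rfl, rfl, h2.symm, h1.symm, fun hh => h3 (by rw [h1, h2, hh])⟩)
  · exact (mixed h h' (by norm_num)).elim
  · have := h.canon.unique h'.canon ((h.on_graph rfl).symm.trans (h'.on_graph rfl)); subst this
    exact .inl ⟨rfl, rfl, h.next.unique h'.next⟩
  · exact (mixed h h' (by norm_num)).elim
  · obtain ⟨h1, h2, h3⟩ := opp h h'
    exact .inr (.inl ⟨rfl, rfl, h1, h2, h3⟩)
  · exact (mixed h' h (by norm_num)).elim
  · have := same h h' (by norm_num); subst this
    exact .inl ⟨rfl, rfl, h.next.unique h'.next⟩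

/-- A gap is not addressed both through its floor and through its ceiling. By `own`, the left end
for the ceiling is no event of the floor. If both addresses held, each of the two left ends would
be at or before the other one, hence they would coincide. -/
theorem Addr.not_opposite {d k ρ c X Y k' ρ'} (h : A.Addr d k ρ 1 c X Y)
    (h' : A.Addr c k' ρ' (-1) d X Y) (hcd : c ≠ d) : False := by
  obtain ⟨hk', hown⟩ := h'.own rfl hcd.symm
  by_cases hr : ρ = 0 <;> by_cases hr' : ρ' = 0
  · obtain ⟨hk, hx⟩ := h.start hr
    obtain ⟨-, hx'⟩ := h'.start hr'
    exact hown k hk (by rw [← hx, ← hx'])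
  · obtain ⟨hk, hx⟩ := h.start hr
    have h1 := h'.right hr'
    have := ((h1.2 k hk).2 hx.ge).2
    linarith [h1.1 hk']
  · obtain ⟨-, hx'⟩ := h'.start hr'
    have h1 := h.right hr
    have := (h1.2 k' hk').2 hx'.ge
    linarith [h1.1 this.1]
  · have h1 := h'.right hr'
    have h2 := h.right hr
    have h3 := (h2.2 k' hk').2 (h1.1 hk').le
    have h4 := (h1.2 k h3.1).2 (h2.1 h3.1).le
    exact hown k h3.1 (le_antisymm h4.2 h3.2)

/-- The cells of different addresses are disjoint. -/
theorem Addr.unique {d k ρ σ c X Y d' k' ρ' σ' c'} (h : A.Addr d k ρ σ c X Y)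
    (h' : A.Addr d' k' ρ' σ' c' X Y) (hm : Mode ρ σ) (hm' : Mode ρ' σ') :
    d = d' ∧ k = k' ∧ ρ = ρ' ∧ σ = σ' := by
  rcases h.position h' hm hm' with ⟨rfl, rfl, rfl⟩ | ⟨rfl, rfl, rfl, rfl, hcd⟩ |
    ⟨rfl, rfl, rfl, rfl, hcd⟩
  · have hidx : k < A.K → k' < A.K → A.ev d k = A.ev d k' → k = k' := by
      intro hk hk' he
      rcases lt_trichotomy k k' with hl | hl | hl
      · exact absurd he (h'.first hk' k hl)
      · exact hl
      · exact absurd he.symm (h.first hk k' hl)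
    have mixed : ∀ {k ρ k' ρ'}, A.Addr d k ρ σ c X Y → A.Addr d k' ρ' σ c X Y →
        ρ = 0 → ρ' ≠ 0 → False := by
      intro k ρ k' ρ' h h' h0 h1
      obtain ⟨hk, hx⟩ := h.start h0
      have h2 := h'.right h1
      have h3 := (h2.2 k hk).1 hx.ge
      linarith [h2.1 h3.1]
    rcases hm.1 with rfl | rfl <;> rcases hm'.1 with rfl | rfl
    · obtain ⟨hk, hx⟩ := h.start rfl
      obtain ⟨hk', hx'⟩ := h'.start rfl
      exact ⟨rfl, hidx hk hk' (hx.symm.trans hx'), rfl, rfl⟩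
    · exact (mixed h h' rfl (by norm_num)).elim
    · exact (mixed h' h rfl (by norm_num)).elim
    · have h1 := h.right (by norm_num)
      have h1' := h'.right (by norm_num)
      refine ⟨rfl, ?_, rfl, rfl⟩
      by_cases hk : k < A.K
      · have h2 := (h1'.2 k hk).1 (h1.1 hk).le
        have h3 := (h1.2 k' h2.1).1 (h1'.1 h2.1).le
        exact hidx hk h2.1 (le_antisymm h2.2 h3.2)
      · have : ¬ k' < A.K := fun hk' => hk ((h1.2 k' hk').1 (h1'.1 hk').le).1
        have := h.k_le; have := h'.k_le; omega
  · exact (h.not_opposite h' hcd).elim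
  · exact (h'.not_opposite h hcd.symm).elim

theorem exists_next (σ : ℝ) (d : ℕ) (X : ℝ) : ∃ c, A.Next σ d c X := by
  classical
  by_cases hne : ∃ e < A.m, 0 < σ * (A.f e X - A.f d X)
  · let S := (Finset.range A.m).filter fun e => 0 < σ * (A.f e X - A.f d X)
    have hS : S.Nonempty := by
      obtain ⟨e, he, h⟩ := hne
      exact ⟨e, by simp [S, he, h]⟩
    -- the least value in the direction `σ`, and the least index with this value
    obtain ⟨e₀, he₀, hmin⟩ := S.exists_min_image (fun e => σ * A.f e X) hS
    let S' := S.filter fun e => A.f e X = A.f e₀ X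
    have hS' : S'.Nonempty := ⟨e₀, by simp [S', he₀]⟩
    have hc := S'.min'_mem hS'
    set c := S'.min' hS' with hcdef
    simp only [S', S, Finset.mem_filter, Finset.mem_range] at hc he₀
    obtain ⟨⟨hcm, hcpos⟩, hce⟩ := hc
    refine ⟨c, fun _ => ⟨hcm, hcpos⟩, fun e he hpos => ⟨?_, ?_⟩⟩
    · intro hcd
      rw [hcd] at hcpos
      simp at hcpos
    · have h1 := hmin e (by simp [S, he, hpos])
      by_cases heq : A.f e X = A.f e₀ X
      · right
        exact ⟨by rw [heq, hce], S'.min'_le e (by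
          simp only [S', S, Finset.mem_filter, Finset.mem_range]
          exact ⟨⟨he, hpos⟩, heq⟩)⟩
      · left
        have hσ : σ ≠ 0 := by rintro rfl; simp at hpos
        have h2 : σ * A.f e X ≠ σ * A.f e₀ X := fun h => heq (mul_left_cancel₀ hσ h)
        rw [hce]
        have := lt_of_le_of_ne h1 h2.symm
        linarith
  · push Not at hne
    exact ⟨d, fun h => absurd rfl h, fun e he h => absurd h (not_lt.2 (hne e he))⟩

theorem exists_canon {d : ℕ} (hd : d < A.m) (X : ℝ) :
    ∃ d' < A.m, A.Canon d' X ∧ A.f d' X = A.f d X := by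
  classical
  have hex : ∃ e, A.f e X = A.f d X := ⟨d, rfl⟩
  refine ⟨Nat.find hex, (Nat.find_min' hex rfl).trans_lt hd, fun e he h => ?_, Nat.find_spec hex⟩
  exact Nat.find_min hex he (h.trans (Nat.find_spec hex))

/-- Every point lies on a canonical graph, or above a canonical graph with nothing in between, or
below all graphs. -/
theorem exists_position (X Y : ℝ) : ∃ d < A.m, ∃ σ c, (σ = -1 ∨ σ = 0 ∨ σ = 1) ∧
    A.Canon d X ∧ A.Next σ d c X ∧ (σ = 0 → Y = A.f d X) ∧ (σ ≠ 0 → 0 < σ * (Y - A.f d X)) ∧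
    (σ ≠ 0 → c ≠ d → σ * (Y - A.f c X) < 0) ∧ (σ = -1 → c = d) := by
  classical
  have hne := A.pos
  by_cases hon : ∃ d < A.m, A.f d X = Y
  · obtain ⟨d, hd, h⟩ := hon
    obtain ⟨d', hd', hc, he⟩ := exists_canon hd X
    obtain ⟨c, hn⟩ := A.exists_next 0 d' X
    exact ⟨d', hd', 0, c, by simp, hc, hn, fun _ => by rw [he, h], by simp, by simp, by norm_num⟩
  push Not at hon
  by_cases hbel : ∃ d < A.m, A.f d X < Y
  · let S := (Finset.range A.m).filter fun e => A.f e X < Y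
    have hS : S.Nonempty := by
      obtain ⟨e, he, h⟩ := hbel
      exact ⟨e, by simp [S, he, h]⟩
    obtain ⟨e₀, he₀, hmax⟩ := S.exists_max_image (fun e => A.f e X) hS
    simp only [S, Finset.mem_filter, Finset.mem_range] at he₀ hmax
    obtain ⟨d, hd, hc, he⟩ := exists_canon he₀.1 X
    obtain ⟨c, hn⟩ := A.exists_next 1 d X
    refine ⟨d, hd, 1, c, by simp, hc, hn, by norm_num, fun _ => by linarith [he₀.2],
      fun _ hcd => ?_, by norm_num⟩
    have h1 := hn.1 hcd
    by_contra hge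
    have h2 : A.f c X < Y := lt_of_le_of_ne (by linarith) (hon c h1.1)
    linarith [hmax c ⟨h1.1, h2⟩]
  · push Not at hbel
    obtain ⟨e₀, he₀, hmin⟩ := (Finset.range A.m).exists_min_image (fun e => A.f e X)
      ⟨0, by simpa using hne⟩
    simp only [Finset.mem_range] at he₀ hmin
    obtain ⟨d, hd, hc, he⟩ := exists_canon he₀ X
    refine ⟨d, hd, -1, d, by simp, hc, ⟨fun h => absurd rfl h, fun e hem hpos => ?_⟩, by norm_num,
      fun _ => ?_, fun _ h => absurd rfl h, fun _ => rfl⟩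
    · linarith [hmin e hem]
    · linarith [lt_of_le_of_ne (hbel d hd) (hon d hd).symm]

/-- The cells cover the plane. The address starts at the last event of the two graphs that is not
to the right of the point. For a gap with two sides, this decides through which of the two graphs it
is addressed. -/
theorem exists_addr (X Y : ℝ) : ∃ d k ρ σ c, Mode ρ σ ∧ A.Addr d k ρ σ c X Y := by
  classical
  obtain ⟨d, hd, σ, c, hσ, hcan, hn, h0, hg, hg', hown⟩ := A.exists_position X Y
  by_cases hev : ∃ r, (r = d ∨ r = c) ∧ ∃ j < A.K, A.ev r j ≤ X
  · -- the last event of the two rows that is not to the right of `X`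
    obtain ⟨r, hr, j, hj, hjX, hmax⟩ : ∃ r, (r = d ∨ r = c) ∧ ∃ j < A.K, A.ev r j ≤ X ∧
        ∀ r', (r' = d ∨ r' = c) → ∀ j' < A.K, A.ev r' j' ≤ X → A.ev r' j' ≤ A.ev r j := by
      let S := (({d, c} : Finset ℕ) ×ˢ Finset.range A.K).filter fun q => A.ev q.1 q.2 ≤ X
      have hS : S.Nonempty := by
        obtain ⟨r, hr, j, hj, h⟩ := hev
        exact ⟨(r, j), by simp [S, hr, hj, h]⟩
      obtain ⟨q, hq, hmax⟩ := S.exists_max_image (fun q => A.ev q.1 q.2) hS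
      simp only [S, Finset.mem_filter, Finset.mem_product, Finset.mem_insert,
        Finset.mem_singleton, Finset.mem_range] at hq hmax
      exact ⟨q.1, hq.1.1, q.2, hq.1.2, hq.2, fun r' hr' j' hj' h' =>
        hmax (r', j') ⟨⟨hr', hj'⟩, h'⟩⟩
    have key : ∀ {d c σ}, d < A.m → (σ = -1 ∨ σ = 0 ∨ σ = 1) → A.Canon d X → A.Next σ d c X →
        (σ = 0 → Y = A.f d X) → (σ ≠ 0 → 0 < σ * (Y - A.f d X)) →
        (σ ≠ 0 → c ≠ d → σ * (Y - A.f c X) < 0) → ∀ j < A.K, A.ev d j ≤ X →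
        (∀ r', (r' = d ∨ r' = c) → ∀ j' < A.K, A.ev r' j' ≤ X → A.ev r' j' ≤ A.ev d j) →
        (σ = -1 → c ≠ d → ∀ j' < A.K, A.ev c j' ≠ A.ev d j) →
        ∃ d k ρ σ c, Mode ρ σ ∧ A.Addr d k ρ σ c X Y := by
      intro d c σ hd hσ hcan hn h0 hg hg' j hj hjX hmax hown
      have hex : ∃ k, A.ev d k = A.ev d j := ⟨j, rfl⟩
      have hk := Nat.find_spec hex
      have hkj := Nat.find_min' hex rfl
      have hfirst : ∀ i < Nat.find hex, A.ev d i ≠ A.ev d (Nat.find hex) :=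
        fun i hi h => Nat.find_min hex hi (h.trans hk)
      set k := Nat.find hex
      rcases eq_or_lt_of_le hjX with he | hlt
      · exact ⟨d, k, 0, σ, c, ⟨by simp, hσ⟩, hd, by omega, hcan, hn, h0, hg, hg',
          fun _ => ⟨by omega, by rw [hk, he]⟩, by simp, fun _ => hfirst,
          fun h h' => ⟨by omega, by rw [hk]; exact hown h h'⟩⟩
      · refine ⟨d, k, 1, σ, c, ⟨by simp, hσ⟩, hd, by omega, hcan, hn, h0, hg, hg', by norm_num,
          fun _ => ⟨fun _ => by rw [hk]; exact hlt, fun i hi => ⟨fun h => ⟨by omega, ?_⟩,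
            fun h => ⟨by omega, ?_⟩⟩⟩, fun _ => hfirst,
          fun h h' => ⟨by omega, by rw [hk]; exact hown h h'⟩⟩
        · rw [hk]; exact hmax d (.inl rfl) i hi h
        · rw [hk]; exact hmax c (.inr rfl) i hi h
    by_cases hind : ∃ j' < A.K, A.ev d j' = A.ev r j
    · obtain ⟨j', hj', he⟩ := hind
      refine key hd hσ hcan hn h0 hg hg' j' hj' (by rw [he]; exact hjX) (by rw [he]; exact hmax) ?_
      intro h1 h2
      exact absurd (hown h1) h2
    · -- the event belongs to the ceiling only
      have hrc : r = c := by
        rcases hr with rfl | rfl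
        · exact absurd ⟨j, hj, rfl⟩ hind
        · rfl
      subst hrc
      have hcd : r ≠ d := by rintro rfl; exact hind ⟨j, hj, rfl⟩
      have hσ1 : σ = 1 := by
        rcases hσ with rfl | rfl | rfl
        · exact absurd (hown rfl) hcd
        · exact absurd hn.eq_of_zero hcd
        · rfl
      subst hσ1
      obtain ⟨hcan', hn'⟩ := hn.flip hd hcan hcd
      have g1 := hg (by norm_num)
      have g2 := hg' (by norm_num) hcd
      refine key (hn.1 hcd).1 (by simp) hcan' hn' (by norm_num) (fun _ => by linarith)
        (fun _ _ => by linarith) j hj hjX (fun r' hr' => hmax r' hr'.symm) ?_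
      intro _ _ j' hj' h
      exact hind ⟨j', hj', h⟩
  · push Not at hev
    refine ⟨d, A.K, 1, σ, c, ⟨by simp, hσ⟩, hd, le_rfl, hcan, hn, h0, hg, hg', by norm_num,
      fun _ => ⟨fun h => absurd h (lt_irrefl _), fun i hi => ⟨fun h => ?_, fun h => ?_⟩⟩,
      fun h => absurd h (lt_irrefl _), fun h h' => absurd (hown h) h'⟩
    · exact absurd h (not_le.2 (hev d (.inl rfl) i hi))
    · exact absurd h (not_le.2 (hev c (.inr rfl) i hi))

/-- Between two points of an open cell, the two graphs that bound it have no events. -/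
theorem Addr.quiet {d k ρ σ c X Y} (h : A.Addr d k ρ σ c X Y) (hρ : ρ ≠ 0) {a : ℝ}
    (ha : k < A.K → A.ev d k < a) : A.Quiet d a X ∧ A.Quiet c a X := by
  have h1 := h.right hρ
  refine ⟨fun j hj h2 => ?_, fun j hj h2 => ?_⟩
  · have h3 := (h1.2 j hj).1 h2.2
    linarith [ha h3.1, h2.1]
  · have h3 := (h1.2 j hj).2 h2.2
    linarith [ha h3.1, h2.1]

theorem Addr.neighbour_eq {d k ρ σ c X Y c' X' Y'} (h : A.Addr d k ρ σ c X Y)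
    (h' : A.Addr d k ρ σ c' X' Y') : c = c' := by
  wlog hXX : X ≤ X' generalizing X Y X' Y' c c'
  · exact (this h' h (le_of_not_ge hXX)).symm
  by_cases hρ : ρ = 0
  · have := (h.start hρ).2.trans (h'.start hρ).2.symm
    subst this
    exact h.next.unique h'.next
  · obtain ⟨h1, h2⟩ := h'.quiet hρ (h.right hρ).1
    exact h.next.unique ((h1.next_iff h2 h.d_lt (h'.next.lt h.d_lt) hXX).2 h'.next)

/-- All the points of a cell are on the same side of each graph. -/
theorem Addr.sign_eq {d k ρ σ c X Y c' X' Y'} (h : A.Addr d k ρ σ c X Y)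
    (h' : A.Addr d k ρ σ c' X' Y') {e : ℕ} (he : e < A.m) :
    SignType.sign (Y - A.f e X) = SignType.sign (Y' - A.f e X') := by
  have hc := h.neighbour_eq h'
  subst hc
  have hcm := h.next.lt h.d_lt
  have hsd : SignType.sign (A.f e X - A.f d X) = SignType.sign (A.f e X' - A.f d X') ∧
      SignType.sign (A.f e X - A.f c X) = SignType.sign (A.f e X' - A.f c X') := by
    wlog hXX : X ≤ X' generalizing X Y X' Y'
    · have := this h' h (le_of_not_ge hXX)
      exact ⟨this.1.symm, this.2.symm⟩
    by_cases hρ : ρ = 0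
    · have := (h.start hρ).2.trans (h'.start hρ).2.symm
      subst this
      exact ⟨rfl, rfl⟩
    · obtain ⟨h1, h2⟩ := h'.quiet hρ (h.right hρ).1
      exact ⟨h1.sign_eq h.d_lt hXX he, h2.sign_eq hcm hXX he⟩
  -- on the side `σ` of `d`, the graph `e` is not strictly between `d` and `c`
  have side : ∀ {X Y}, A.Addr d k ρ σ c X Y → σ ≠ 0 →
      (0 < σ * (A.f e X - A.f d X) → σ * (Y - A.f e X) < 0) ∧
      (¬ 0 < σ * (A.f e X - A.f d X) → 0 < σ * (Y - A.f e X)) := by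
    intro X Y h hs
    refine ⟨fun hpos => ?_, fun hpos => ?_⟩
    · obtain ⟨h1, h2⟩ := h.next.2 e he hpos
      have h3 := h.gap' hs h1
      rcases h2 with h2 | h2
      · nlinarith
      · rw [h2.1]; exact h3
    · have := h.gap hs
      nlinarith
  by_cases hs : σ = 0
  · rw [h.on_graph hs, h'.on_graph hs, ← neg_sub (A.f e X), ← neg_sub (A.f e X'),
      Left.sign_neg, Left.sign_neg, hsd.1]
  · have s1 := side h hs
    have s2 := side h' hs
    have hiff := sign_pos_iff (σ := σ) hsd.1
    have hmul : SignType.sign (σ * (Y - A.f e X)) = SignType.sign (σ * (Y' - A.f e X')) := by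
      by_cases hpos : 0 < σ * (A.f e X - A.f d X)
      · rw [sign_neg (s1.1 hpos), sign_neg (s2.1 (hiff.1 hpos))]
      · rw [sign_pos (s1.2 hpos), sign_pos (s2.2 (fun h => hpos (hiff.2 h)))]
    rw [sign_mul, sign_mul] at hmul
    exact mul_left_cancel₀ (by simpa [sign_eq_zero_iff] using hs) hmul

/-- All the points of a cell are on the same side of each event of its first graph. -/
theorem Addr.sign_ev_eq {d k ρ σ c X Y c' X' Y'} (h : A.Addr d k ρ σ c X Y)
    (h' : A.Addr d k ρ σ c' X' Y') {j : ℕ} (hj : j < A.K) :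
    SignType.sign (X - A.ev d j) = SignType.sign (X' - A.ev d j) := by
  by_cases hρ : ρ = 0
  · rw [(h.start hρ).2, (h'.start hρ).2]
  · have h1 := h.right hρ
    have h2 := h'.right hρ
    by_cases hle : A.ev d j ≤ X
    · have h3 := (h1.2 j hj).1 hle
      rw [sign_pos (by linarith [h1.1 h3.1]), sign_pos (by linarith [h2.1 h3.1])]
    · have hle' : ¬ A.ev d j ≤ X' := by
        intro hle'
        have h3 := (h2.2 j hj).1 hle'
        linarith [h1.1 h3.1]
      rw [sign_neg (by linarith), sign_neg (by linarith)]

/-! ### Sample points -/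

variable (A)

/-- The abscissa `x` and the neighbour `c` have been found for the address `(d, k, ρ, σ)`:
`l` is the abscissa of the event number `k` of row `d`, or an abscissa to the left of all events;
`x = l` or `x` is so close to the right of `l` that the graphs `d` and `c` have no further events
up to `x`. -/
structure Sampled (d k : ℕ) (ρ σ : ℝ) (l : ℝ) (c : ℕ) (x : ℝ) : Prop where
  d_lt : d < A.m
  k_le : k ≤ A.K
  left : k < A.K → l = A.ev d k
  left_none : k = A.K → ∀ r < A.m, ∀ j < A.K, l < A.ev r j
  start : ρ = 0 → x = l
  lt : ρ ≠ 0 → l < x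
  next : A.Next σ d c x
  quiet : ∀ j < A.K, ¬ (l < A.ev d j ∧ A.ev d j ≤ x)
  quiet' : ∀ j < A.K, ¬ (l < A.ev c j ∧ A.ev c j ≤ x)

/-- The conditions for the address to be in use, as they are tested at the sample point. -/
structure Tests (d k : ℕ) (ρ σ : ℝ) (l : ℝ) (c : ℕ) (x : ℝ) : Prop where
  canon : A.Canon d x
  first : ∀ j < k, j < A.K → A.ev d j ≠ l
  own : σ = -1 → c ≠ d → k < A.K ∧ ∀ j < A.K, A.ev c j ≠ l
  start : ρ = 0 → k < A.K

variable {A}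

/-- If the tests succeed, then the sample point has the address. -/
theorem Sampled.addr {d k ρ σ l c x y} (h : A.Sampled d k ρ σ l c x) (ht : A.Tests d k ρ σ l c x)
    (h0 : σ = 0 → y = A.f d x) (hg : σ ≠ 0 → 0 < σ * (y - A.f d x))
    (hg' : σ ≠ 0 → c ≠ d → σ * (y - A.f c x) < 0) : A.Addr d k ρ σ c x y := by
  have hc := h.next.lt h.d_lt
  refine ⟨h.d_lt, h.k_le, ht.canon, h.next, h0, hg, hg', fun hρ => ⟨ht.start hρ, ?_⟩,
    fun hρ => ⟨fun hk => ?_, fun j hj => ⟨fun hle => ?_, fun hle => ?_⟩⟩, fun hk j hj => ?_,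
    fun h1 h2 => ?_⟩
  · rw [h.start hρ, h.left (ht.start hρ)]
  · rw [← h.left hk]; exact h.lt hρ
  · have h1 : A.ev d j ≤ l := by by_contra h'; exact h.quiet j hj ⟨by linarith, hle⟩
    have hk : k < A.K := by
      by_contra hk
      have := h.left_none (le_antisymm h.k_le (not_lt.1 hk)) d h.d_lt j hj
      linarith
    exact ⟨hk, by rw [← h.left hk]; exact h1⟩
  · have h1 : A.ev c j ≤ l := by by_contra h'; exact h.quiet' j hj ⟨by linarith, hle⟩
    have hk : k < A.K := by
      by_contra hk
      have := h.left_none (le_antisymm h.k_le (not_lt.1 hk)) c hc j hj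
      linarith
    exact ⟨hk, by rw [← h.left hk]; exact h1⟩
  · rw [← h.left hk]; exact ht.first j hj (hj.trans hk)
  · obtain ⟨hk, h3⟩ := ht.own h1 h2
    exact ⟨hk, by rw [← h.left hk]; exact h3⟩

/-- If the address is in use at all, then the tests succeed at the sample point. -/
theorem Sampled.tests {d k ρ σ l c x c' X Y} (h : A.Sampled d k ρ σ l c x)
    (ha : A.Addr d k ρ σ c' X Y) : A.Tests d k ρ σ l c x := by
  have hc := h.next.lt h.d_lt
  have hc' := ha.next.lt h.d_lt
  have key : c = c' ∧ A.Canon d x := by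
    by_cases hρ : ρ = 0
    · obtain ⟨hk, hX⟩ := ha.start hρ
      have : X = x := by rw [hX, h.start hρ, h.left hk]
      subst this
      exact ⟨h.next.unique ha.next, ha.canon⟩
    · -- compare at an abscissa `a` to the left of both `x` and `X`
      set a := min x X with hadef
      have hlx := h.lt hρ
      have hla : k < A.K → A.ev d k < a := fun hk =>
        lt_min (by rw [← h.left hk]; exact hlx) ((ha.right hρ).1 hk)
      obtain ⟨q1, q2⟩ := ha.quiet hρ hla
      have q3 : ∀ r < A.m, (∀ j < A.K, ¬ (l < A.ev r j ∧ A.ev r j ≤ x)) → A.Quiet r a x := by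
        intro r hr hq j hj h2
        refine hq j hj ⟨?_, h2.2⟩
        by_cases hk : k < A.K
        · rw [h.left hk]; exact (hla hk).trans_le h2.1
        · exact h.left_none (le_antisymm h.k_le (not_lt.1 hk)) r hr j hj
      have q4 := q3 d h.d_lt h.quiet
      have q5 := q3 c hc h.quiet'
      have ha1 := (q4.next_iff q5 h.d_lt hc (min_le_left _ _)).2 h.next
      have ha2 := (q1.next_iff q2 h.d_lt hc' (min_le_right _ _)).2 ha.next
      exact ⟨ha1.unique ha2, (q4.canon_iff h.d_lt (min_le_left _ _)).1
        ((q1.canon_iff h.d_lt (min_le_right _ _)).2 ha.canon)⟩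
  obtain ⟨rfl, hcan⟩ := key
  refine ⟨hcan, fun j hj hjK => ?_, fun h1 h2 => ?_, fun hρ => (ha.start hρ).1⟩
  · by_cases hk : k < A.K
    · rw [h.left hk]; exact ha.first hk j hj
    · exact (h.left_none (le_antisymm h.k_le (not_lt.1 hk)) d h.d_lt j hjK).ne'
  · obtain ⟨hk, h3⟩ := ha.own h1 h2
    exact ⟨hk, by rw [h.left hk]; exact h3⟩

/-- The abscissas of an open cell with the sample point `x`: they extend from the event number `k`
to the next event of the two graphs. -/
def InSpan (A : Arrangement) (d k c : ℕ) (x X : ℝ) : Prop :=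
  (k < A.K → A.ev d k < X) ∧
    ∀ j < A.K, (x < A.ev d j → X < A.ev d j) ∧ (x < A.ev c j → X < A.ev c j)

/-- The points with the address of a sample point form a cell: over the abscissas in its span, the
graphs `d` and `c` remain canonical neighbours. -/
theorem Addr.iff_inSpan {d k ρ σ c x y c' X Y} (h : A.Addr d k ρ σ c x y) (hρ : ρ ≠ 0) :
    A.Addr d k ρ σ c' X Y ↔ c' = c ∧ A.InSpan d k c x X ∧ (σ = 0 → Y = A.f d X) ∧
      (σ ≠ 0 → 0 < σ * (Y - A.f d X)) ∧ (σ ≠ 0 → c ≠ d → σ * (Y - A.f c X) < 0) := by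
  have hr := h.right hρ
  constructor
  · intro ha
    have hcc := ha.neighbour_eq h
    subst hcc
    have ha' := ha.right hρ
    refine ⟨rfl, ⟨ha'.1, fun j hj => ⟨fun hlt => ?_, fun hlt => ?_⟩⟩, ha.on_graph, ha.gap, ha.gap'⟩
    · by_contra hle
      have h1 := (ha'.2 j hj).1 (not_lt.1 hle)
      linarith [hr.1 h1.1]
    · by_contra hle
      have h1 := (ha'.2 j hj).2 (not_lt.1 hle)
      linarith [hr.1 h1.1]
  · rintro ⟨rfl, hsp, h0, hg, hg'⟩
    have hc := h.next.lt h.d_lt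
    -- events up to `X` are events up to `x`
    have up : ∀ j < A.K, (A.ev d j ≤ X → A.ev d j ≤ x) ∧ (A.ev c' j ≤ X → A.ev c' j ≤ x) :=
      fun j hj => ⟨fun hle => by by_contra h'; linarith [(hsp.2 j hj).1 (not_le.1 h')],
        fun hle => by by_contra h'; linarith [(hsp.2 j hj).2 (not_le.1 h')]⟩
    have hright : (k < A.K → A.ev d k < X) ∧
        ∀ j < A.K, (A.ev d j ≤ X → k < A.K ∧ A.ev d j ≤ A.ev d k) ∧
          (A.ev c' j ≤ X → k < A.K ∧ A.ev c' j ≤ A.ev d k) :=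
      ⟨hsp.1, fun j hj => ⟨fun hle => (hr.2 j hj).1 ((up j hj).1 hle),
        fun hle => (hr.2 j hj).2 ((up j hj).2 hle)⟩⟩
    have hnc : A.Canon d X ∧ A.Next σ d c' X := by
      rcases le_total X x with hX | hX
      · obtain ⟨q1, q2⟩ := h.quiet hρ hsp.1
        exact ⟨(q1.canon_iff h.d_lt hX).2 h.canon, (q1.next_iff q2 h.d_lt hc hX).2 h.next⟩
      · have q : A.Quiet d x X ∧ A.Quiet c' x X := by
          refine ⟨fun j hj h2 => ?_, fun j hj h2 => ?_⟩
          · have h3 := (hright.2 j hj).1 h2.2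
            linarith [hr.1 h3.1, h2.1]
          · have h3 := (hright.2 j hj).2 h2.2
            linarith [hr.1 h3.1, h2.1]
        exact ⟨(q.1.canon_iff h.d_lt hX).1 h.canon, (q.1.next_iff q.2 h.d_lt hc hX).1 h.next⟩
    exact ⟨h.d_lt, h.k_le, hnc.1, hnc.2, h0, hg, hg', fun h' => absurd h' hρ, fun _ => hright,
      h.first, h.own⟩

theorem Addr.iff_at {d k σ c x y c' X Y} (h : A.Addr d k 0 σ c x y) :
    A.Addr d k 0 σ c' X Y ↔ c' = c ∧ X = x ∧ (σ = 0 → Y = A.f d X) ∧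
      (σ ≠ 0 → 0 < σ * (Y - A.f d X)) ∧ (σ ≠ 0 → c ≠ d → σ * (Y - A.f c X) < 0) := by
  obtain ⟨hk, hx⟩ := h.start rfl
  constructor
  · intro ha
    have hcc := ha.neighbour_eq h
    subst hcc
    exact ⟨rfl, by rw [(ha.start rfl).2, hx], ha.on_graph, ha.gap, ha.gap'⟩
  · rintro ⟨rfl, rfl, h0, hg, hg'⟩
    exact ⟨h.d_lt, h.k_le, h.canon, h.next, h0, hg, hg', fun _ => ⟨hk, hx⟩,
      fun h' => absurd rfl h', h.first, h.own⟩

end Arrangement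

/-! ### Collisions as sign conditions -/

/-- For a disc that moves from the origin to `w`, and a disc at `u` that it does not meet at the
start: `w` lies in the disc of radius `2` around `u`, or strictly between the two tangents from the
origin to this disc and not before the chord through the two points of tangency. -/
def Hits (ux uy wx wy : ℝ) : Prop :=
  (wx - ux) ^ 2 + (wy - uy) ^ 2 < 4 ∨
    ((wx * uy - wy * ux) ^ 2 < 4 * (wx ^ 2 + wy ^ 2) ∧
      ux ^ 2 + uy ^ 2 - 4 ≤ wx * ux + wy * uy)

/-- The distance of the moving disc is controlled by a quadratic function of the time. It falls below
`2` if it does so at the end, or if the discriminant is positive and the minimum is attained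
within the unit interval; in the presence of the first alternative, this can be replaced by
the position relative to the chord. -/
theorem not_hits_iff {ux uy wx wy : ℝ} (hu : 4 ≤ ux ^ 2 + uy ^ 2) :
    (∀ t ∈ Set.Icc (0 : ℝ) 1, 4 ≤ (t * wx - ux) ^ 2 + (t * wy - uy) ^ 2) ↔
      ¬ Hits ux uy wx wy := by
  -- the squared distance minus `4` is the quadratic function `a t ^ 2 - 2 b t + g`
  set a := wx ^ 2 + wy ^ 2 with ha
  set b := wx * ux + wy * uy with hb
  set g := ux ^ 2 + uy ^ 2 - 4 with hg
  have hg0 : 0 ≤ g := by linarith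
  have ha0 : 0 ≤ a := by positivity
  have hq : ∀ t : ℝ, (t * wx - ux) ^ 2 + (t * wy - uy) ^ 2 - 4 = a * t ^ 2 - 2 * b * t + g := by
    intro t; rw [ha, hb, hg]; ring
  have hdisc : b ^ 2 - a * g = 4 * a - (wx * uy - wy * ux) ^ 2 := by
    rw [ha, hb, hg]; ring
  constructor
  · rintro h (h1 | ⟨h1, h2⟩)
    · have := h 1 (by simp)
      simp only [one_mul] at this
      linarith
    · have hpos : 0 < a := by nlinarith [sq_nonneg (wx * uy - wy * ux)]
      by_cases hba : b ≤ a
      · have := h (b / a) ⟨by apply div_nonneg <;> linarith, by rw [div_le_one hpos]; exact hba⟩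
        have h3 := hq (b / a)
        have h4 : a * (a * (b / a) ^ 2 - 2 * b * (b / a) + g) = a * g - b ^ 2 := by
          field_simp; ring
        nlinarith
      · have := h 1 (by simp)
        have h3 := hq 1
        linarith
  · intro h t ht
    by_contra hlt
    have hqt : a * t ^ 2 - 2 * b * t + g < 0 := by rw [← hq]; linarith
    apply h
    have hpos : 0 < a := by
      rcases ha0.lt_or_eq with h' | h'
      · exact h'
      · exfalso
        have hx : wx = 0 := by nlinarith [sq_nonneg wx, sq_nonneg wy]
        have hy : wy = 0 := by nlinarith [sq_nonneg wx, sq_nonneg wy]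
        have : b = 0 := by rw [hb, hx, hy]; ring
        rw [← h', this] at hqt
        linarith
    have hd : 0 < b ^ 2 - a * g := by nlinarith [sq_nonneg (a * t - b)]
    by_cases h1 : (wx - ux) ^ 2 + (wy - uy) ^ 2 < 4
    · exact .inl h1
    · refine .inr ⟨by linarith, ?_⟩
      have h1' : 0 ≤ a - 2 * b + g := by
        have := hq 1
        simp only [one_mul, one_pow, mul_one] at this
        linarith
      by_contra hbg
      have hbg : b < g := not_le.1 hbg
      have hb0 : 0 < b := by
        by_contra hb0
        have := ht.1
        nlinarith [mul_nonneg this (by linarith : (0 : ℝ) ≤ -b), mul_nonneg ha0 (sq_nonneg t)]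
      have hab : a < b := by nlinarith
      have : (a * 1 - 2 * b + g) - (a * t ^ 2 - 2 * b * t + g) =
          (1 - t) * (a * (1 + t) - 2 * b) := by ring
      have h5 : (1 - t) * (a * (1 + t) - 2 * b) ≤ 0 := by
        apply mul_nonpos_of_nonneg_of_nonpos
        · linarith [ht.2]
        · nlinarith [ht.2]
      linarith

theorem Plane.dist_sq (a b : Plane) : dist a b ^ 2 = (a 0 - b 0) ^ 2 + (a 1 - b 1) ^ 2 := by
  rw [EuclideanSpace.dist_eq, Real.sq_sqrt (by positivity), Fin.sum_univ_two]
  simp [Real.dist_eq, sq_abs]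

theorem disjoint_unitDisc_iff (a b : Plane) :
    Disjoint (unitDisc a) (unitDisc b) ↔ 4 ≤ (a 0 - b 0) ^ 2 + (a 1 - b 1) ^ 2 := by
  unfold unitDisc
  rw [disjoint_ball_ball_iff one_pos one_pos, ← Plane.dist_sq]
  constructor
  · intro h; nlinarith
  · intro h; nlinarith [dist_nonneg (x := a) (y := b)]

theorem collisionFree_iff {a b c : Plane} (h : Disjoint (unitDisc a) (unitDisc c)) :
    CollisionFree a b c ↔ ¬ Hits (c 0 - a 0) (c 1 - a 1) (b 0 - a 0) (b 1 - a 1) := by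
  rw [disjoint_unitDisc_iff] at h
  rw [← not_hits_iff (by nlinarith)]
  unfold CollisionFree
  refine forall₂_congr fun t _ => ?_
  rw [disjoint_unitDisc_iff]
  simp only [AffineMap.lineMap_apply, vsub_eq_sub, vadd_eq_add, PiLp.add_apply, PiLp.smul_apply,
    PiLp.sub_apply, smul_eq_mul]
  ring_nf

/-! ### Total curves and their events -/

/-- A line or half of a circle of radius `2`, as the graph of a function on all of `ℝ`: with `half`
equal to `1` or `-1`, the upper or lower half of the circle around `(ctr, icpt)`, prolonged by two
horizontal rays. The lines have `half = 0`; they use `ctr` for the vertical line at `ctr - 2`. -/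
structure TotalCurve where
  slope : ℝ
  icpt : ℝ
  ctr : ℝ
  half : ℝ

namespace TotalCurve

/-- The ordinate at the abscissa `x`. The square root of a negative number is zero, so that the
half circles are prolonged by horizontal rays. -/
noncomputable def val (c : TotalCurve) (x : ℝ) : ℝ :=
  c.slope * x + c.icpt + c.half * √(4 - (x - c.ctr) * (x - c.ctr))

/-- The curve is a line or a half circle. -/
def IsLegal (c : TotalCurve) : Prop :=
  c.half = 0 ∨ ((c.half = 1 ∨ c.half = -1) ∧ c.slope = 0)

/-- The abscissas of the intersections of the line with slope `s` and intercept `q` with the circle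
of radius `2` around `(p, r)`, for `ε = 1` and `ε = -1`. -/
noncomputable def lineCircle (s q p r ε : ℝ) : ℝ :=
  (p - s * (q - r) + ε * √((p - s * (q - r)) * (p - s * (q - r)) -
    (1 + s * s) * (p * p + (q - r) * (q - r) - 4))) / (1 + s * s)

/-- The abscissas of the intersections of the circles of radius `2` around `(p, q)` and
`(p', q')`, for `ε = 1` and `ε = -1`. -/
noncomputable def circleCircle (p q p' q' ε : ℝ) : ℝ :=
  p + (p' - p) / 2 + ε * (q' - q) *
    √(4 * ((p' - p) * (p' - p) + (q' - q) * (q' - q)) -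
      ((p' - p) * (p' - p) + (q' - q) * (q' - q)) *
        ((p' - p) * (p' - p) + (q' - q) * (q' - q)) / 4) /
    ((p' - p) * (p' - p) + (q' - q) * (q' - q))

/-- The eleven abscissas at which the order of two curves may change. -/
noncomputable def event (c e : TotalCurve) : ℕ → ℝ
  | 0 => (e.icpt - c.icpt) / (c.slope - e.slope)
  | 1 => lineCircle c.slope c.icpt e.ctr e.icpt 1
  | 2 => lineCircle c.slope c.icpt e.ctr e.icpt (-1)
  | 3 => lineCircle e.slope e.icpt c.ctr c.icpt 1
  | 4 => lineCircle e.slope e.icpt c.ctr c.icpt (-1)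
  | 5 => circleCircle c.ctr c.icpt e.ctr e.icpt 1
  | 6 => circleCircle c.ctr c.icpt e.ctr e.icpt (-1)
  | 7 => c.ctr - 2
  | 8 => c.ctr + 2
  | 9 => e.ctr - 2
  | _ => e.ctr + 2

theorem continuous_val (c : TotalCurve) : Continuous c.val := by
  unfold val
  fun_prop

theorem eq_sqrt_or {X D : ℝ} (h : X * X = D) : X = √D ∨ X = -√D := by
  subst h
  rw [Real.sqrt_mul_self_eq_abs]
  rcases abs_cases X with h | h
  · left; linarith
  · right; linarith

/-- The formula yields every abscissa of an intersection. -/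
theorem lineCircle_spec {s q p r x : ℝ}
    (h : (x - p) * (x - p) + (s * x + q - r) * (s * x + q - r) = 4) :
    x = lineCircle s q p r 1 ∨ x = lineCircle s q p r (-1) := by
  have hA : 0 < 1 + s * s := by nlinarith [mul_self_nonneg s]
  have h1 : ((1 + s * s) * x - (p - s * (q - r))) * ((1 + s * s) * x - (p - s * (q - r))) =
      (p - s * (q - r)) * (p - s * (q - r)) - (1 + s * s) * (p * p + (q - r) * (q - r) - 4) := by
    linear_combination (1 + s * s) * h
  unfold lineCircle
  refine (eq_sqrt_or h1).imp (fun h2 => ?_) (fun h2 => ?_) <;> rw [eq_div_iff hA.ne'] <;> linarith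

/-- For circles with different centres, the formula yields every abscissa of an intersection. -/
theorem circleCircle_spec {p q p' q' x y : ℝ} (h : (x - p) * (x - p) + (y - q) * (y - q) = 4)
    (h' : (x - p') * (x - p') + (y - q') * (y - q') = 4)
    (hD : (p' - p) * (p' - p) + (q' - q) * (q' - q) ≠ 0) :
    x = circleCircle p q p' q' 1 ∨ x = circleCircle p q p' q' (-1) := by
  unfold circleCircle
  set D := (p' - p) * (p' - p) + (q' - q) * (q' - q) with hDdef
  -- the radical line
  have h1 : (x - p) * (p' - p) + (y - q) * (q' - q) = D / 2 := by
    rw [hDdef]; linear_combination (h - h') / 2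
  have h2 : ((x - p) * (q' - q) - (y - q) * (p' - p)) *
      ((x - p) * (q' - q) - (y - q) * (p' - p)) = 4 * D - D * D / 4 := by
    linear_combination D * h - ((x - p) * (p' - p) + (y - q) * (q' - q) + D / 2) * h1
  have h3 : (x - p) * D = (p' - p) * (D / 2) +
      (q' - q) * ((x - p) * (q' - q) - (y - q) * (p' - p)) := by
    linear_combination (p' - p) * h1 + (x - p) * hDdef
  have h5 : ∀ R : ℝ, (x - p) * D = (p' - p) * (D / 2) + (q' - q) * R →
      x = p + (p' - p) / 2 + (q' - q) * R / D := by
    intro R hR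
    field_simp
    linarith
  refine (eq_sqrt_or h2).imp (fun h4 => ?_) (fun h4 => ?_) <;> rw [h4] at h3 <;> rw [h5 _ h3] <;>
    ring

/-- Away from its two ends a curve is a line or an arc. -/
theorem line_or_arc {c : TotalCurve} (hc : c.IsLegal) {a b : ℝ}
    (h1 : ¬ (a ≤ c.ctr - 2 ∧ c.ctr - 2 ≤ b)) (h2 : ¬ (a ≤ c.ctr + 2 ∧ c.ctr + 2 ≤ b)) :
    (∀ x, a ≤ x → x ≤ b → c.val x = c.slope * x + c.icpt) ∨
      ((c.half = 1 ∨ c.half = -1) ∧ ∀ x, a ≤ x → x ≤ b → c.ctr - 2 < x ∧ x < c.ctr + 2 ∧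
        0 < √(4 - (x - c.ctr) * (x - c.ctr)) ∧
        c.val x = c.icpt + c.half * √(4 - (x - c.ctr) * (x - c.ctr)) ∧
        (x - c.ctr) * (x - c.ctr) + (c.val x - c.icpt) * (c.val x - c.icpt) = 4) := by
  rcases hc with h0 | ⟨hh, hs⟩
  · left; intro x _ _; simp [val, h0]
  · by_cases hl : b < c.ctr - 2
    · left; intro x _ hx
      rw [val, Real.sqrt_eq_zero_of_nonpos (by nlinarith)]; ring
    by_cases hr : c.ctr + 2 < a
    · left; intro x hx _
      rw [val, Real.sqrt_eq_zero_of_nonpos (by nlinarith)]; ring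
    right
    refine ⟨hh, fun x hx hx' => ?_⟩
    have e1 : c.ctr - 2 < x := by
      by_contra h; exact h1 ⟨by linarith, by linarith⟩
    have e2 : x < c.ctr + 2 := by
      by_contra h; exact h2 ⟨by linarith, by linarith⟩
    have e3 : 0 < 4 - (x - c.ctr) * (x - c.ctr) := by nlinarith
    have e4 : c.val x = c.icpt + c.half * √(4 - (x - c.ctr) * (x - c.ctr)) := by
      rw [val, hs]; ring
    refine ⟨e1, e2, Real.sqrt_pos.2 e3, e4, ?_⟩
    have e5 := Real.mul_self_sqrt e3.le
    rw [e4]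
    rcases hh with hh | hh <;> rw [hh] <;> linear_combination e5

/-- The sign of a continuous function is the same at both ends of an interval, if each zero in the
interval entails this. -/
theorem sign_eq_of_zero {g : ℝ → ℝ} (hg : Continuous g) {a b : ℝ} (hab : a ≤ b)
    (h : ∀ x, a ≤ x → x ≤ b → g x = 0 → g a = 0 ∧ g b = 0) :
    SignType.sign (g a) = SignType.sign (g b) := by
  by_cases h0 : ∃ x, a ≤ x ∧ x ≤ b ∧ g x = 0
  · obtain ⟨x, h1, h2, h3⟩ := h0
    obtain ⟨h4, h5⟩ := h x h1 h2 h3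
    rw [h4, h5]
  push Not at h0
  rcases lt_trichotomy (g a) 0 with ha | ha | ha
  · rcases lt_trichotomy (g b) 0 with hb | hb | hb
    · rw [sign_neg ha, sign_neg hb]
    · exact absurd hb (h0 b hab le_rfl)
    · obtain ⟨x, hx, hx'⟩ := intermediate_value_Icc hab hg.continuousOn ⟨ha.le, hb.le⟩
      exact absurd hx' (h0 x hx.1 hx.2)
  · exact absurd ha (h0 a le_rfl hab)
  · rcases lt_trichotomy (g b) 0 with hb | hb | hb
    · obtain ⟨x, hx, hx'⟩ := intermediate_value_Icc' hab hg.continuousOn ⟨hb.le, ha.le⟩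
      exact absurd hx' (h0 x hx.1 hx.2)
    · exact absurd hb (h0 b hab le_rfl)
    · rw [sign_pos ha, sign_pos hb]

/-- The order of two curves changes only at their events: between events, two curves that meet
coincide. -/
theorem sign_eq_of_event {c e : TotalCurve} (hc : c.IsLegal) (he : e.IsLegal) {a b : ℝ}
    (hab : a ≤ b) (h : ∀ t < 11, ¬ (a ≤ c.event e t ∧ c.event e t ≤ b)) :
    SignType.sign (e.val a - c.val a) = SignType.sign (e.val b - c.val b) := by
  have hev : ∀ t < 11, ∀ x, a ≤ x → x ≤ b → x = c.event e t → False := by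
    rintro t ht x h1 h2 rfl
    exact h t ht ⟨h1, h2⟩
  refine sign_eq_of_zero (g := fun x => e.val x - c.val x)
    (e.continuous_val.sub c.continuous_val) hab fun x hxa hxb hx => ?_
  rcases line_or_arc hc (h 7 (by norm_num)) (h 8 (by norm_num)) with lc | ⟨kc, ac⟩ <;>
    rcases line_or_arc he (h 9 (by norm_num)) (h 10 (by norm_num)) with le | ⟨ke, ae⟩
  · rw [lc x hxa hxb, le x hxa hxb] at hx
    by_cases hs : c.slope - e.slope = 0
    · have hq : e.icpt = c.icpt := by linear_combination hx + hs * x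
      rw [lc a le_rfl hab, le a le_rfl hab, lc b hab le_rfl, le b hab le_rfl]
      constructor
      · linear_combination hq - hs * a
      · linear_combination hq - hs * b
    · refine (hev 0 (by norm_num) x hxa hxb ?_).elim
      change x = (e.icpt - c.icpt) / (c.slope - e.slope)
      rw [eq_div_iff hs]
      linarith
  · obtain ⟨-, -, -, -, h3⟩ := ae x hxa hxb
    rw [show e.val x = c.slope * x + c.icpt by rw [← lc x hxa hxb]; linarith] at h3
    rcases lineCircle_spec h3 with h4 | h4
    · exact (hev 1 (by norm_num) x hxa hxb h4).elim
    · exact (hev 2 (by norm_num) x hxa hxb h4).elim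
  · obtain ⟨-, -, -, -, h3⟩ := ac x hxa hxb
    rw [show c.val x = e.slope * x + e.icpt by rw [← le x hxa hxb]; linarith] at h3
    rcases lineCircle_spec h3 with h4 | h4
    · exact (hev 3 (by norm_num) x hxa hxb h4).elim
    · exact (hev 4 (by norm_num) x hxa hxb h4).elim
  · obtain ⟨-, -, p1, v1, h1⟩ := ac x hxa hxb
    obtain ⟨-, -, p2, v2, h2⟩ := ae x hxa hxb
    have hv : e.val x = c.val x := by linarith
    by_cases hD : (e.ctr - c.ctr) * (e.ctr - c.ctr) + (e.icpt - c.icpt) * (e.icpt - c.icpt) = 0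
    · have d1 : e.ctr = c.ctr := by
        nlinarith [mul_self_nonneg (e.ctr - c.ctr), mul_self_nonneg (e.icpt - c.icpt)]
      have d2 : e.icpt = c.icpt := by
        nlinarith [mul_self_nonneg (e.ctr - c.ctr), mul_self_nonneg (e.icpt - c.icpt)]
      have d3 : e.half = c.half := by
        rw [v1, v2, d2, d1] at hv
        exact (mul_right_cancel₀ p1.ne' (add_left_cancel hv))
      obtain ⟨-, -, -, u1, -⟩ := ac a le_rfl hab
      obtain ⟨-, -, -, u2, -⟩ := ae a le_rfl hab
      obtain ⟨-, -, -, u3, -⟩ := ac b hab le_rfl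
      obtain ⟨-, -, -, u4, -⟩ := ae b hab le_rfl
      rw [u1, u2, u3, u4, d1, d2, d3]
      simp
    · rw [hv] at h2
      rcases circleCircle_spec h1 h2 hD with h4 | h4
      · exact (hev 5 (by norm_num) x hxa hxb h4).elim
      · exact (hev 6 (by norm_num) x hxa hxb h4).elim

/-- The line `α x + β y + γ = 0`. If it is vertical, its abscissa is `ctr - 2`. -/
noncomputable def ofLine (α β γ : ℝ) : TotalCurve :=
  ⟨(0 - α) / β, (0 - γ) / β, 2 - γ / α, 0⟩

/-- The half `h` of the circle of radius `2` around `(p, q)`. -/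
def ofCircle (p q h : ℝ) : TotalCurve := ⟨0, q, p, h⟩

theorem isLegal_ofLine (α β γ : ℝ) : (ofLine α β γ).IsLegal := .inl rfl

theorem isLegal_ofCircle (p q : ℝ) {h : ℝ} (hh : h = 1 ∨ h = -1) : (ofCircle p q h).IsLegal :=
  .inr ⟨hh, rfl⟩

/-- The two points are on the same side of the curve, and of the vertical lines through its ends. -/
structure SameSide (c : TotalCurve) (X Y X' Y' : ℝ) : Prop where
  val : SignType.sign (Y - c.val X) = SignType.sign (Y' - c.val X')
  left : SignType.sign (X - (c.ctr - 2)) = SignType.sign (X' - (c.ctr - 2))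
  right : SignType.sign (X - (c.ctr + 2)) = SignType.sign (X' - (c.ctr + 2))

theorem SameSide.line {α β γ X Y X' Y' : ℝ} (h : (ofLine α β γ).SameSide X Y X' Y') :
    SignType.sign (α * X + β * Y + γ) = SignType.sign (α * X' + β * Y' + γ) := by
  obtain ⟨h1, h2, -⟩ := h
  simp only [ofLine, TotalCurve.val] at h1 h2
  by_cases hβ : β = 0
  · by_cases hα : α = 0
    · simp [hα, hβ]
    · have e : ∀ X Y : ℝ, α * X + β * Y + γ = α * (X - (2 - γ / α - 2)) := by
        intro X Y; rw [hβ]; field_simp; ring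
      rw [e, e, sign_mul, sign_mul, h2]
  · have e : ∀ X Y : ℝ, α * X + β * Y + γ = β * (Y - ((0 - α) / β * X + (0 - γ) / β +
        0 * √(4 - (X - (2 - γ / α)) * (X - (2 - γ / α))))) := by
      intro X Y; field_simp; ring
    rw [e, e, sign_mul, sign_mul, h1]

/-- Inside a circle means to the right of its left end, to the left of its right end, below its upper
half and above its lower half. -/
theorem in_disc_iff {p q X Y : ℝ} : (X - p) ^ 2 + (Y - q) ^ 2 < 4 ↔ 0 < X - (p - 2) ∧
    X - (p + 2) < 0 ∧ Y - (ofCircle p q 1).val X < 0 ∧ 0 < Y - (ofCircle p q (-1)).val X := by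
  simp only [ofCircle, val]
  constructor
  · intro h
    have h1 : (Y - q) ^ 2 < 4 - (X - p) * (X - p) := by linarith
    have h2 := abs_lt.1 ((Real.lt_sqrt (abs_nonneg _)).2 ((sq_abs (Y - q)).trans_lt h1))
    refine ⟨by nlinarith [sq_nonneg (Y - q)], by nlinarith [sq_nonneg (Y - q)], ?_, ?_⟩ <;>
      linarith [h2.1, h2.2]
  · rintro ⟨h1, h2, h3, h4⟩
    have h5 : 0 ≤ 4 - (X - p) * (X - p) := by nlinarith
    have h6 := Real.mul_self_sqrt h5
    nlinarith

theorem SameSide.disc {p q X Y X' Y' : ℝ} (h : (ofCircle p q 1).SameSide X Y X' Y')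
    (h' : (ofCircle p q (-1)).SameSide X Y X' Y') :
    (X - p) ^ 2 + (Y - q) ^ 2 < 4 ↔ (X' - p) ^ 2 + (Y' - q) ^ 2 < 4 := by
  obtain ⟨h1, h2, h3⟩ := h
  have h4 := h'.val
  simp only [ofCircle] at h2 h3
  rw [in_disc_iff, in_disc_iff]
  simp only [← sign_eq_one_iff, ← sign_eq_neg_one_iff, h2, h3, ofCircle]
  simp only [ofCircle] at h1 h4
  simp only [h1, h4]

end TotalCurve

/-- The number `k` of the five curves that delimit the translations `v` for which a disc that moves
to `v + w` hits a disc at `u`: two tangents, the chord, and the two halves of the circle. -/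
noncomputable def hitCurve (ux uy wx wy : ℝ) : ℕ → TotalCurve
  | 0 => .ofLine (√(ux * ux + uy * uy - 4) * uy + 2 * ux) (2 * uy - √(ux * ux + uy * uy - 4) * ux)
      ((√(ux * ux + uy * uy - 4) * uy + 2 * ux) * wx +
        (2 * uy - √(ux * ux + uy * uy - 4) * ux) * wy)
  | 1 => .ofLine (√(ux * ux + uy * uy - 4) * uy - 2 * ux)
      (0 - 2 * uy - √(ux * ux + uy * uy - 4) * ux)
      ((√(ux * ux + uy * uy - 4) * uy - 2 * ux) * wx +
        (0 - 2 * uy - √(ux * ux + uy * uy - 4) * ux) * wy)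
  | 2 => .ofLine ux uy (ux * wx + uy * wy - (ux * ux + uy * uy - 4))
  | 3 => .ofCircle (ux - wx) (uy - wy) 1
  | _ => .ofCircle (ux - wx) (uy - wy) (-1)

/-- The five curves determine whether there is a collision. -/
theorem hits_congr {ux uy wx wy X Y X' Y' : ℝ} (hu : 4 ≤ ux ^ 2 + uy ^ 2)
    (h : ∀ k < 5, (hitCurve ux uy wx wy k).SameSide X Y X' Y') :
    Hits ux uy (X + wx) (Y + wy) ↔ Hits ux uy (X' + wx) (Y' + wy) := by
  have h1 := (h 0 (by norm_num)).line
  have h2 := (h 1 (by norm_num)).line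
  have h3 := (h 2 (by norm_num)).line
  have h4 := TotalCurve.SameSide.disc (h 3 (by norm_num)) (h 4 (by norm_num))
  have hk : √(ux * ux + uy * uy - 4) * √(ux * ux + uy * uy - 4) = ux * ux + uy * uy - 4 :=
    Real.mul_self_sqrt (by nlinarith)
  set k := √(ux * ux + uy * uy - 4)
  have hdisc : ∀ X Y : ℝ, (X + wx - ux) ^ 2 + (Y + wy - uy) ^ 2 < 4 ↔
      (X - (ux - wx)) ^ 2 + (Y - (uy - wy)) ^ 2 < 4 := by
    intro X Y; ring_nf
  -- the product of the two tangents is a quadratic form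
  have hcone : ∀ X Y : ℝ, ((X + wx) * uy - (Y + wy) * ux) ^ 2 < 4 * ((X + wx) ^ 2 + (Y + wy) ^ 2) ↔
      SignType.sign (((k * uy + 2 * ux) * X + (2 * uy - k * ux) * Y +
        ((k * uy + 2 * ux) * wx + (2 * uy - k * ux) * wy)) *
        ((k * uy - 2 * ux) * X + (0 - 2 * uy - k * ux) * Y +
        ((k * uy - 2 * ux) * wx + (0 - 2 * uy - k * ux) * wy))) = -1 := by
    intro X Y
    rw [sign_eq_neg_one_iff]
    have e : ((k * uy + 2 * ux) * X + (2 * uy - k * ux) * Y +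
        ((k * uy + 2 * ux) * wx + (2 * uy - k * ux) * wy)) *
        ((k * uy - 2 * ux) * X + (0 - 2 * uy - k * ux) * Y +
        ((k * uy - 2 * ux) * wx + (0 - 2 * uy - k * ux) * wy)) = (ux ^ 2 + uy ^ 2) *
        (((X + wx) * uy - (Y + wy) * ux) ^ 2 - 4 * ((X + wx) ^ 2 + (Y + wy) ^ 2)) := by
      linear_combination ((X + wx) * uy - (Y + wy) * ux) ^ 2 * hk
    rw [e]
    constructor
    · intro h; exact mul_neg_of_pos_of_neg (by linarith) (by linarith)
    · intro h
      have := (pos_iff_neg_of_mul_neg h).1 (by linarith)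
      linarith
  have hchord : ∀ X Y : ℝ, ux ^ 2 + uy ^ 2 - 4 ≤ (X + wx) * ux + (Y + wy) * uy ↔
      ¬ SignType.sign (ux * X + uy * Y + (ux * wx + uy * wy - (ux * ux + uy * uy - 4))) = -1 := by
    intro X Y
    rw [sign_eq_neg_one_iff, not_lt]
    constructor <;> intro h <;> linarith
  unfold Hits
  rw [hdisc, hdisc, hcone, hcone, hchord, hchord, h4, sign_mul, sign_mul, h1, h2, h3]


/-! ### Itineraries as linear orders that avoid a relation -/

/-- The set can be listed so that no element stands in the relation `B` to a later one. -/
def Orderable (B : ℕ → ℕ → Prop) (A : Finset ℕ) : Prop :=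
  ∃ l : List ℕ, l.Nodup ∧ l.toFinset = A ∧ l.Pairwise fun a b => ¬ B a b

theorem orderable_empty (B : ℕ → ℕ → Prop) : Orderable B ∅ := ⟨[], by simp⟩

/-- An element that may come first can be removed greedily. -/
theorem orderable_erase_iff {B : ℕ → ℕ → Prop} {A : Finset ℕ} {p : ℕ} (hp : p ∈ A)
    (h : ∀ j ∈ A, j ≠ p → ¬ B p j) : Orderable B A ↔ Orderable B (A.erase p) := by
  constructor
  · rintro ⟨l, h1, rfl, h3⟩
    refine ⟨l.erase p, h1.erase p, ?_, h3.sublist l.erase_sublist⟩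
    ext j
    simp [h1.mem_erase_iff]
  · rintro ⟨l, h1, h2, h3⟩
    have hmem : ∀ j, j ∈ l ↔ j ≠ p ∧ j ∈ A := by
      intro j
      rw [← List.mem_toFinset, h2, Finset.mem_erase]
    refine ⟨p :: l, List.nodup_cons.2 ⟨fun hpl => ((hmem p).1 hpl).1 rfl, h1⟩, ?_,
      List.pairwise_cons.2 ⟨fun j hj => h j ((hmem j).1 hj).2 ((hmem j).1 hj).1, h3⟩⟩
    rw [List.toFinset_cons, h2, Finset.insert_erase hp]

theorem Orderable.exists_first {B : ℕ → ℕ → Prop} {A : Finset ℕ} (h : Orderable B A)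
    (hA : A.Nonempty) : ∃ p ∈ A, ∀ j ∈ A, j ≠ p → ¬ B p j := by
  obtain ⟨l, h1, rfl, h3⟩ := h
  cases l with
  | nil => simp at hA
  | cons p l =>
    rw [List.pairwise_cons] at h3
    refine ⟨p, by simp, fun j hj hne => h3.1 j ?_⟩
    simpa [hne] using hj

theorem orderable_range_iff {B : ℕ → ℕ → Prop} {n : ℕ} :
    Orderable B (Finset.range n) ↔ ∃ σ : Fin n ≃ Fin n, ∀ i j, i < j → ¬ B (σ i) (σ j) := by
  constructor
  · rintro ⟨l, h1, h2, h3⟩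
    have hlen : l.length = n := by
      rw [← List.toFinset_card_of_nodup h1, h2, Finset.card_range]
    have hlt : ∀ i : Fin n, l[(i : ℕ)]'(by omega) < n := by
      intro i
      have : l[(i : ℕ)]'(by omega) ∈ l.toFinset := by simp
      rw [h2] at this
      simpa using this
    let g : Fin n → Fin n := fun i => ⟨l[(i : ℕ)]'(by omega), hlt i⟩
    have hg : Function.Injective g := by
      intro i j hij
      have := (List.Nodup.getElem_inj_iff h1).1 (Fin.mk.inj_iff.1 hij)
      exact Fin.ext this
    refine ⟨Equiv.ofBijective g (Finite.injective_iff_bijective.1 hg), fun i j hij => ?_⟩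
    exact List.pairwise_iff_getElem.1 h3 i j (by omega) (by omega) hij
  · rintro ⟨σ, hσ⟩
    refine ⟨List.ofFn fun i => (σ i : ℕ), ?_, ?_, ?_⟩
    · rw [List.nodup_ofFn]
      intro i j hij
      exact σ.injective (Fin.ext hij)
    · ext j
      simp only [List.mem_toFinset, List.mem_ofFn, Finset.mem_range]
      constructor
      · rintro ⟨i, rfl⟩; exact (σ i).2
      · intro hj; exact ⟨σ.symm ⟨j, hj⟩, by simp⟩
    · rw [List.pairwise_ofFn]
      exact fun i j hij => hσ i j hij

/-- The start positions of the discs, and for each disc its target position. -/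
structure Coords where
  sx : ℕ → ℝ
  sy : ℕ → ℝ
  tx : ℕ → ℝ
  ty : ℕ → ℝ

/-- For the translation `(x, y)`, the disc `a` cannot be moved before the disc `b`: either `a`
would run into the start position of `b`, or `b` into the target position of `a`. -/
def Coords.Blocks (P : Coords) (x y : ℝ) (a b : ℕ) : Prop :=
  Hits (P.sx b - P.sx a) (P.sy b - P.sy a) (x + (P.tx a - P.sx a)) (y + (P.ty a - P.sy a)) ∨
    Hits (P.tx b - P.tx a) (P.ty b - P.ty a) (x + (P.tx b - P.sx b)) (y + (P.ty b - P.sy b))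

/-- The start positions keep their distance, and so do the target positions. -/
def Coords.Apart (P : Coords) (n : ℕ) : Prop :=
  ∀ a < n, ∀ b < n, a ≠ b → 4 ≤ (P.sx b - P.sx a) ^ 2 + (P.sy b - P.sy a) ^ 2 ∧
    4 ≤ (P.tx b - P.tx a) ^ 2 + (P.ty b - P.ty a) ^ 2

/-- The coordinates that a memory holds in its input arrays. -/
def State.coords (s : State) : Coords where
  sx := s.rarr 0
  sy := s.rarr 1
  tx i := s.rarr 2 (s.narr 0 i)
  ty i := s.rarr 3 (s.narr 0 i)

theorem collisionFree_comm {a b c : Plane} : CollisionFree a b c ↔ CollisionFree b a c := by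
  have h : ∀ a b : Plane, CollisionFree a b c → CollisionFree b a c := by
    intro a b h t ht
    have := h (1 - t) ⟨by linarith [ht.2], by linarith [ht.1]⟩
    rwa [AffineMap.lineMap_apply_one_sub] at this
  exact ⟨h a b, h b a⟩

theorem hits_neg {ux uy wx wy : ℝ} : Hits (-ux) (-uy) (-wx) (-wy) ↔ Hits ux uy wx wy := by
  unfold Hits
  ring_nf

section instances
variable {n : ℕ} (I : LabeledInstance n)

theorem coords_inputState (i : Fin n) :
    (inputState I).coords.sx i = I.S i 0 ∧ (inputState I).coords.sy i = I.S i 1 ∧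
      (inputState I).coords.tx i = I.T (I.M i) 0 ∧ (inputState I).coords.ty i = I.T (I.M i) 1 := by
  simp [State.coords, inputState]

theorem apart_inputState : (inputState I).coords.Apart n := by
  intro a ha b hb hab
  obtain ⟨h1, h2, h3, h4⟩ := coords_inputState I ⟨a, ha⟩
  obtain ⟨k1, k2, k3, k4⟩ := coords_inputState I ⟨b, hb⟩
  simp only at h1 h2 h3 h4 k1 k2 k3 k4
  have hne : (⟨b, hb⟩ : Fin n) ≠ ⟨a, ha⟩ := by simpa using hab.symm
  rw [h1, h2, h3, h4, k1, k2, k3, k4]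
  exact ⟨(disjoint_unitDisc_iff _ _).1 (I.valid_S _ _ hne),
    (disjoint_unitDisc_iff _ _).1 (I.valid_T _ _ (fun h => hne (I.M.injective h)))⟩

theorem isItinerary_iff (v : Plane) (σ : Fin n ≃ Fin n) : IsItinerary I v σ ↔
    ∀ i j, i < j → ¬ (inputState I).coords.Blocks (v 0) (v 1) (σ i) (σ j) := by
  have key : ∀ i j, i < j → (¬ (inputState I).coords.Blocks (v 0) (v 1) (σ i) (σ j) ↔
      CollisionFree (I.S (σ i)) (I.T (I.M (σ i)) + v) (I.S (σ j)) ∧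
      CollisionFree (I.S (σ j)) (I.T (I.M (σ j)) + v) (I.T (I.M (σ i)) + v)) := by
    intro i j hij
    have hne : σ i ≠ σ j := fun h => hij.ne (σ.injective h)
    obtain ⟨h1, h2, h3, h4⟩ := coords_inputState I (σ i)
    obtain ⟨k1, k2, k3, k4⟩ := coords_inputState I (σ j)
    have hT : Disjoint (unitDisc (I.T (I.M (σ j)) + v)) (unitDisc (I.T (I.M (σ i)) + v)) := by
      have := (disjoint_unitDisc_iff _ _).1
        (I.valid_T _ _ (fun h => hne (I.M.injective h).symm : I.M (σ j) ≠ I.M (σ i)))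
      rw [disjoint_unitDisc_iff]
      simpa using this
    rw [collisionFree_iff (I.valid_S _ _ hne), collisionFree_comm (a := I.S (σ j)),
      collisionFree_iff hT, Coords.Blocks, h1, h2, h3, h4, k1, k2, k3, k4, not_or]
    refine and_congr (not_congr ?_) (not_congr ?_)
    · simp only [PiLp.add_apply]
      ring_nf
    · rw [← hits_neg]
      simp only [PiLp.add_apply]
      ring_nf
  constructor
  · intro h i j hij
    exact (key i j hij).2 ⟨(h i).1 j hij, (h j).2 i hij⟩
  · intro h i
    exact ⟨fun j hij => ((key i j hij).1 (h i j hij)).1, fun j hij => ((key j i hij).1 (h j i hij)).2⟩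

theorem mem_validTranslations_iff (v : Plane) : v ∈ validTranslations I ↔
    Orderable ((inputState I).coords.Blocks (v 0) (v 1)) (Finset.range n) := by
  rw [orderable_range_iff]
  simp only [← isItinerary_iff]
  rfl

end instances

/-- The curves that delimit the translations for which `a` cannot be moved before `b`: the first
five belong to the start position of `b`, the other five to the target position of `a`. -/
noncomputable def Coords.curve (P : Coords) (a b : ℕ) : Bool → ℕ → TotalCurve
  | false => hitCurve (P.sx b - P.sx a) (P.sy b - P.sy a) (P.tx a - P.sx a) (P.ty a - P.sy a)
  | true => hitCurve (P.tx b - P.tx a) (P.ty b - P.ty a) (P.tx b - P.sx b) (P.ty b - P.sy b)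

theorem Coords.blocks_congr {P : Coords} {n a b : ℕ} (hP : P.Apart n) (ha : a < n) (hb : b < n)
    (hab : a ≠ b) {X Y X' Y' : ℝ} (h : ∀ i, ∀ k < 5, (P.curve a b i k).SameSide X Y X' Y') :
    P.Blocks X Y a b ↔ P.Blocks X' Y' a b := by
  obtain ⟨h1, h2⟩ := hP a ha b hb hab
  unfold Coords.Blocks
  exact or_congr (hits_congr h1 (h false)) (hits_congr h2 (h true))


/-! ### The program -/

instance : Add NExpr := ⟨.add⟩
instance : Sub NExpr := ⟨.sub⟩
instance : Add RExpr := ⟨.add⟩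
instance : Sub RExpr := ⟨.sub⟩
instance : Mul RExpr := ⟨.mul⟩
instance : Div RExpr := ⟨.div⟩

section eval
variable (s : State)

@[simp] theorem NExpr.eval_const (k : ℕ) : (NExpr.const k).eval s = k := rfl
@[simp] theorem NExpr.eval_var (i : ℕ) : (NExpr.var i).eval s = s.nvar i := rfl
@[simp] theorem NExpr.eval_get (a : ℕ) (e) : (NExpr.get a e).eval s = s.narr a (e.eval s) := rfl
@[simp] theorem NExpr.eval_add (e f : NExpr) : (e + f).eval s = e.eval s + f.eval s := rfl
@[simp] theorem NExpr.eval_sub (e f : NExpr) : (e - f).eval s = e.eval s - f.eval s := rfl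
@[simp] theorem RExpr.eval_const (k : ℤ) : (RExpr.const k).eval s = k := rfl
@[simp] theorem RExpr.eval_var (i : ℕ) : (RExpr.var i).eval s = s.rvar i := rfl
@[simp] theorem RExpr.eval_get (a : ℕ) (e) : (RExpr.get a e).eval s = s.rarr a (e.eval s) := rfl
@[simp] theorem RExpr.eval_add (e f : RExpr) : (e + f).eval s = e.eval s + f.eval s := rfl
@[simp] theorem RExpr.eval_sub (e f : RExpr) : (e - f).eval s = e.eval s - f.eval s := rfl
@[simp] theorem RExpr.eval_mul (e f : RExpr) : (e * f).eval s = e.eval s * f.eval s := rfl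
@[simp] theorem RExpr.eval_div (e f : RExpr) : (e / f).eval s = e.eval s / f.eval s := rfl
@[simp] theorem RExpr.eval_sqrt (e : RExpr) : (RExpr.sqrt e).eval s = √(e.eval s) := rfl

/-- The test `e < f` on natural numbers. -/
def NExpr.lt (e f : NExpr) : BExpr := .not (.nle f e)

/-- The test `e = f` on natural numbers. -/
def NExpr.eq (e f : NExpr) : BExpr := .and (.nle e f) (.nle f e)

/-- The test `e < f` on real numbers. -/
def RExpr.lt (e f : RExpr) : BExpr := .not (.rle f e)

/-- The test `e = f` on real numbers. -/
def RExpr.eq (e f : RExpr) : BExpr := .and (.rle e f) (.rle f e)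

/-- The disjunction of two tests. -/
def BExpr.or (b c : BExpr) : BExpr := .not (.and (.not b) (.not c))

@[simp] theorem NExpr.holds_lt (e f : NExpr) : (e.lt f).holds s ↔ e.eval s < f.eval s := not_le
@[simp] theorem NExpr.holds_eq (e f : NExpr) : (e.eq f).holds s ↔ e.eval s = f.eval s :=
  le_antisymm_iff.symm
@[simp] theorem RExpr.holds_lt (e f : RExpr) : (e.lt f).holds s ↔ e.eval s < f.eval s := not_le
@[simp] theorem RExpr.holds_eq (e f : RExpr) : (e.eq f).holds s ↔ e.eval s = f.eval s :=
  le_antisymm_iff.symm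
@[simp] theorem RExpr.holds_rle (e f : RExpr) :
    (BExpr.rle e f).holds s ↔ e.eval s ≤ f.eval s := .rfl
@[simp] theorem BExpr.holds_not (b : BExpr) : b.not.holds s ↔ ¬ b.holds s := .rfl
@[simp] theorem BExpr.holds_and (b c : BExpr) : (b.and c).holds s ↔ b.holds s ∧ c.holds s := .rfl
@[simp] theorem BExpr.holds_or (b c : BExpr) : (b.or c).holds s ↔ b.holds s ∨ c.holds s := by
  simp [BExpr.or]; tauto

/-- The expression for `11 e`. -/
def NExpr.eleven (e : NExpr) : NExpr := e + e + e + e + e + e + e + e + e + e + e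

@[simp] theorem NExpr.eval_eleven (e : NExpr) : e.eleven.eval s = 11 * e.eval s := by
  simp [NExpr.eleven]; ring

end eval

-- The variables for natural numbers: sizes, the address of the current cell, counters and flags.
local notation "nvN" => (0 : ℕ)
local notation "nvOut" => (1 : ℕ)
local notation "nvM" => (2 : ℕ)
local notation "nvK" => (3 : ℕ)
local notation "nvEleven" => (4 : ℕ)
local notation "nvKs" => (5 : ℕ)
local notation "nvD" => (6 : ℕ)
local notation "nvE" => (7 : ℕ)
local notation "nvF" => (8 : ℕ)
local notation "nvT" => (9 : ℕ)
local notation "nvJ" => (10 : ℕ)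
local notation "nvCur" => (11 : ℕ)
local notation "nvOk" => (12 : ℕ)
local notation "nvNext" => (13 : ℕ)
local notation "nvValid" => (14 : ℕ)
local notation "nvA" => (15 : ℕ)
local notation "nvB" => (16 : ℕ)
local notation "nvR" => (17 : ℕ)
local notation "nvPick" => (18 : ℕ)
local notation "nvLo" => (19 : ℕ)
local notation "nvHi" => (20 : ℕ)
local notation "nvBase" => (21 : ℕ)
local notation "nvTag" => (22 : ℕ)

-- The variables for real numbers.
local notation "rvL" => (0 : ℕ)
local notation "rvX" => (1 : ℕ)
local notation "rvY" => (2 : ℕ)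
local notation "rvRho" => (3 : ℕ)
local notation "rvSig" => (4 : ℕ)
local notation "rvNext" => (5 : ℕ)
local notation "rvMin" => (6 : ℕ)
local notation "rvUx" => (7 : ℕ)
local notation "rvUy" => (8 : ℕ)
local notation "rvWx" => (9 : ℕ)
local notation "rvWy" => (10 : ℕ)
local notation "rvRoot" => (11 : ℕ)
local notation "rvAl" => (12 : ℕ)
local notation "rvBe" => (13 : ℕ)
local notation "rvGa" => (14 : ℕ)

-- The arrays that are neither input nor output.
local notation "naRow" => (5 : ℕ)
local notation "naGone" => (6 : ℕ)
local notation "naCnt" => (7 : ℕ)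
local notation "raSlope" => (12 : ℕ)
local notation "raIcpt" => (13 : ℕ)
local notation "raCtr" => (14 : ℕ)
local notation "raHalf" => (15 : ℕ)
local notation "raEv" => (16 : ℕ)

namespace FProg

/-! #### Tables of curves and events -/

/-- Append a curve to the table. -/
def addCurve (s q p h : RExpr) : FProg :=
  putR raSlope (.var nvM) s ;; putR raIcpt (.var nvM) q ;; putR raCtr (.var nvM) p ;;
  putR raHalf (.var nvM) h ;; setN nvM (.var nvM + .const 1)

/-- Append the line `α x + β y + γ = 0`. -/
def addLine (α β γ : RExpr) : FProg :=
  setR rvAl α ;; setR rvBe β ;; setR rvGa γ ;;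
  addCurve ((.const 0 - .var rvAl) / .var rvBe) ((.const 0 - .var rvGa) / .var rvBe)
    (.const 2 - .var rvGa / .var rvAl) (.const 0)

/-- Append the five curves `hitCurve`. -/
def addHits : FProg :=
  setR rvRoot (.sqrt (.var rvUx * .var rvUx + .var rvUy * .var rvUy - .const 4)) ;;
  addLine (.var rvRoot * .var rvUy + .const 2 * .var rvUx)
    (.const 2 * .var rvUy - .var rvRoot * .var rvUx)
    ((.var rvRoot * .var rvUy + .const 2 * .var rvUx) * .var rvWx +
      (.const 2 * .var rvUy - .var rvRoot * .var rvUx) * .var rvWy) ;;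
  addLine (.var rvRoot * .var rvUy - .const 2 * .var rvUx)
    (.const 0 - .const 2 * .var rvUy - .var rvRoot * .var rvUx)
    ((.var rvRoot * .var rvUy - .const 2 * .var rvUx) * .var rvWx +
      (.const 0 - .const 2 * .var rvUy - .var rvRoot * .var rvUx) * .var rvWy) ;;
  addLine (.var rvUx) (.var rvUy) (.var rvUx * .var rvWx + .var rvUy * .var rvWy -
    (.var rvUx * .var rvUx + .var rvUy * .var rvUy - .const 4)) ;;
  addCurve (.const 0) (.var rvUy - .var rvWy) (.var rvUx - .var rvWx) (.const 1) ;;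
  addCurve (.const 0) (.var rvUy - .var rvWy) (.var rvUx - .var rvWx) (.const (-1))

/-- The start abscissa or ordinate (array `a`) of the disc whose number is in the variable `i`. -/
def startE (a i : ℕ) : RExpr := .get a (.var i)

/-- The target abscissa or ordinate (array `a`) of the disc whose number is in the variable `i`. -/
def targetE (a i : ℕ) : RExpr := .get a (.get 0 (.var i))

/-- The difference of two start positions, and the motion of the first disc. -/
def setStart : FProg :=
  setR rvUx (startE 0 nvB - startE 0 nvA) ;; setR rvUy (startE 1 nvB - startE 1 nvA) ;;
  setR rvWx (targetE 2 nvA - startE 0 nvA) ;; setR rvWy (targetE 3 nvA - startE 1 nvA)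

/-- The difference of two target positions, and the motion of the second disc. -/
def setTarget : FProg :=
  setR rvUx (targetE 2 nvB - targetE 2 nvA) ;; setR rvUy (targetE 3 nvB - targetE 3 nvA) ;;
  setR rvWx (targetE 2 nvB - startE 0 nvB) ;; setR rvWy (targetE 3 nvB - startE 1 nvB)

/-- The table of all curves. The curve number `0` is the axis `y = 0`. -/
def buildCurves : FProg :=
  setN nvM (.const 1) ;;
  .count nvA nvN (.count nvB nvN (setStart ;; addHits ;; setTarget ;; addHits))

/-- The sizes of the table of events. -/
def setSizes : FProg :=
  setN nvK (NExpr.var nvM).eleven ;; setN nvEleven (.const 11) ;;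
  setN nvKs (.var nvK + .const 1)

/-- The expression for `lineCircle`. -/
def lineCircleE (s q p r : RExpr) (ε : ℤ) : RExpr :=
  (p - s * (q - r) + .const ε * .sqrt ((p - s * (q - r)) * (p - s * (q - r)) -
    (.const 1 + s * s) * (p * p + (q - r) * (q - r) - .const 4))) / (.const 1 + s * s)

/-- The expression for `circleCircle`. -/
def circleCircleE (p q p' q' : RExpr) (ε : ℤ) : RExpr :=
  p + (p' - p) / .const 2 + .const ε * (q' - q) *
    .sqrt (.const 4 * ((p' - p) * (p' - p) + (q' - q) * (q' - q)) -
      ((p' - p) * (p' - p) + (q' - q) * (q' - q)) *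
        ((p' - p) * (p' - p) + (q' - q) * (q' - q)) / .const 4) /
    ((p' - p) * (p' - p) + (q' - q) * (q' - q))

/-- An entry of the table of curves. -/
def curveE (a c : ℕ) : RExpr := .get a (.var c)

/-- The expression for the event number `t` of the curves in the variables `nvD` and `nvF`. -/
def eventE : ℕ → RExpr
  | 0 => (curveE raIcpt nvF - curveE raIcpt nvD) / (curveE raSlope nvD - curveE raSlope nvF)
  | 1 => lineCircleE (curveE raSlope nvD) (curveE raIcpt nvD) (curveE raCtr nvF)
      (curveE raIcpt nvF) 1
  | 2 => lineCircleE (curveE raSlope nvD) (curveE raIcpt nvD) (curveE raCtr nvF)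
      (curveE raIcpt nvF) (-1)
  | 3 => lineCircleE (curveE raSlope nvF) (curveE raIcpt nvF) (curveE raCtr nvD)
      (curveE raIcpt nvD) 1
  | 4 => lineCircleE (curveE raSlope nvF) (curveE raIcpt nvF) (curveE raCtr nvD)
      (curveE raIcpt nvD) (-1)
  | 5 => circleCircleE (curveE raCtr nvD) (curveE raIcpt nvD) (curveE raCtr nvF)
      (curveE raIcpt nvF) 1
  | 6 => circleCircleE (curveE raCtr nvD) (curveE raIcpt nvD) (curveE raCtr nvF)
      (curveE raIcpt nvF) (-1)
  | 7 => curveE raCtr nvD - .const 2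
  | 8 => curveE raCtr nvD + .const 2
  | 9 => curveE raCtr nvF - .const 2
  | _ => curveE raCtr nvF + .const 2

/-- Append the event number `t` to the table. -/
def addEvent (t : ℕ) : FProg :=
  putR raEv (.var nvBase) (eventE t) ;; setN nvBase (.var nvBase + .const 1)

/-- Append all events of two curves to the table. -/
def addEvents : FProg :=
  addEvent 0 ;; addEvent 1 ;; addEvent 2 ;; addEvent 3 ;; addEvent 4 ;; addEvent 5 ;;
  addEvent 6 ;; addEvent 7 ;; addEvent 8 ;; addEvent 9 ;; addEvent 10

/-- The table of events; the array `naRow` holds the positions at which its rows begin. -/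
def buildEvents : FProg :=
  setN nvBase (.const 0) ;;
  .count nvD nvM (putN naRow (.var nvD) (.var nvBase) ;; .count nvF nvM addEvents)

/-- The position in the table of the event `j` of the curve whose number is in the variable `c`. -/
def evE (c : ℕ) (j : NExpr) : RExpr := .get raEv (.get naRow (.var c) + j)

/-- An abscissa to the left of all events. -/
def findMin : FProg :=
  setR rvMin (.const 0) ;;
  .count nvD nvM (.count nvJ nvK
    (ite ((evE nvD (.var nvJ) - .const 1).lt (.var rvMin))
      (setR rvMin (evE nvD (.var nvJ) - .const 1)) skip))

/-! #### The sample point of a cell -/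

/-- Move the abscissa to the left, halfway to the left end, if it is not already closer to the left
end than the event `z`. -/
def shrink (z : RExpr) : FProg :=
  ite (.and ((RExpr.var rvL).lt z) (((.var rvL + z) / .const 2).lt (.var rvX)))
    (setR rvX ((.var rvL + z) / .const 2)) skip

/-- Move the abscissa to the left of all events of a curve after the left end. -/
def shrinkRow (c : ℕ) : FProg := .count nvJ nvK (shrink (evE c (.var nvJ)))

/-- The height of a curve at the current abscissa. -/
def heightE (c : ℕ) : RExpr :=
  curveE raSlope c * .var rvX + curveE raIcpt c + curveE raHalf c *
    .sqrt (.const 4 - (.var rvX - curveE raCtr c) * (.var rvX - curveE raCtr c))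

/-- One step of the search for the neighbour: compare the candidate with the curve `nvF`, to the
left of their next event. -/
def tryNeighbour : FProg :=
  .count nvT nvEleven (shrink (evE nvCur ((NExpr.var nvF).eleven + .var nvT))) ;;
  ite (.and ((RExpr.const 0).lt (.var rvSig * (heightE nvF - heightE nvD)))
      (.or ((NExpr.var nvCur).eq (.var nvD))
        ((.var rvSig * (heightE nvF - heightE nvCur)).lt (.const 0))))
    (setN nvCur (.var nvF)) skip

/-- Find the neighbour of the curve `nvD`. -/
def findNeighbour : FProg :=
  setN nvCur (.var nvD) ;; .count nvF nvM tryNeighbour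

/-- Choose the ordinate of the sample point. -/
def sampleY : FProg :=
  ite ((NExpr.var nvCur).eq (.var nvD)) (setR rvY (heightE nvD + .var rvSig))
    (setR rvY ((heightE nvD + heightE nvCur) / .const 2))

/-- Lower the flag if the curve is not canonical. -/
def testCanon : FProg :=
  .count nvF nvM (ite (.and ((NExpr.var nvF).lt (.var nvD)) ((heightE nvF).eq (heightE nvD)))
    (setN nvOk (.const 0)) skip)

/-- Lower the flag if the left end has an earlier index, or has to be addressed through the lower
curve. -/
def testEvents : FProg :=
  .count nvJ nvK (ite (.or
      (.and ((NExpr.var nvJ).lt (.var nvE)) ((evE nvD (.var nvJ)).eq (.var rvL)))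
      (.and ((RExpr.var rvSig).lt (.const 0)) (.and (.not ((NExpr.var nvCur).eq (.var nvD)))
        (.or ((NExpr.var nvE).eq (.var nvK)) ((evE nvCur (.var nvJ)).eq (.var rvL))))))
    (setN nvOk (.const 0)) skip)

/-- Test whether the address is in use. -/
def testAddress : FProg :=
  setN nvOk (.const 1) ;; testCanon ;; testEvents ;;
  ite (.and ((RExpr.var rvRho).eq (.const 0)) ((NExpr.var nvE).eq (.var nvK)))
    (setN nvOk (.const 0)) skip

/-- Replace the next event by `z` if this comes earlier. -/
def updNext (z : RExpr) : FProg :=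
  ite (.and ((RExpr.var rvX).lt z)
      (.or ((NExpr.var nvNext).eq (.const 0)) (z.lt (.var rvNext))))
    (setR rvNext z ;; setN nvNext (.const 1)) skip

/-- Find the next event of the two curves to the right of the sample point. -/
def findNext : FProg :=
  setN nvNext (.const 0) ;;
  .count nvJ nvK (updNext (evE nvD (.var nvJ)) ;; updNext (evE nvCur (.var nvJ)))

/-! #### Validity of the sample point -/

/-- The test for `Hits`. -/
def hitsE (ux uy wx wy : RExpr) : BExpr :=
  .or (((wx - ux) * (wx - ux) + (wy - uy) * (wy - uy)).lt (.const 4))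
    (.and (((wx * uy - wy * ux) * (wx * uy - wy * ux)).lt (.const 4 * (wx * wx + wy * wy)))
      (.rle (ux * ux + uy * uy - .const 4) (wx * ux + wy * uy)))

/-- The test for `Coords.Blocks`, for the discs in the variables `a` and `b`. -/
def blocksE (a b : ℕ) : BExpr :=
  .or (hitsE (startE 0 b - startE 0 a) (startE 1 b - startE 1 a)
      (.var rvX + (targetE 2 a - startE 0 a)) (.var rvY + (targetE 3 a - startE 1 a)))
    (hitsE (targetE 2 b - targetE 2 a) (targetE 3 b - targetE 3 a)
      (.var rvX + (targetE 2 b - startE 0 b)) (.var rvY + (targetE 3 b - startE 1 b)))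

/-- Count the discs that block each disc. -/
def countBlocking : FProg :=
  .count nvA nvN (putN naGone (.var nvA) (.const 0) ;; putN naCnt (.var nvA) (.const 0) ;;
    .count nvB nvN (ite (.and (.not ((NExpr.var nvA).eq (.var nvB))) (blocksE nvA nvB))
      (putN naCnt (.var nvA) (.get naCnt (.var nvA) + .const 1)) skip))

/-- Find a disc that is not blocked. -/
def findFree : FProg :=
  setN nvPick (.var nvN) ;;
  .count nvA nvN (ite (.and ((NExpr.get naGone (.var nvA)).eq (.const 0))
    ((NExpr.get naCnt (.var nvA)).eq (.const 0))) (setN nvPick (.var nvA)) skip)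

/-- Remove the disc that has been found. -/
def removeFree : FProg :=
  putN naGone (.var nvPick) (.const 1) ;;
  .count nvA nvN (ite (.and (.not ((NExpr.var nvA).eq (.var nvPick))) (blocksE nvA nvPick))
    (putN naCnt (.var nvA) (.get naCnt (.var nvA) - .const 1)) skip)

/-- Test whether the sample point is a valid translation: remove free discs, as long as possible. -/
def testValid : FProg :=
  countBlocking ;; setN nvValid (.const 1) ;;
  .count nvR nvN (findFree ;;
    ite ((NExpr.var nvPick).lt (.var nvN)) removeFree (setN nvValid (.const 0)))

/-! #### Output -/

/-- Write the type and the parameters of a curve to the output. -/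
def putCurve (tag p q r c : ℕ) : FProg :=
  ite (.and (.not ((curveE raHalf c).eq (.const 0)))
      (.rle ((.var rvX - curveE raCtr c) * (.var rvX - curveE raCtr c)) (.const 4)))
    (setN nvTag (.const 2) ;;
      ite ((RExpr.const 0).lt (curveE raHalf c)) (setN nvTag (.const 1)) skip ;;
      putN tag (.var nvOut) (.var nvTag) ;; putR p (.var nvOut) (curveE raCtr c) ;;
      putR q (.var nvOut) (curveE raIcpt c) ;; putR r (.var nvOut) (.const 2))
    (putN tag (.var nvOut) (.const 0) ;; putR p (.var nvOut) (curveE raSlope c) ;;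
      putR q (.var nvOut) (curveE raIcpt c))

/-- Write the abscissas of a cell to the output. -/
def putXs : FProg :=
  ite ((RExpr.var rvRho).eq (.const 0)) (setN nvTag (.const 0))
    (ite ((NExpr.var nvE).lt (.var nvK))
      (ite ((NExpr.var nvNext).eq (.const 0)) (setN nvTag (.const 2)) (setN nvTag (.const 1)))
      (ite ((NExpr.var nvNext).eq (.const 0)) (setN nvTag (.const 4)) (setN nvTag (.const 3)))) ;;
  putN 1 (.var nvOut) (.var nvTag) ;; putR 4 (.var nvOut) (.var rvL) ;;
  putR 5 (.var nvOut) (.var rvNext)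

/-- Determine the lower curve and the upper curve of a cell and write the shape of its ordinates to
the output. -/
def putYs : FProg :=
  ite ((RExpr.var rvSig).lt (.const 0))
    (setN nvLo (.var nvCur) ;; setN nvHi (.var nvD))
    (setN nvLo (.var nvD) ;; setN nvHi (.var nvCur)) ;;
  ite ((RExpr.var rvSig).eq (.const 0)) (setN nvTag (.const 0))
    (ite ((NExpr.var nvCur).eq (.var nvD))
      (ite ((RExpr.var rvSig).lt (.const 0)) (setN nvTag (.const 3)) (setN nvTag (.const 2)))
      (setN nvTag (.const 1))) ;;
  putN 2 (.var nvOut) (.var nvTag)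

/-- Write a cell to the output. -/
def emit : FProg :=
  putXs ;; putYs ;; putCurve 3 6 7 8 nvLo ;; putCurve 4 9 10 11 nvHi ;;
  setN nvOut (.var nvOut + .const 1)

/-! #### The main loop -/

/-- Find the sample point of the cell with the given address. -/
def sample (ρ σ : ℤ) : FProg :=
  setR rvRho (.const ρ) ;; setR rvSig (.const σ) ;; setR rvX (.var rvL + .var rvRho) ;;
  shrinkRow nvD ;; findNeighbour ;; shrinkRow nvCur

/-- Report the cell with the given address, if it exists and its translations are valid. -/
def report (ρ σ : ℤ) : FProg :=
  sample ρ σ ;; sampleY ;; testAddress ;; findNext ;; testValid ;;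
  ite (.and (.not ((NExpr.var nvOk).eq (.const 0))) (.not ((NExpr.var nvValid).eq (.const 0))))
    emit skip

/-- Report all cells whose addresses have the given curve and event. -/
def reportAll : FProg :=
  ite ((NExpr.var nvE).lt (.var nvK)) (setR rvL (evE nvD (.var nvE))) (setR rvL (.var rvMin)) ;;
  report 0 (-1) ;; report 0 0 ;; report 0 1 ;; report 1 (-1) ;; report 1 0 ;; report 1 1

/-- Report all cells. -/
def reportCells : FProg := .count nvD nvM (.count nvE nvKs reportAll)

/-- The part of the program that runs after the sizes are known. -/
def mainPart : FProg := buildEvents ;; findMin ;; reportCells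

/-- The orders of the loop bounds: there are `O(n ^ 2)` curves, and each has `O(n ^ 2)` events. -/
def order : ℕ → ℕ
  | 0 => 1
  | 2 => 2
  | 3 => 2
  | 5 => 2
  | _ => 0

theorem wf_buildCurves : buildCurves.wf = true := by decide
theorem wf_mainPart : mainPart.wf = true := by decide
theorem deg_mainPart : mainPart.deg order = 6 := by decide
theorem deg_buildCurves : buildCurves.deg order = 2 := by decide
theorem bounds_mainPart : ∀ b ∈ mainPart.bounds, mainPart.wN.contains b = false := by decide
theorem bounds_buildCurves : ∀ b ∈ buildCurves.bounds, buildCurves.wN.contains b = false := by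
  decide

end FProg

/-! ### The memory during the main loop -/

/-- The curve number `i` of the table. -/
def State.curveAt (s : State) (i : ℕ) : TotalCurve :=
  ⟨s.rarr raSlope i, s.rarr raIcpt i, s.rarr raCtr i, s.rarr raHalf i⟩

/-- The entry `j` of the row `d` of the table of events. -/
def State.evAt (s : State) (d j : ℕ) : ℝ := s.rarr raEv (s.narr naRow d + j)

/-- The arrangement of the curves of an instance with `n` discs: every pair of discs contributes its
ten curves. The number `low` is less than all events. -/
structure Scene where
  A : Arrangement
  n : ℕ
  P : Coords
  curve : ℕ → TotalCurve
  low : ℝ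
  f_eq : ∀ e x, A.f e x = (curve e).val x
  legal : ∀ e < A.m, (curve e).IsLegal
  ev_left : ∀ d < A.m, ∀ e < A.m, A.ev d (11 * e + 9) = (curve e).ctr - 2
  ev_right : ∀ d < A.m, ∀ e < A.m, A.ev d (11 * e + 10) = (curve e).ctr + 2
  low_lt : ∀ d < A.m, ∀ j < A.K, low < A.ev d j
  apart : P.Apart n
  complete : ∀ a < n, ∀ b < n, ∀ i, ∀ k < 5, ∃ e < A.m, curve e = P.curve a b i k

/-- The memory holds the tables of the scene. -/
structure Tables (S : Scene) (s : State) : Prop where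
  n_eq : s.nvar nvN = S.n
  m_eq : s.nvar nvM = S.A.m
  K_eq : s.nvar nvK = S.A.K
  eleven_eq : s.nvar nvEleven = 11
  Ks_eq : s.nvar nvKs = S.A.K + 1
  curve_eq : ∀ e, s.curveAt e = S.curve e
  ev_eq : ∀ d < S.A.m, ∀ j < S.A.K, s.evAt d j = S.A.ev d j
  coords_eq : s.coords = S.P
  low_eq : s.rvar rvMin = S.low

namespace FProg

/-- The program does not write the tables. -/
def keepsTables (p : FProg) : Bool :=
  !p.wN.contains nvN && !p.wN.contains nvM && !p.wN.contains nvK && !p.wN.contains nvEleven &&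
  !p.wN.contains nvKs && !p.wR.contains rvMin && !p.wNA.contains 0 && !p.wNA.contains naRow &&
  !p.wRA.contains 0 && !p.wRA.contains 1 && !p.wRA.contains 2 && !p.wRA.contains 3 &&
  !p.wRA.contains raSlope && !p.wRA.contains raIcpt && !p.wRA.contains raCtr &&
  !p.wRA.contains raHalf && !p.wRA.contains raEv

end FProg

open FProg

theorem Tables.of_agree {S : Scene} {p : FProg} {s s' : State} (h : Tables S s)
    (ha : Agree p s s') (hp : p.keepsTables = true) : Tables S s' := by
  simp only [keepsTables, Bool.and_eq_true, Bool.not_eq_eq_eq_not, Bool.not_true] at hp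
  obtain ⟨⟨⟨⟨⟨⟨⟨⟨⟨⟨⟨⟨⟨⟨⟨⟨h0, h1⟩, h2⟩, h3⟩, h4⟩, h5⟩, h6⟩, h7⟩, h8⟩, h9⟩, h10⟩, h11⟩, h12⟩, h13⟩,
    h14⟩, h15⟩, h16⟩ := hp
  constructor
  · rw [ha.nvar _ h0, h.n_eq]
  · rw [ha.nvar _ h1, h.m_eq]
  · rw [ha.nvar _ h2, h.K_eq]
  · rw [ha.nvar _ h3, h.eleven_eq]
  · rw [ha.nvar _ h4, h.Ks_eq]
  · intro e
    rw [← h.curve_eq, State.curveAt, State.curveAt, ha.rarr _ h12, ha.rarr _ h13, ha.rarr _ h14,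
      ha.rarr _ h15]
  · intro d hd j hj
    rw [← h.ev_eq d hd j hj, State.evAt, State.evAt, ha.narr _ h7, ha.rarr _ h16]
  · rw [← h.coords_eq, State.coords, State.coords, ha.narr _ h6, ha.rarr _ h8, ha.rarr _ h9,
      ha.rarr _ h10, ha.rarr _ h11]
  · rw [ha.rvar _ h5, h.low_eq]

theorem Tables.den {S : Scene} {s : State} (h : Tables S s) {p : FProg}
    (hp : p.keepsTables = true) : Tables S (p.den s) :=
  h.of_agree (agree_den p s) hp

theorem eval_heightE {S : Scene} {s : State} (h : Tables S s) (c : ℕ) :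
    (heightE c).eval s = S.A.f (s.nvar c) (s.rvar rvX) := by
  rw [S.f_eq, ← h.curve_eq]
  simp [heightE, curveE, TotalCurve.val, State.curveAt]

theorem eval_evE {S : Scene} {s : State} (h : Tables S s) {c : ℕ} {e : NExpr}
    (hc : s.nvar c < S.A.m) (he : e.eval s < S.A.K) :
    (evE c e).eval s = S.A.ev (s.nvar c) (e.eval s) := by
  rw [← h.ev_eq _ hc _ he]
  simp [evE, State.evAt]

/-! ### Finding the sample point -/

/-- The abscissa `x` has been moved to `x'`, towards `l`. -/
structure Shrunk (l x x' : ℝ) : Prop where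
  le : x' ≤ x
  ge : l ≤ x'
  gt : l < x → l < x'

theorem Shrunk.refl {l x : ℝ} (h : l ≤ x) : Shrunk l x x := ⟨le_rfl, h, id⟩

theorem Shrunk.trans {l x x' x'' : ℝ} (h : Shrunk l x x') (h' : Shrunk l x' x'') :
    Shrunk l x x'' :=
  ⟨h'.le.trans h.le, h'.ge, fun hx => h'.gt (h.gt hx)⟩

theorem shrink_spec (z : RExpr) (s : State) (h : s.rvar rvL ≤ s.rvar rvX) :
    ∃ x, (shrink z).den s = s.setR rvX x ∧ Shrunk (s.rvar rvL) (s.rvar rvX) x ∧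
      ¬ (s.rvar rvL < z.eval s ∧ z.eval s ≤ x) := by
  by_cases hc : s.rvar rvL < z.eval s ∧ (s.rvar rvL + z.eval s) / 2 < s.rvar rvX
  · refine ⟨(s.rvar rvL + z.eval s) / 2, ?_, ⟨hc.2.le, by linarith, fun _ => by linarith⟩,
      fun h' => by linarith⟩
    rw [shrink, den_ite_pos _ _ (by simpa using hc)]
    simp
  · refine ⟨s.rvar rvX, ?_, Shrunk.refl h, fun h' => hc ⟨h'.1, by linarith⟩⟩
    rw [shrink, den_ite_neg _ _ (by simpa using hc), den_skip]
    simp [State.setR]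

/-- Shrinking for a list of events, one after the other. -/
theorem shrink_loop {i b : ℕ} {e : RExpr} (hib : i ≠ b) (s : State) (z : ℕ → ℝ)
    (h : s.rvar rvL ≤ s.rvar rvX)
    (hz : ∀ k < s.nvar b, ∀ s', Agree (.count i b (shrink e)) s s' → s'.nvar i = k →
      e.eval s' = z k) :
    Shrunk (s.rvar rvL) (s.rvar rvX) (((FProg.count i b (shrink e)).den s).rvar rvX) ∧
      ∀ k < s.nvar b, ¬ (s.rvar rvL < z k ∧
        z k ≤ ((FProg.count i b (shrink e)).den s).rvar rvX) := by
  refine for_rule (i := i) (b := b) (p := shrink e) ?_ s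
    (fun k s' => Shrunk (s.rvar rvL) (s.rvar rvX) (s'.rvar rvX) ∧
      ∀ j < k, ¬ (s.rvar rvL < z j ∧ z j ≤ s'.rvar rvX)) ?_ ?_
  · simp [wf, shrink, wN, hib]
  · simpa using Shrunk.refl h
  · intro k hk s' h1 h2 h3
    have hl : s'.rvar rvL = s.rvar rvL := h3.rvar _ (by simp [wR, shrink])
    obtain ⟨x, hx, hs, hn⟩ := shrink_spec e s' (by rw [hl]; exact h1.1.ge)
    rw [hl, hz k hk s' h3 h2] at hn
    rw [hl] at hs
    rw [hx]
    simp only [State.setN_rvar, State.setR_rvar, if_pos]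
    refine ⟨h1.1.trans hs, fun j hj => ?_⟩
    rcases Nat.lt_succ_iff_lt_or_eq.1 hj with hj | rfl
    · exact fun h' => h1.2 j hj ⟨h'.1, h'.2.trans hs.le⟩
    · exact hn

theorem shrinkRow_spec {S : Scene} {s : State} (hT : Tables S s) {c : ℕ} (hc : c ≠ nvJ)
    (hcm : s.nvar c < S.A.m) (h : s.rvar rvL ≤ s.rvar rvX) :
    Shrunk (s.rvar rvL) (s.rvar rvX) (((shrinkRow c).den s).rvar rvX) ∧
      ∀ j < S.A.K, ¬ (s.rvar rvL < S.A.ev (s.nvar c) j ∧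
        S.A.ev (s.nvar c) j ≤ ((shrinkRow c).den s).rvar rvX) := by
  have := shrink_loop (i := nvJ) (b := nvK) (e := evE c (.var nvJ)) (by norm_num) s
    (fun j => S.A.ev (s.nvar c) j) h ?_
  · rw [hT.K_eq] at this
    exact this
  · intro k hk s' ha hi
    have hT' : Tables S s' := hT.of_agree ha rfl
    have hcs : s'.nvar c = s.nvar c := ha.nvar c (by simp [wN, shrink, hc])
    rw [eval_evE hT' (by rw [hcs]; exact hcm) (by rw [hT.K_eq] at hk; simpa [hi] using hk), hcs]
    simp [hi]

namespace Arrangement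
variable (A : Arrangement)

/-- The condition `Next`, as far as the first `N` graphs are concerned. -/
def NextBelow (N : ℕ) (σ : ℝ) (d c : ℕ) (X : ℝ) : Prop :=
  (c ≠ d → c < N ∧ 0 < σ * (A.f c X - A.f d X)) ∧
    ∀ e < N, 0 < σ * (A.f e X - A.f d X) →
      c ≠ d ∧ (0 < σ * (A.f e X - A.f c X) ∨ (A.f e X = A.f c X ∧ c ≤ e))

variable {A}

theorem NextBelow.replace {e : ℕ} {σ : ℝ} {d c : ℕ} {X : ℝ} (h : A.NextBelow e σ d c X)
    (h1 : 0 < σ * (A.f e X - A.f d X)) (h2 : c = d ∨ σ * (A.f e X - A.f c X) < 0) :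
    A.NextBelow (e + 1) σ d e X := by
  refine ⟨fun _ => ⟨by omega, h1⟩, fun e' he' hpos => ⟨?_, ?_⟩⟩
  · rintro rfl; simp at h1
  · rcases Nat.lt_succ_iff_lt_or_eq.1 he' with he' | rfl
    · obtain ⟨hcd, h3⟩ := h.2 e' he' hpos
      have h4 := h2.resolve_left hcd
      rcases h3 with h3 | h3
      · left; linarith
      · left; rw [h3.1]; linarith
    · exact .inr ⟨rfl, le_rfl⟩

theorem NextBelow.keep {e : ℕ} {σ : ℝ} {d c : ℕ} {X : ℝ} (h : A.NextBelow e σ d c X)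
    (h1 : ¬ (0 < σ * (A.f e X - A.f d X) ∧ (c = d ∨ σ * (A.f e X - A.f c X) < 0))) :
    A.NextBelow (e + 1) σ d c X := by
  refine ⟨fun hcd => ⟨by linarith [(h.1 hcd).1], (h.1 hcd).2⟩, fun e' he' hpos => ?_⟩
  rcases Nat.lt_succ_iff_lt_or_eq.1 he' with he' | rfl
  · exact h.2 e' he' hpos
  · have h2 : ¬ (c = d ∨ σ * (A.f e' X - A.f c X) < 0) := fun h2 => h1 ⟨hpos, h2⟩
    push Not at h2
    refine ⟨h2.1, h2.2.lt_or_eq.imp id fun h3 => ⟨?_, ((h.1 h2.1).1).le⟩⟩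
    have hσ : σ ≠ 0 := by rintro rfl; simp at hpos
    rcases mul_eq_zero.1 h3.symm with h4 | h4
    · exact absurd h4 hσ
    · linarith

end Arrangement

/-- One step of the search for the neighbour. The result is right not only at the sample point, but
also everywhere between it and the left end, because the sample point has been moved to the left of the
events that separate the compared curves; so it stays right when the sample point moves on. -/
theorem tryNeighbour_spec {S : Scene} {s : State} (hT : Tables S s) (hd : s.nvar nvD < S.A.m)
    (hc : s.nvar nvCur < S.A.m) (he : s.nvar nvF < S.A.m) (h : s.rvar rvL ≤ s.rvar rvX)
    (hq : ∀ j < S.A.K, ¬ (s.rvar rvL < S.A.ev (s.nvar nvD) j ∧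
      S.A.ev (s.nvar nvD) j ≤ s.rvar rvX))
    (hn : ∀ ξ, (ξ = s.rvar rvX ∨ (s.rvar rvL < ξ ∧ ξ ≤ s.rvar rvX)) →
      S.A.NextBelow (s.nvar nvF) (s.rvar rvSig) (s.nvar nvD) (s.nvar nvCur) ξ) :
    Shrunk (s.rvar rvL) (s.rvar rvX) ((tryNeighbour.den s).rvar rvX) ∧
      (tryNeighbour.den s).nvar nvCur < S.A.m ∧
      ∀ ξ, (ξ = (tryNeighbour.den s).rvar rvX ∨
          (s.rvar rvL < ξ ∧ ξ ≤ (tryNeighbour.den s).rvar rvX)) →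
        S.A.NextBelow (s.nvar nvF + 1) (s.rvar rvSig) (s.nvar nvD)
          ((tryNeighbour.den s).nvar nvCur) ξ := by
  have hb := shrink_loop (i := nvT) (b := nvEleven)
    (e := evE nvCur ((NExpr.var nvF).eleven + .var nvT)) (by norm_num) s
    (fun t => S.A.ev (s.nvar nvCur) (11 * s.nvar nvF + t)) h ?_
  swap
  · intro k hk s' ha hi
    have hT' : Tables S s' := hT.of_agree ha rfl
    have hcs : s'.nvar nvCur = s.nvar nvCur := ha.nvar _ rfl
    have hfs : s'.nvar nvF = s.nvar nvF := ha.nvar _ rfl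
    rw [hT.eleven_eq] at hk
    rw [eval_evE hT' (by rw [hcs]; exact hc) (by
      simp [hi, hfs, Arrangement.K]; omega), hcs]
    simp [hi, hfs]
  rw [tryNeighbour, den_seq]
  set s₁ := (FProg.count nvT nvEleven
    (shrink (evE nvCur ((NExpr.var nvF).eleven + .var nvT)))).den s with hs₁
  have ha : Agree _ s s₁ := agree_den _ s
  have hT₁ : Tables S s₁ := hT.of_agree ha rfl
  have e1 : s₁.nvar nvCur = s.nvar nvCur := ha.nvar _ rfl
  have e2 : s₁.nvar nvF = s.nvar nvF := ha.nvar _ rfl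
  have e3 : s₁.nvar nvD = s.nvar nvD := ha.nvar _ rfl
  have e4 : s₁.rvar rvSig = s.rvar rvSig := ha.rvar _ rfl
  rw [hT.eleven_eq] at hb
  obtain ⟨hb1, hb2⟩ := hb
  -- on the remaining range, the order relative to `d` and to the candidate does not change
  have hsd : ∀ ξ, (ξ = s₁.rvar rvX ∨ (s.rvar rvL < ξ ∧ ξ ≤ s₁.rvar rvX)) →
      SignType.sign (S.A.f (s.nvar nvF) ξ - S.A.f (s.nvar nvD) ξ) =
        SignType.sign (S.A.f (s.nvar nvF) (s₁.rvar rvX) - S.A.f (s.nvar nvD) (s₁.rvar rvX)) ∧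
      SignType.sign (S.A.f (s.nvar nvF) ξ - S.A.f (s.nvar nvCur) ξ) =
        SignType.sign (S.A.f (s.nvar nvF) (s₁.rvar rvX) -
          S.A.f (s.nvar nvCur) (s₁.rvar rvX)) := by
    rintro ξ (rfl | ⟨h1, h2⟩)
    · exact ⟨rfl, rfl⟩
    · exact ⟨S.A.sep _ hd _ he _ _ h2 fun t ht h3 => hq _ (by unfold Arrangement.K; omega)
          ⟨by linarith [h3.1], h3.2.trans hb1.le⟩,
        S.A.sep _ hc _ he _ _ h2 fun t ht h3 => hb2 t ht ⟨by linarith [h3.1], h3.2⟩⟩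
  have hn' : ∀ ξ, (ξ = s₁.rvar rvX ∨ (s.rvar rvL < ξ ∧ ξ ≤ s₁.rvar rvX)) →
      S.A.NextBelow (s.nvar nvF) (s.rvar rvSig) (s.nvar nvD) (s.nvar nvCur) ξ := by
    rintro ξ (rfl | ⟨h1, h2⟩)
    · rcases h.eq_or_lt with h0 | h0
      · exact hn _ (.inl (le_antisymm hb1.le (h0 ▸ hb1.ge)))
      · exact hn _ (.inr ⟨hb1.gt h0, hb1.le⟩)
    · exact hn _ (.inr ⟨h1, h2.trans hb1.le⟩)
  have hcond : ∀ ξ, (ξ = s₁.rvar rvX ∨ (s.rvar rvL < ξ ∧ ξ ≤ s₁.rvar rvX)) →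
      ((0 < s.rvar rvSig * (S.A.f (s.nvar nvF) ξ - S.A.f (s.nvar nvD) ξ) ∧
        (s.nvar nvCur = s.nvar nvD ∨
          s.rvar rvSig * (S.A.f (s.nvar nvF) ξ - S.A.f (s.nvar nvCur) ξ) < 0)) ↔
      (BExpr.and ((RExpr.const 0).lt (.var rvSig * (heightE nvF - heightE nvD)))
        (.or ((NExpr.var nvCur).eq (.var nvD))
        ((RExpr.var rvSig * (heightE nvF - heightE nvCur)).lt (.const 0)))).holds s₁) := by
    intro ξ hξ
    obtain ⟨h1, h2⟩ := hsd ξ hξ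
    simp only [BExpr.holds_and, BExpr.holds_or, RExpr.holds_lt, NExpr.holds_eq, RExpr.eval_const,
      RExpr.eval_mul, RExpr.eval_sub, RExpr.eval_var, NExpr.eval_var, eval_heightE hT₁, e1, e2, e3,
      e4, Int.cast_zero]
    refine and_congr (sign_pos_iff h1) (or_congr Iff.rfl ?_)
    rw [← neg_pos, ← neg_pos (a := _ * (S.A.f _ (s₁.rvar rvX) - _)), ← neg_mul, ← neg_mul]
    exact sign_pos_iff h2
  by_cases hc' : (BExpr.and ((RExpr.const 0).lt (.var rvSig * (heightE nvF - heightE nvD)))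
        (.or ((NExpr.var nvCur).eq (.var nvD))
        ((RExpr.var rvSig * (heightE nvF - heightE nvCur)).lt (.const 0)))).holds s₁
  · rw [den_ite_pos _ _ hc']
    simp only [den_setN, NExpr.eval_var, State.setN_rvar, State.setN_nvar, if_pos, e2]
    refine ⟨hb1, he, fun ξ hξ => ?_⟩
    have h3 := (hcond ξ hξ).2 hc'
    exact (hn' ξ hξ).replace h3.1 h3.2
  · rw [den_ite_neg _ _ hc', den_skip, e1]
    exact ⟨hb1, hc, fun ξ hξ => (hn' ξ hξ).keep fun h3 => hc' ((hcond ξ hξ).1 h3)⟩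

theorem findNeighbour_spec {S : Scene} {s : State} (hT : Tables S s) (hd : s.nvar nvD < S.A.m)
    (h : s.rvar rvL ≤ s.rvar rvX)
    (hq : ∀ j < S.A.K, ¬ (s.rvar rvL < S.A.ev (s.nvar nvD) j ∧
      S.A.ev (s.nvar nvD) j ≤ s.rvar rvX)) :
    Shrunk (s.rvar rvL) (s.rvar rvX) ((findNeighbour.den s).rvar rvX) ∧
      (findNeighbour.den s).nvar nvCur < S.A.m ∧
      ∀ ξ, (ξ = (findNeighbour.den s).rvar rvX ∨
          (s.rvar rvL < ξ ∧ ξ ≤ (findNeighbour.den s).rvar rvX)) →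
        S.A.Next (s.rvar rvSig) (s.nvar nvD) ((findNeighbour.den s).nvar nvCur) ξ := by
  rw [findNeighbour, den_seq, den_setN]
  set s₁ := s.setN nvCur ((NExpr.var nvD).eval s) with hs₁
  have e0 : s₁.nvar nvM = S.A.m := by simp [hs₁, hT.m_eq]
  have e1 : s₁.nvar nvCur = s.nvar nvD := by simp [hs₁]
  have e2 : s₁.nvar nvD = s.nvar nvD := by simp [hs₁]
  have hT₁ : Tables S s₁ := hT.den (p := setN nvCur (.var nvD)) rfl
  have := for_rule (i := nvF) (b := nvM) (p := tryNeighbour) rfl s₁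
    (fun k s' => Shrunk (s.rvar rvL) (s.rvar rvX) (s'.rvar rvX) ∧ s'.nvar nvCur < S.A.m ∧
      ∀ ξ, (ξ = s'.rvar rvX ∨ (s.rvar rvL < ξ ∧ ξ ≤ s'.rvar rvX)) →
        S.A.NextBelow k (s.rvar rvSig) (s.nvar nvD) (s'.nvar nvCur) ξ) ?_ ?_
  · rw [e0] at this
    exact this
  · simp only [State.setN_rvar, State.setN_nvar]
    refine ⟨Shrunk.refl h, by simpa [e1] using hd, fun ξ _ => ⟨fun hne => ?_, fun e he => ?_⟩⟩
    · exact absurd (by simp [e1]) hne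
    · exact absurd he (Nat.not_lt_zero e)
  · rintro k hk s' ⟨h1, h2, h3⟩ hi ha
    rw [e0] at hk
    have hT' : Tables S s' := hT₁.of_agree ha rfl
    have d1 : s'.nvar nvD = s.nvar nvD := (ha.nvar _ rfl).trans e2
    have d2 : s'.rvar rvL = s.rvar rvL := ha.rvar _ rfl
    have d3 : s'.rvar rvSig = s.rvar rvSig := ha.rvar _ rfl
    have := tryNeighbour_spec hT' (by rw [d1]; exact hd) h2 (by rw [hi]; exact hk)
      (by rw [d2]; exact h1.ge) ?_ ?_
    · rw [hi, d1, d2, d3] at this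
      simp only [State.setN_rvar, State.setN_nvar]
      exact ⟨h1.trans this.1, by simpa using this.2.1, by simpa using this.2.2⟩
    · rw [d1, d2]
      exact fun j hj h' => hq j hj ⟨h'.1, h'.2.trans h1.le⟩
    · rw [hi, d1, d2, d3]
      exact h3

/-- The sample point that the program finds for an address. -/
theorem sample_spec {S : Scene} {s : State} (hT : Tables S s) (hd : s.nvar nvD < S.A.m)
    {k : ℕ} (hk : k ≤ S.A.K) (hl : k < S.A.K → s.rvar rvL = S.A.ev (s.nvar nvD) k)
    (hl' : k = S.A.K → s.rvar rvL = S.low) {ρ σ : ℤ} (hρ : ρ = 0 ∨ ρ = 1) :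
    S.A.Sampled (s.nvar nvD) k ρ σ (s.rvar rvL) (((sample ρ σ).den s).nvar nvCur)
      (((sample ρ σ).den s).rvar rvX) := by
  rw [sample]
  simp only [den_seq]
  set s₁ := (setR rvX (.var rvL + .var rvRho)).den
    ((setR rvSig (.const σ)).den ((setR rvRho (.const ρ)).den s)) with hs₁
  have hT₁ : Tables S s₁ := ((hT.den (p := setR rvRho (.const ρ)) rfl).den
    (p := setR rvSig (.const σ)) rfl).den (p := setR rvX (.var rvL + .var rvRho)) rfl
  have e1 : s₁.nvar nvD = s.nvar nvD := rfl
  have e2 : s₁.rvar rvL = s.rvar rvL := by simp [hs₁]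
  have e3 : s₁.rvar rvX = s.rvar rvL + ρ := by simp [hs₁]
  have e4 : s₁.rvar rvSig = σ := by simp [hs₁]
  have hρ0 : (0 : ℝ) ≤ ρ := by rcases hρ with rfl | rfl <;> simp
  obtain ⟨a1, a2⟩ := shrinkRow_spec hT₁ (c := nvD) (by norm_num) (by rw [e1]; exact hd)
    (by rw [e2, e3]; linarith)
  set s₂ := (shrinkRow nvD).den s₁
  have hT₂ : Tables S s₂ := hT₁.den rfl
  have f1 : s₂.nvar nvD = s.nvar nvD := den_nvar rfl s₁
  have f2 : s₂.rvar rvL = s.rvar rvL := (den_rvar rfl s₁).trans e2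
  have f4 : s₂.rvar rvSig = σ := (den_rvar rfl s₁).trans e4
  rw [e1, e2] at a2
  rw [e2, e3] at a1
  obtain ⟨b1, b2, b3⟩ := findNeighbour_spec hT₂ (by rw [f1]; exact hd) (by rw [f2]; exact a1.ge)
    (by rw [f1, f2]; exact a2)
  set s₃ := findNeighbour.den s₂
  have hT₃ : Tables S s₃ := hT₂.den rfl
  have g2 : s₃.rvar rvL = s.rvar rvL := (den_rvar rfl s₂).trans f2
  rw [f1, f2, f4] at b3
  rw [f2] at b1
  obtain ⟨c1, c2⟩ := shrinkRow_spec hT₃ (c := nvCur) (by norm_num) b2 (by rw [g2]; exact b1.ge)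
  set s₄ := (shrinkRow nvCur).den s₃
  have h1 : s₄.nvar nvCur = s₃.nvar nvCur := den_nvar rfl s₃
  rw [g2] at c1 c2
  rw [h1]
  have hall := (a1.trans b1).trans c1
  refine ⟨hd, hk, hl, fun hk' r hr j hj => by rw [hl' hk']; exact S.low_lt r hr j hj,
    fun hρ' => ?_, fun hρ' => ?_, b3 _ ?_,
    fun j hj h' => a2 j hj ⟨h'.1, h'.2.trans (b1.trans c1).le⟩, c2⟩
  · have h5 := hall.le
    rw [hρ', add_zero] at h5
    exact le_antisymm h5 hall.ge
  · have h6 : (0 : ℝ) < ρ := lt_of_le_of_ne hρ0 (Ne.symm hρ')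
    exact hall.gt (by linarith)
  · rcases (a1.trans b1).ge.eq_or_lt with h0 | h0
    · exact .inl (le_antisymm c1.le (h0 ▸ c1.ge))
    · exact .inr ⟨c1.gt h0, c1.le⟩

open FProg

/-- A loop that lowers a flag as soon as a condition holds. -/
theorem flag_loop {i b ok : ℕ} {c : BExpr} (hib : i ≠ b) (hio : i ≠ ok) (hbo : b ≠ ok) (s : State)
    (C : ℕ → Prop) (hC : ∀ k < s.nvar b, ∀ s',
      Agree (.count i b (ite c (setN ok (.const 0)) skip)) s s' → s'.nvar i = k →
      (c.holds s' ↔ C k)) :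
    ((FProg.count i b (ite c (setN ok (.const 0)) skip)).den s).nvar ok ≠ 0 ↔
      s.nvar ok ≠ 0 ∧ ∀ k < s.nvar b, ¬ C k := by
  refine for_rule (i := i) (b := b) (p := ite c (setN ok (.const 0)) skip) ?_ s
    (fun k s' => s'.nvar ok ≠ 0 ↔ s.nvar ok ≠ 0 ∧ ∀ j < k, ¬ C j) ?_ ?_
  · simp [wf, wN, hib, hio, hbo]
  · simp [hio.symm]
  · intro k hk s' h1 h2 h3
    have hsucc : (∀ j < k + 1, ¬ C j) ↔ (∀ j < k, ¬ C j) ∧ ¬ C k := by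
      constructor
      · exact fun h => ⟨fun j hj => h j (by omega), h k (by omega)⟩
      · rintro ⟨h, h'⟩ j hj
        rcases Nat.lt_succ_iff_lt_or_eq.1 hj with hj | rfl
        · exact h j hj
        · exact h'
    rw [hsucc, ← and_assoc, ← h1]
    by_cases hc : c.holds s'
    · rw [den_ite_pos _ _ hc]
      have := (hC k hk s' h3 h2).1 hc
      simp [hio.symm, this]
    · rw [den_ite_neg _ _ hc]
      have : ¬ C k := fun h => hc ((hC k hk s' h3 h2).2 h)
      simp [hio.symm, this]

theorem sampleY_spec {S : Scene} {s : State} (hT : Tables S s)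
    (hn : S.A.Next (s.rvar rvSig) (s.nvar nvD) (s.nvar nvCur) (s.rvar rvX)) :
    (s.rvar rvSig = 0 → (sampleY.den s).rvar rvY = S.A.f (s.nvar nvD) (s.rvar rvX)) ∧
    (s.rvar rvSig ≠ 0 →
      0 < s.rvar rvSig * ((sampleY.den s).rvar rvY - S.A.f (s.nvar nvD) (s.rvar rvX))) ∧
    (s.rvar rvSig ≠ 0 → s.nvar nvCur ≠ s.nvar nvD →
      s.rvar rvSig * ((sampleY.den s).rvar rvY - S.A.f (s.nvar nvCur) (s.rvar rvX)) < 0) := by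
  by_cases hc : s.nvar nvCur = s.nvar nvD
  · rw [sampleY, den_ite_pos _ _ (by simpa using hc)]
    simp only [den_setR, RExpr.eval_add, RExpr.eval_var, eval_heightE hT, State.setR_rvar, if_pos]
    refine ⟨fun h => by rw [h, add_zero], fun h => ?_, fun _ h => absurd hc h⟩
    rw [add_sub_cancel_left]
    exact mul_self_pos.2 h
  · rw [sampleY, den_ite_neg _ _ (by simpa using hc)]
    simp only [den_setR, RExpr.eval_add, RExpr.eval_div, RExpr.eval_const, eval_heightE hT,
      State.setR_rvar, if_pos, Int.cast_ofNat]
    have := (hn.1 hc).2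
    refine ⟨fun h => ?_, fun h => by linarith, fun _ _ => by linarith⟩
    rw [h] at hn
    exact absurd hn.eq_of_zero hc

theorem testAddress_spec {S : Scene} {s : State} (hT : Tables S s) {ρ σ : ℝ}
    (hσ : σ = -1 ∨ σ = 0 ∨ σ = 1) (hrho : s.rvar rvRho = ρ) (hsig : s.rvar rvSig = σ)
    (hs : S.A.Sampled (s.nvar nvD) (s.nvar nvE) ρ σ (s.rvar rvL) (s.nvar nvCur) (s.rvar rvX)) :
    (testAddress.den s).nvar nvOk ≠ 0 ↔
      S.A.Tests (s.nvar nvD) (s.nvar nvE) ρ σ (s.rvar rvL) (s.nvar nvCur) (s.rvar rvX) := by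
  have hd := hs.d_lt
  have hc := hs.next.lt hd
  have hK : 0 < S.A.K := by have := S.A.pos; unfold Arrangement.K; omega
  rw [testAddress]
  simp only [den_seq]
  set s₁ := (setN nvOk (.const 1)).den s with hs₁
  have hT₁ : Tables S s₁ := hT.den rfl
  have e0 : s₁.nvar nvOk = 1 := by simp [hs₁]
  set s₂ := testCanon.den s₁ with hs₂
  have hT₂ : Tables S s₂ := hT₁.den rfl
  have c1 : s₂.nvar nvOk ≠ 0 ↔ s₁.nvar nvOk ≠ 0 ∧ ∀ k < s₁.nvar nvM,
      ¬ (k < s.nvar nvD ∧ S.A.f k (s.rvar rvX) = S.A.f (s.nvar nvD) (s.rvar rvX)) := by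
    refine flag_loop (by norm_num) (by norm_num) (by norm_num) s₁ _ fun k hk s' ha hi => ?_
    have hT' : Tables S s' := hT₁.of_agree ha rfl
    have d1 : s'.nvar nvD = s.nvar nvD := ha.nvar _ rfl
    have d2 : s'.rvar rvX = s.rvar rvX := ha.rvar _ rfl
    simp [eval_heightE hT', hi, d1, d2]
  set s₃ := testEvents.den s₂ with hs₃
  have c2 : s₃.nvar nvOk ≠ 0 ↔ s₂.nvar nvOk ≠ 0 ∧ ∀ j < s₂.nvar nvK,
      ¬ ((j < s.nvar nvE ∧ S.A.ev (s.nvar nvD) j = s.rvar rvL) ∨ (σ < 0 ∧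
        s.nvar nvCur ≠ s.nvar nvD ∧ (s.nvar nvE = S.A.K ∨
          S.A.ev (s.nvar nvCur) j = s.rvar rvL))) := by
    refine flag_loop (by norm_num) (by norm_num) (by norm_num) s₂ _ fun k hk s' ha hi => ?_
    have hT' : Tables S s' := hT₂.of_agree ha rfl
    rw [hT₂.K_eq] at hk
    have hs12 : ∀ j, j ≠ nvOk → j ≠ nvF → s₂.nvar j = s.nvar j := by
      intro j h1 h2
      rw [hs₂, den_nvar (by simp [testCanon, wN, h1, h2]), hs₁]
      simp [h1]
    have d1 : s'.nvar nvD = s.nvar nvD :=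
      (ha.nvar _ rfl).trans (hs12 _ (by norm_num) (by norm_num))
    have d3 : s'.nvar nvCur = s.nvar nvCur :=
      (ha.nvar _ rfl).trans (hs12 _ (by norm_num) (by norm_num))
    have d4 : s'.nvar nvE = s.nvar nvE :=
      (ha.nvar _ rfl).trans (hs12 _ (by norm_num) (by norm_num))
    have d2 : s'.rvar rvL = s.rvar rvL := (ha.rvar _ rfl).trans (den_rvar rfl s₁)
    have d5 : s'.rvar rvSig = σ := ((ha.rvar _ rfl).trans (den_rvar rfl s₁)).trans hsig
    have v1 := eval_evE hT' (c := nvD) (e := .var nvJ) (by rw [d1]; exact hd) (by simpa [hi])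
    have v2 := eval_evE hT' (c := nvCur) (e := .var nvJ) (by rw [d3]; exact hc) (by simpa [hi])
    simp [v1, v2, hi, d1, d2, d3, d4, d5, hT'.K_eq]
  have f1 : s₃.rvar rvRho = ρ := ((den_rvar rfl s₂).trans (den_rvar rfl s₁)).trans hrho
  have f2 : s₃.nvar nvE = s.nvar nvE := (den_nvar rfl s₂).trans (den_nvar rfl s₁)
  have f3 : s₃.nvar nvK = S.A.K := (hT₂.den (p := testEvents) rfl).K_eq
  have c3 : ((ite (.and ((RExpr.var rvRho).eq (.const 0)) ((NExpr.var nvE).eq (.var nvK)))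
      (setN nvOk (.const 0)) skip).den s₃).nvar nvOk ≠ 0 ↔
      s₃.nvar nvOk ≠ 0 ∧ ¬ (ρ = 0 ∧ s.nvar nvE = S.A.K) := by
    by_cases h : ρ = 0 ∧ s.nvar nvE = S.A.K
    · rw [den_ite_pos _ _ (by simpa [f1, f2, f3] using h)]
      simp [h]
    · rw [den_ite_neg _ _ (by simpa [f1, f2, f3] using h)]
      simp [h]
  rw [c3, c2, c1, e0, hT₁.m_eq, hT₂.K_eq]
  have hkle := hs.k_le
  constructor
  · rintro ⟨⟨⟨-, h1⟩, h2⟩, h3⟩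
    refine ⟨fun e he h => h1 e (he.trans hd) ⟨he, h⟩, fun j hj hjK h => h2 j hjK (.inl ⟨hj, h⟩),
      fun h4 h5 => ⟨?_, fun j hj h => h2 j hj (.inr ⟨by rw [h4]; norm_num, h5, .inr h⟩)⟩,
      fun h => ?_⟩
    · by_contra h
      exact h2 0 hK (.inr ⟨by rw [h4]; norm_num, h5, .inl (by omega)⟩)
    · by_contra h'
      exact h3 ⟨h, by omega⟩
  · rintro ⟨h1, h2, h3, h4⟩
    refine ⟨⟨⟨one_ne_zero, fun e he h => h1 e h.1 h.2⟩, fun j hj h => ?_⟩,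
      fun h => (h4 h.1).ne h.2⟩
    rcases h with h | ⟨h5, h6, h7⟩
    · exact h2 j h.1 hj h.2
    · have hσ1 : σ = -1 := by
        rcases hσ with h | h | h
        · exact h
        · linarith
        · linarith
      obtain ⟨h8, h9⟩ := h3 hσ1 h6
      rcases h7 with h7 | h7
      · exact h8.ne h7
      · exact h9 j hj h7

/-- The variables `nvNext` and `rvNext` hold the least of the numbers `z` with `C z` that are
greater than the current abscissa, if there is one. -/
def HoldsNext (s : State) (C : ℝ → Prop) : Prop :=
  (s.nvar nvNext = 0 ∧ ∀ z, C z → ¬ s.rvar rvX < z) ∨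
    (s.nvar nvNext = 1 ∧ s.rvar rvX < s.rvar rvNext ∧ C (s.rvar rvNext) ∧
      ∀ z, C z → s.rvar rvX < z → s.rvar rvNext ≤ z)

theorem updNext_spec (e : RExpr) (s : State) {C : ℝ → Prop} (h : HoldsNext s C) :
    HoldsNext ((updNext e).den s) (fun z => C z ∨ z = e.eval s) := by
  by_cases hc : s.rvar rvX < e.eval s ∧ (s.nvar nvNext = 0 ∨ e.eval s < s.rvar rvNext)
  · rw [updNext, den_ite_pos _ _ (by simpa using hc)]
    right
    simp only [den_seq, den_setR, den_setN, State.setN_nvar, State.setN_rvar, State.setR_rvar,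
      NExpr.eval_const, if_pos, or_true, true_and, if_neg (by norm_num : ¬ rvX = rvNext)]
    refine ⟨hc.1, ?_⟩
    rintro z (hz | rfl) hxz
    · rcases h with h | h
      · exact absurd hxz (h.2 z hz)
      · rcases hc.2 with h2 | h2
        · exact absurd (h.1.symm.trans h2) one_ne_zero
        · exact h2.le.trans (h.2.2.2 z hz hxz)
    · exact le_rfl
  · rw [updNext, den_ite_neg _ _ (by simpa using hc), den_skip]
    rcases h with h | h
    · left
      refine ⟨h.1, ?_⟩
      rintro z (hz | rfl)
      · exact h.2 z hz
      · exact fun hlt => hc ⟨hlt, .inl h.1⟩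
    · right
      refine ⟨h.1, h.2.1, .inl h.2.2.1, ?_⟩
      rintro z (hz | rfl) hxz
      · exact h.2.2.2 z hz hxz
      · by_contra hlt
        exact hc ⟨hxz, .inr (not_le.1 hlt)⟩

/-- The next event of the two graphs is the right end of the cell. -/
theorem findNext_spec {S : Scene} {s : State} (hT : Tables S s) (hd : s.nvar nvD < S.A.m)
    (hc : s.nvar nvCur < S.A.m) :
    HoldsNext (findNext.den s) (fun z => ∃ j < S.A.K,
      z = S.A.ev (s.nvar nvD) j ∨ z = S.A.ev (s.nvar nvCur) j) := by
  rw [findNext, den_seq]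
  set s₁ := (setN nvNext (.const 0)).den s with hs₁
  have hT₁ : Tables S s₁ := hT.den rfl
  have := for_rule (i := nvJ) (b := nvK)
    (p := updNext (evE nvD (.var nvJ)) ;; updNext (evE nvCur (.var nvJ))) rfl s₁
    (fun k s' => HoldsNext s' (fun z => ∃ j < k,
      z = S.A.ev (s.nvar nvD) j ∨ z = S.A.ev (s.nvar nvCur) j)) ?_ ?_
  · rwa [hT₁.K_eq] at this
  · left
    simp [hs₁]
  · intro k hk s' h hi ha
    rw [hT₁.K_eq] at hk
    have hT' : Tables S s' := hT₁.of_agree ha rfl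
    have d1 : s'.nvar nvD = s.nvar nvD := ha.nvar _ rfl
    have d2 : s'.nvar nvCur = s.nvar nvCur := ha.nvar _ rfl
    have h1 := updNext_spec (evE nvD (.var nvJ)) s' h
    rw [eval_evE hT' (by rw [d1]; exact hd) (by simpa [hi])] at h1
    set s'' := (updNext (evE nvD (.var nvJ))).den s' with hs''
    have hT'' : Tables S s'' := hT'.den rfl
    have d3 : s''.nvar nvCur = s.nvar nvCur := (den_nvar rfl s').trans d2
    have d4 : s''.nvar nvJ = k := (den_nvar rfl s').trans hi
    have h2 := updNext_spec (evE nvCur (.var nvJ)) s'' h1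
    rw [eval_evE hT'' (by rw [d3]; exact hc) (by simpa [d4])] at h2
    simp only [NExpr.eval_var, hi, d1, d3, d4] at h2
    rw [den_seq, ← hs'']
    have hset : (fun z => ∃ j < k + 1, z = S.A.ev (s.nvar nvD) j ∨
        z = S.A.ev (s.nvar nvCur) j) = (fun z => ((∃ j < k, z = S.A.ev (s.nvar nvD) j ∨
          z = S.A.ev (s.nvar nvCur) j) ∨ z = S.A.ev (s.nvar nvD) k) ∨
          z = S.A.ev (s.nvar nvCur) k) := by
      funext z
      simp only [Nat.lt_succ_iff_lt_or_eq, or_and_right, exists_or, exists_eq_left, or_assoc]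
    rw [hset]
    exact h2

open FProg

/-! ### The validity test -/

theorem holds_blocksE {S : Scene} {s : State} (hT : Tables S s) (a b : ℕ) :
    (blocksE a b).holds s ↔
      S.P.Blocks (s.rvar rvX) (s.rvar rvY) (s.nvar a) (s.nvar b) := by
  rw [← hT.coords_eq]
  simp [blocksE, hitsE, startE, targetE, Coords.Blocks, Hits, State.coords, pow_two]

open Classical in
/-- The discs that have not been removed. -/
noncomputable def State.remaining (s : State) (n : ℕ) : Finset ℕ :=
  (Finset.range n).filter fun i => s.narr naGone i = 0

open Classical in
/-- The discs among `R` that block the disc `i`. -/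
noncomputable def blocking (B : ℕ → ℕ → Prop) (R : Finset ℕ) (i : ℕ) : Finset ℕ :=
  R.filter fun j => i ≠ j ∧ B i j

theorem blocking_range_succ {B : ℕ → ℕ → Prop} {k i : ℕ} :
    ((i ≠ k ∧ B i k) → (blocking B (Finset.range (k + 1)) i).card =
      (blocking B (Finset.range k) i).card + 1) ∧
    (¬ (i ≠ k ∧ B i k) → (blocking B (Finset.range (k + 1)) i).card =
      (blocking B (Finset.range k) i).card) := by
  unfold blocking
  rw [Finset.range_add_one, Finset.filter_insert]
  constructor <;> intro h
  · rw [if_pos h, Finset.card_insert_of_notMem (by simp)]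
  · rw [if_neg h]

theorem blocking_erase {B : ℕ → ℕ → Prop} {R : Finset ℕ} {p i : ℕ} (hp : p ∈ R) :
    ((i ≠ p ∧ B i p) → (blocking B (R.erase p) i).card = (blocking B R i).card - 1) ∧
    (¬ (i ≠ p ∧ B i p) → (blocking B (R.erase p) i).card = (blocking B R i).card) := by
  have h : blocking B (R.erase p) i = (blocking B R i).erase p := by
    unfold blocking; rw [Finset.filter_erase]
  rw [h]
  constructor <;> intro h
  · exact Finset.card_erase_of_mem (by simp [blocking, hp, h])
  · rw [Finset.erase_eq_of_notMem (by simp only [blocking, Finset.mem_filter]; tauto)]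

theorem countBlocking_spec {S : Scene} {s : State} (hT : Tables S s) :
    ∀ i < S.n, (countBlocking.den s).narr naGone i = 0 ∧ (countBlocking.den s).narr naCnt i =
      (blocking (S.P.Blocks (s.rvar rvX) (s.rvar rvY)) (Finset.range S.n) i).card := by
  have := for_rule (i := nvA) (b := nvN) (p := putN naGone (.var nvA) (.const 0) ;;
    putN naCnt (.var nvA) (.const 0) ;;
    .count nvB nvN (ite (.and (.not ((NExpr.var nvA).eq (.var nvB))) (blocksE nvA nvB))
      (putN naCnt (.var nvA) (.get naCnt (.var nvA) + .const 1)) skip)) (by decide) s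
    (fun k s' => ∀ i < k, s'.narr naGone i = 0 ∧ s'.narr naCnt i =
      (blocking (S.P.Blocks (s.rvar rvX) (s.rvar rvY)) (Finset.range S.n) i).card)
    (fun i hi => absurd hi (Nat.not_lt_zero i)) ?_
  · rwa [hT.n_eq] at this
  · intro k hk s' h hi ha
    have hT' : Tables S s' := hT.of_agree ha rfl
    simp only [den_seq]
    set s₁ := (putN naCnt (.var nvA) (.const 0)).den
      ((putN naGone (.var nvA) (.const 0)).den s') with hs₁
    have hT₁ : Tables S s₁ := (hT'.den (p := putN naGone (.var nvA) (.const 0)) rfl).den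
      (p := putN naCnt (.var nvA) (.const 0)) rfl
    have x1 : s₁.rvar rvX = s.rvar rvX := ha.rvar _ rfl
    have y1 : s₁.rvar rvY = s.rvar rvY := ha.rvar _ rfl
    have a1 : s₁.nvar nvA = k := hi
    have g1 : s₁.narr naGone = Function.update (s'.narr naGone) k 0 := by simp [hs₁, hi]
    have c1 : s₁.narr naCnt = Function.update (s'.narr naCnt) k 0 := by simp [hs₁, hi]
    have inner := for_rule (i := nvB) (b := nvN)
      (p := ite (.and (.not ((NExpr.var nvA).eq (.var nvB))) (blocksE nvA nvB))
        (putN naCnt (.var nvA) (.get naCnt (.var nvA) + .const 1)) skip) (by decide) s₁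
      (fun l s' => s'.narr naGone = s₁.narr naGone ∧ s'.narr naCnt =
        Function.update (s₁.narr naCnt) k
          (blocking (S.P.Blocks (s.rvar rvX) (s.rvar rvY)) (Finset.range l) k).card) ?_ ?_
    · rw [hT₁.n_eq] at inner
      simp only [State.setN_narr]
      intro i hik
      rw [inner.1, inner.2, g1, c1]
      rcases Nat.lt_succ_iff_lt_or_eq.1 hik with hik | rfl
      · rw [Function.update_of_ne hik.ne, Function.update_of_ne hik.ne,
          Function.update_of_ne hik.ne]
        exact h i hik
      · simp
    · simp [blocking, c1]
    · rintro l hl s₂ ⟨h1, h2⟩ hl2 ha2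
      have hT₂ : Tables S s₂ := hT₁.of_agree ha2 rfl
      have x2 : s₂.rvar rvX = s.rvar rvX := (ha2.rvar _ rfl).trans x1
      have y2 : s₂.rvar rvY = s.rvar rvY := (ha2.rvar _ rfl).trans y1
      have a2 : s₂.nvar nvA = k := (ha2.nvar _ rfl).trans a1
      have hiff : (BExpr.and (.not ((NExpr.var nvA).eq (.var nvB))) (blocksE nvA nvB)).holds s₂ ↔
          k ≠ l ∧ S.P.Blocks (s.rvar rvX) (s.rvar rvY) k l := by
        simp [holds_blocksE hT₂, x2, y2, a2, hl2]
      by_cases hc : (BExpr.and (.not ((NExpr.var nvA).eq (.var nvB)))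
          (blocksE nvA nvB)).holds s₂
      · rw [den_ite_pos _ _ hc, blocking_range_succ.1 (hiff.1 hc)]
        simp only [den_putN, State.setN_narr, State.putN_narr, if_pos,
          if_neg (by norm_num : ¬ naGone = naCnt)]
        refine ⟨h1, ?_⟩
        simp [h2, a2]
      · rw [den_ite_neg _ _ hc, den_skip, blocking_range_succ.2 (fun h => hc (hiff.2 h))]
        exact ⟨h1, h2⟩

theorem findFree_spec {S : Scene} {s : State} (hT : Tables S s) :
    ((findFree.den s).nvar nvPick < S.n → s.narr naGone ((findFree.den s).nvar nvPick) = 0 ∧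
      s.narr naCnt ((findFree.den s).nvar nvPick) = 0) ∧
    (¬ (findFree.den s).nvar nvPick < S.n → ∀ i < S.n,
      ¬ (s.narr naGone i = 0 ∧ s.narr naCnt i = 0)) := by
  rw [findFree, den_seq]
  set s₁ := (setN nvPick (.var nvN)).den s with hs₁
  have hT₁ : Tables S s₁ := hT.den rfl
  have p1 : s₁.nvar nvPick = S.n := by simp [hs₁, hT.n_eq]
  have := for_rule (i := nvA) (b := nvN) (p := ite (.and ((NExpr.get naGone (.var nvA)).eq
    (.const 0)) ((NExpr.get naCnt (.var nvA)).eq (.const 0))) (setN nvPick (.var nvA)) skip)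
    (by decide) s₁
    (fun k s' => (s'.nvar nvPick < S.n → s.narr naGone (s'.nvar nvPick) = 0 ∧
      s.narr naCnt (s'.nvar nvPick) = 0) ∧
      (¬ s'.nvar nvPick < S.n → ∀ i < k, ¬ (s.narr naGone i = 0 ∧ s.narr naCnt i = 0))) ?_ ?_
  · rwa [hT₁.n_eq] at this
  · simp [p1]
  · rintro k hk s' h hi ha
    rw [hT₁.n_eq] at hk
    have g1 : s'.narr naGone = s.narr naGone := ha.narr _ rfl
    have c1 : s'.narr naCnt = s.narr naCnt := ha.narr _ rfl
    by_cases hc : s.narr naGone k = 0 ∧ s.narr naCnt k = 0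
    · rw [den_ite_pos _ _ (by simpa [g1, c1, hi] using hc)]
      simp [hi, hk, hc]
    · rw [den_ite_neg _ _ (by simpa [g1, c1, hi] using hc), den_skip]
      simp only [State.setN_nvar, if_neg (by norm_num : ¬ nvPick = nvA)]
      refine ⟨h.1, fun hp i hik => ?_⟩
      rcases Nat.lt_succ_iff_lt_or_eq.1 hik with hik | rfl
      · exact h.2 hp i hik
      · exact hc

/-- When a disc is removed, the numbers of the blocking discs are corrected in linear time. -/
theorem removeFree_spec {S : Scene} {s : State} (hT : Tables S s) {p : ℕ}
    (hp : s.nvar nvPick = p) (hpm : p ∈ s.remaining S.n)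
    (h : ∀ i < S.n, s.narr naCnt i =
      (blocking (S.P.Blocks (s.rvar rvX) (s.rvar rvY)) (s.remaining S.n) i).card) :
    (removeFree.den s).remaining S.n = (s.remaining S.n).erase p ∧
    ∀ i < S.n, (removeFree.den s).narr naCnt i =
      (blocking (S.P.Blocks (s.rvar rvX) (s.rvar rvY)) ((s.remaining S.n).erase p) i).card := by
  rw [removeFree, den_seq]
  set s₁ := (putN naGone (.var nvPick) (.const 1)).den s with hs₁
  have hT₁ : Tables S s₁ := hT.den rfl
  have g1 : s₁.narr naGone = Function.update (s.narr naGone) p 1 := by simp [hs₁, hp]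
  have c1 : s₁.narr naCnt = s.narr naCnt := by simp [hs₁]
  have := for_rule (i := nvA) (b := nvN)
    (p := ite (.and (.not ((NExpr.var nvA).eq (.var nvPick))) (blocksE nvA nvPick))
    (putN naCnt (.var nvA) (.get naCnt (.var nvA) - .const 1)) skip) (by decide) s₁
    (fun k s' => (∀ i < k, s'.narr naCnt i = (blocking (S.P.Blocks (s.rvar rvX) (s.rvar rvY))
      ((s.remaining S.n).erase p) i).card) ∧ ∀ i, k ≤ i → s'.narr naCnt i = s.narr naCnt i)
    ⟨fun i hi => absurd hi (Nat.not_lt_zero i), fun i _ => by simp [c1]⟩ ?_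
  · rw [hT₁.n_eq] at this
    refine ⟨?_, this.1⟩
    ext i
    have hg : ∀ q : FProg, q.wNA.contains naGone = false → (q.den s₁).narr naGone =
        s₁.narr naGone := fun q hq => den_narr hq s₁
    simp only [State.remaining, Finset.mem_filter, Finset.mem_range, Finset.mem_erase]
    rw [hg _ rfl, g1]
    by_cases hip : i = p
    · simp [hip]
    · simp [hip]
  · rintro k hk s' ⟨h1, h2⟩ hi ha
    rw [hT₁.n_eq] at hk
    have hT' : Tables S s' := hT₁.of_agree ha rfl
    have x2 : s'.rvar rvX = s.rvar rvX := ha.rvar _ rfl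
    have y2 : s'.rvar rvY = s.rvar rvY := ha.rvar _ rfl
    have p2 : s'.nvar nvPick = p := (ha.nvar _ rfl).trans hp
    have hiff : (BExpr.and (.not ((NExpr.var nvA).eq (.var nvPick))) (blocksE nvA nvPick)).holds s'
        ↔ k ≠ p ∧ S.P.Blocks (s.rvar rvX) (s.rvar rvY) k p := by
      simp [holds_blocksE hT', x2, y2, p2, hi]
    by_cases hc : (BExpr.and (.not ((NExpr.var nvA).eq (.var nvPick)))
        (blocksE nvA nvPick)).holds s'
    · rw [den_ite_pos _ _ hc]
      simp only [den_putN, State.setN_narr, State.putN_narr, if_pos, NExpr.eval_var, hi,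
        NExpr.eval_sub, NExpr.eval_get, NExpr.eval_const]
      refine ⟨fun i hik => ?_, fun i hik => ?_⟩
      · rcases Nat.lt_succ_iff_lt_or_eq.1 hik with hik | rfl
        · rw [Function.update_of_ne hik.ne]
          exact h1 i hik
        · rw [Function.update_self, h2 i le_rfl, h i hk, (blocking_erase hpm).1 (hiff.1 hc)]
      · rw [Function.update_of_ne (by omega)]
        exact h2 i (by omega)
    · rw [den_ite_neg _ _ hc, den_skip]
      simp only [State.setN_narr]
      refine ⟨fun i hik => ?_, fun i hik => h2 i (by omega)⟩
      rcases Nat.lt_succ_iff_lt_or_eq.1 hik with hik | rfl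
      · exact h1 i hik
      · rw [h2 i le_rfl, h i hk, (blocking_erase hpm).2 (fun h => hc (hiff.2 h))]

/-- The greedy removal of free discs decides whether the sample point is valid. -/
theorem testValid_spec {S : Scene} {s : State} (hT : Tables S s) :
    (testValid.den s).nvar nvValid ≠ 0 ↔
      Orderable (S.P.Blocks (s.rvar rvX) (s.rvar rvY)) (Finset.range S.n) := by
  rw [testValid]
  simp only [den_seq]
  have hcount := countBlocking_spec hT
  set s₁ := (setN nvValid (.const 1)).den (countBlocking.den s) with hs₁
  have hT₁ : Tables S s₁ := (hT.den (p := countBlocking) rfl).den rfl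
  have v1 : s₁.nvar nvValid = 1 := by simp [hs₁]
  have x1 : s₁.rvar rvX = s.rvar rvX := den_rvar (p := countBlocking) rfl s
  have y1 : s₁.rvar rvY = s.rvar rvY := den_rvar (p := countBlocking) rfl s
  have a1 : s₁.narr = (countBlocking.den s).narr := by simp [hs₁]
  have r1 : s₁.remaining S.n = Finset.range S.n := by
    unfold State.remaining
    rw [Finset.filter_true_of_mem]
    intro i hi
    rw [a1]
    exact (hcount i (Finset.mem_range.1 hi)).1
  set B := S.P.Blocks (s.rvar rvX) (s.rvar rvY) with hB
  have := for_rule (i := nvR) (b := nvN) (p := findFree ;;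
      ite ((NExpr.var nvPick).lt (.var nvN)) removeFree (setN nvValid (.const 0)))
    (by decide) s₁
    (fun k s' => (∀ i < S.n, s'.narr naCnt i = (blocking B (s'.remaining S.n) i).card) ∧
      (Orderable B (Finset.range S.n) ↔ Orderable B (s'.remaining S.n)) ∧
      (s'.nvar nvValid ≠ 0 → (s'.remaining S.n).card + k = S.n) ∧
      (s'.nvar nvValid = 0 → ¬ Orderable B (s'.remaining S.n))) ?_ ?_
  · rw [hT₁.n_eq] at this
    obtain ⟨-, h2, h3, h4⟩ := this
    rw [h2]
    constructor
    · intro h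
      rw [Finset.card_eq_zero.1 (Nat.add_eq_right.1 (h3 h))]
      exact orderable_empty B
    · exact fun h h' => h4 h' h
  · have r1' : (s₁.setN nvR 0).remaining S.n = Finset.range S.n := r1
    rw [r1']
    refine ⟨fun i hi => ?_, .rfl, fun _ => by simp, fun h => ?_⟩
    · rw [State.setN_narr, a1]
      exact (hcount i hi).2
    · simp [v1] at h
  · rintro k hk s' ⟨h1, h2, h3, h4⟩ hi ha
    rw [hT₁.n_eq] at hk
    have hT' : Tables S s' := hT₁.of_agree ha rfl
    have x2 : s'.rvar rvX = s.rvar rvX := (ha.rvar _ rfl).trans x1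
    have y2 : s'.rvar rvY = s.rvar rvY := (ha.rvar _ rfl).trans y1
    have hff := findFree_spec hT'
    rw [den_seq]
    set s₂ := findFree.den s' with hs₂
    have hT₂ : Tables S s₂ := hT'.den rfl
    have g2 : s₂.narr = s'.narr := by funext j; exact den_narr (by rfl) s'
    have v2 : s₂.nvar nvValid = s'.nvar nvValid := den_nvar (by rfl) s'
    have x3 : s₂.rvar rvX = s.rvar rvX := (den_rvar (by rfl) s').trans x2
    have y3 : s₂.rvar rvY = s.rvar rvY := (den_rvar (by rfl) s').trans y2
    have r2 : s₂.remaining S.n = s'.remaining S.n := by unfold State.remaining; rw [g2]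
    by_cases hp : s₂.nvar nvPick < S.n
    · rw [den_ite_pos _ _ (by simpa [hT₂.n_eq] using hp)]
      obtain ⟨k1, k2⟩ := hff.1 hp
      set p := s₂.nvar nvPick with hpdef
      have hpm : p ∈ s'.remaining S.n := by simp [State.remaining, hp, k1]
      obtain ⟨q1, q2⟩ := removeFree_spec hT₂ hpdef.symm (by rw [r2]; exact hpm)
        (by rw [x3, y3, r2, g2]; exact h1)
      rw [r2] at q1 q2
      rw [x3, y3] at q2
      have v3 : (removeFree.den s₂).nvar nvValid = s'.nvar nvValid := (den_nvar (by rfl) s₂).trans v2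
      have hr : ((removeFree.den s₂).setN nvR (k + 1)).remaining S.n =
          (s'.remaining S.n).erase p := q1
      have hiff : Orderable B (s'.remaining S.n) ↔ Orderable B ((s'.remaining S.n).erase p) := by
        refine orderable_erase_iff hpm fun j hj hne hBj => ?_
        have hcard := h1 p hp
        rw [k2] at hcard
        have : j ∈ blocking B (s'.remaining S.n) p := by simp [blocking, hj, hne.symm, hBj]
        rw [Finset.card_eq_zero.1 hcard.symm] at this
        simp at this
      rw [hr]
      refine ⟨q2, h2.trans hiff, fun hv => ?_, fun hv => ?_⟩
      · have := h3 (by simpa [v3] using hv)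
        rw [Finset.card_erase_of_mem hpm]
        have := Finset.card_pos.2 ⟨p, hpm⟩
        omega
      · rw [← hiff]
        exact h4 (by simpa [v3] using hv)
    · rw [den_ite_neg _ _ (by simpa [hT₂.n_eq] using hp)]
      have hr : (((setN nvValid (.const 0)).den s₂).setN nvR (k + 1)).remaining S.n =
          s'.remaining S.n := r2
      rw [hr]
      simp only [den_setN, State.setN_narr, State.setN_nvar, g2]
      refine ⟨h1, h2, fun hv => by simp at hv, fun _ hord => ?_⟩
      by_cases hv : s'.nvar nvValid = 0
      · exact h4 hv hord
      · have hne : (s'.remaining S.n).Nonempty := by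
          rw [← Finset.card_pos]
          have := h3 hv
          omega
        -- a first disc of an order is not blocked
        obtain ⟨q, hq, hq'⟩ := hord.exists_first hne
        have hqn : q < S.n ∧ s'.narr naGone q = 0 := by simpa [State.remaining] using hq
        refine hff.2 hp q hqn.1 ⟨hqn.2, ?_⟩
        rw [h1 q hqn.1, Finset.card_eq_zero]
        ext j
        simp only [blocking, Finset.mem_filter, Finset.notMem_empty, iff_false, not_and]
        exact fun hj hne => hq' j hj hne.symm

open FProg

/-! ### The output -/

open Classical in
/-- The line or the circular arc that the curve follows near the abscissa `x`. -/
noncomputable def TotalCurve.piece (c : TotalCurve) (x : ℝ) : Curve :=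
  if c.half ≠ 0 ∧ (x - c.ctr) * (x - c.ctr) ≤ 4 then
    if 0 < c.half then .upper c.ctr c.icpt 2 else .lower c.ctr c.icpt 2
  else .line c.slope c.icpt

theorem TotalCurve.piece_spec {c : TotalCurve} (hc : c.IsLegal) {x X : ℝ}
    (hl : SignType.sign (x - (c.ctr - 2)) = SignType.sign (X - (c.ctr - 2)))
    (hr : SignType.sign (x - (c.ctr + 2)) = SignType.sign (X - (c.ctr + 2))) :
    X ∈ (c.piece x).domain ∧ (c.piece x).height X = c.val X := by
  have h1 : x < c.ctr - 2 ↔ X < c.ctr - 2 := by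
    rw [← sub_neg, ← sign_eq_neg_one_iff, hl, sign_eq_neg_one_iff, sub_neg]
  have h2 : c.ctr + 2 < x ↔ c.ctr + 2 < X := by
    rw [← sub_pos, ← sign_eq_one_iff, hr, sign_eq_one_iff, sub_pos]
  have hsq : ∀ y : ℝ, (y - c.ctr) * (y - c.ctr) ≤ 4 ↔ ¬ y < c.ctr - 2 ∧ ¬ c.ctr + 2 < y := by
    intro y
    constructor
    · intro h; constructor <;> intro h' <;> nlinarith
    · rintro ⟨h, h'⟩; nlinarith
  have hiff : (x - c.ctr) * (x - c.ctr) ≤ 4 ↔ (X - c.ctr) * (X - c.ctr) ≤ 4 := by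
    rw [hsq, hsq, h1, h2]
  unfold piece
  simp only [hiff]
  split_ifs with h h'
  · rcases hc with hc | ⟨hc, hs⟩
    · exact absurd hc h.1
    · have : c.half = 1 := hc.resolve_right (by intro h; rw [h] at h'; norm_num at h')
      refine ⟨?_, by simp only [Curve.height, val, hs, this]; ring_nf⟩
      simp only [Curve.domain, Set.mem_ofPred_eq, abs_le]
      constructor <;> nlinarith [h.2]
  · rcases hc with hc | ⟨hc, hs⟩
    · exact absurd hc h.1
    · have : c.half = -1 := hc.resolve_left (by intro h; rw [h] at h'; norm_num at h')
      refine ⟨?_, by simp only [Curve.height, val, hs, this]; ring_nf⟩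
      simp only [Curve.domain, Set.mem_ofPred_eq, abs_le]
      constructor <;> nlinarith [h.2]
  · refine ⟨Set.mem_univ _, ?_⟩
    simp only [Curve.height, val]
    rcases hc with hc | ⟨hc, hs⟩
    · simp [hc]
    · have h3 : ¬ (X - c.ctr) * (X - c.ctr) ≤ 4 := fun h3 => h ⟨by rcases hc with h | h <;> simp [h], h3⟩
      rw [Real.sqrt_eq_zero_of_nonpos (by linarith)]
      ring

open Classical in
/-- The abscissas of a cell: one point (for `ρ = 0`), or an interval that may have a left end and a
right end. -/
noncomputable def spanX (ρ : ℝ) (left right : Prop) (l b : ℝ) : Span ℝ :=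
  if ρ = 0 then .single l
  else if left then (if right then .between l b else .above l)
  else (if right then .below b else .all)

open Classical in
/-- The ordinates of a cell: on the curve `γ` (for `σ = 0`), or above or below it, up to the curve
`δ` if there is one. -/
noncomputable def spanY (σ : ℝ) (other : Prop) (γ δ : Curve) : Span Curve :=
  if σ = 0 then .single γ
  else if other then (if σ < 0 then .between δ γ else .between γ δ)
  else (if σ < 0 then .below γ else .above γ)

theorem mem_spanX {ρ : ℝ} {left right : Prop} {l b x : ℝ} :
    x ∈ (spanX ρ left right l b).toSet ↔
      (ρ = 0 → x = l) ∧ (ρ ≠ 0 → (left → l < x) ∧ (right → x < b)) := by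
  unfold spanX
  split_ifs <;> simp_all [Span.toSet]

theorem mem_spanY {σ : ℝ} (hσ : σ = -1 ∨ σ = 0 ∨ σ = 1) {other : Prop} {γ δ : Curve} {X Y : ℝ} :
    Y ∈ ((spanY σ other γ δ).map (Curve.height X)).toSet ↔ (σ = 0 → Y = γ.height X) ∧
      (σ ≠ 0 → 0 < σ * (Y - γ.height X)) ∧ (σ ≠ 0 → other → σ * (Y - δ.height X) < 0) := by
  unfold spanY
  rcases hσ with rfl | rfl | rfl
  · by_cases h : other <;> simp [h, Span.toSet, Span.map]
    exact and_comm
  · simp [Span.toSet, Span.map]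
  · by_cases h : other <;> norm_num [h, Span.toSet, Span.map]

theorem ends_spanY {σ : ℝ} {other : Prop} {γ δ ε : Curve} (h : ε ∈ (spanY σ other γ δ).ends) :
    ε = γ ∨ ε = δ := by
  unfold spanY at h
  split_ifs at h <;> simp_all [Span.ends, or_comm]

/-- Apart from the index `o`, the arrays of the two states agree. -/
def AgreeOff (o : ℕ) (s s' : State) : Prop :=
  ∀ k, k ≠ o → ∀ a, s'.narr a k = s.narr a k ∧ s'.rarr a k = s.rarr a k

theorem AgreeOff.trans {o : ℕ} {s s' s'' : State} (h : AgreeOff o s s') (h' : AgreeOff o s' s'') :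
    AgreeOff o s s'' :=
  fun k hk a => ⟨(h' k hk a).1.trans (h k hk a).1, (h' k hk a).2.trans (h k hk a).2⟩

theorem putN_agreeOff (s : State) (a o x : ℕ) : AgreeOff o s (s.putN a o x) := by
  intro k hk b
  refine ⟨?_, rfl⟩
  rw [State.putN_narr]
  split_ifs with h
  · rw [Function.update_of_ne hk, h]
  · rfl

theorem putR_agreeOff (s : State) (a o : ℕ) (x : ℝ) : AgreeOff o s (s.putR a o x) := by
  intro k hk b
  refine ⟨rfl, ?_⟩
  rw [State.putR_rarr]
  split_ifs with h
  · rw [Function.update_of_ne hk, h]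
  · rfl

theorem setN_agreeOff (s : State) (i o x : ℕ) : AgreeOff o s (s.setN i x) :=
  fun _ _ _ => ⟨rfl, rfl⟩

/-- What is written depends on whether the sample point is over the arc or over one of its rays. -/
theorem putCurve_spec {S : Scene} {s : State} (hT : Tables S s) {tag p q r c : ℕ} (hpq : p ≠ q)
    (hpr : p ≠ r) (hqr : q ≠ r) (hcn : c ≠ nvTag) (hp : p < raSlope) :
    AgreeOff (s.nvar nvOut) s ((putCurve tag p q r c).den s) ∧
    decodeCurve (((putCurve tag p q r c).den s).narr tag (s.nvar nvOut))
      (((putCurve tag p q r c).den s).rarr p (s.nvar nvOut))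
      (((putCurve tag p q r c).den s).rarr q (s.nvar nvOut))
      (((putCurve tag p q r c).den s).rarr r (s.nvar nvOut)) =
        (S.curve (s.nvar c)).piece (s.rvar rvX) := by
  have h13 : raIcpt ≠ p := by omega
  have h12 : raSlope ≠ p := by omega
  rw [← hT.curve_eq]
  unfold putCurve TotalCurve.piece
  by_cases h1 : ¬ s.rarr raHalf (s.nvar c) = 0 ∧ (s.rvar rvX - s.rarr raCtr (s.nvar c)) *
      (s.rvar rvX - s.rarr raCtr (s.nvar c)) ≤ 4
  · rw [den_ite_pos _ _ (by simpa [curveE] using h1)]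
    simp only [den_seq, den_setN]
    have key : ∀ t, (t = 1 ↔ 0 < s.rarr raHalf (s.nvar c)) → (t = 1 ∨ t = 2) →
        (ite ((RExpr.const 0).lt (curveE raHalf c)) (setN nvTag (.const 1)) skip).den
          (s.setN nvTag ((NExpr.const 2).eval s)) = s.setN nvTag t := by
      intro t ht ht'
      by_cases h2 : 0 < s.rarr raHalf (s.nvar c)
      · rw [den_ite_pos _ _ (by simpa [curveE, hcn] using h2), ht.2 h2]
        simp [State.setN]
      · rw [den_ite_neg _ _ (by simpa [curveE, hcn] using h2),
          ht'.resolve_left (fun h => h2 (ht.1 h))]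
        simp
    by_cases h2 : 0 < s.rarr raHalf (s.nvar c)
    · rw [key 1 (by simp [h2]) (.inl rfl)]
      refine ⟨?_, ?_⟩
      · exact (((setN_agreeOff _ _ _ _).trans (putN_agreeOff _ _ _ _)).trans
          (putR_agreeOff _ _ _ _)).trans ((putR_agreeOff _ _ _ _).trans (putR_agreeOff _ _ _ _))
      · simp [State.curveAt, h1, h2, decodeCurve, hpq, hpr, hqr, hcn, curveE, h13]
    · rw [key 2 (by simp [h2]) (.inr rfl)]
      refine ⟨?_, ?_⟩
      · exact (((setN_agreeOff _ _ _ _).trans (putN_agreeOff _ _ _ _)).trans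
          (putR_agreeOff _ _ _ _)).trans ((putR_agreeOff _ _ _ _).trans (putR_agreeOff _ _ _ _))
      · simp [State.curveAt, h1, h2, decodeCurve, hpq, hpr, hqr, hcn, curveE, h13]
  · rw [den_ite_neg _ _ (by simpa [curveE] using h1)]
    simp only [den_seq]
    refine ⟨((putN_agreeOff _ _ _ _).trans (putR_agreeOff _ _ _ _)).trans
      (putR_agreeOff _ _ _ _), ?_⟩
    rw [if_neg (by simpa [State.curveAt] using h1)]
    simp [State.curveAt, decodeCurve, hpq, curveE, h13]

theorem putXs_spec (s : State) :
    AgreeOff (s.nvar nvOut) s (putXs.den s) ∧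
    decodeSpan ((putXs.den s).narr 1 (s.nvar nvOut)) ((putXs.den s).rarr 4 (s.nvar nvOut))
      ((putXs.den s).rarr 5 (s.nvar nvOut)) =
        spanX (s.rvar rvRho) (s.nvar nvE < s.nvar nvK) (s.nvar nvNext ≠ 0) (s.rvar rvL)
          (s.rvar rvNext) := by
  have key : ∃ t, (ite ((RExpr.var rvRho).eq (.const 0)) (setN nvTag (.const 0))
    (ite ((NExpr.var nvE).lt (.var nvK))
      (ite ((NExpr.var nvNext).eq (.const 0)) (setN nvTag (.const 2)) (setN nvTag (.const 1)))
      (ite ((NExpr.var nvNext).eq (.const 0)) (setN nvTag (.const 4))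
        (setN nvTag (.const 3))))).den s = s.setN nvTag t ∧ ∀ l b : ℝ, decodeSpan t l b =
        spanX (s.rvar rvRho) (s.nvar nvE < s.nvar nvK) (s.nvar nvNext ≠ 0) l b := by
    by_cases h1 : s.rvar rvRho = 0
    · exact ⟨0, by rw [den_ite_pos _ _ (by simpa using h1)]; simp,
        fun l b => by simp [spanX, h1, decodeSpan]⟩
    rw [den_ite_neg _ _ (by simpa using h1)]
    by_cases h2 : s.nvar nvE < s.nvar nvK
    · rw [den_ite_pos _ _ (by simpa using h2)]
      by_cases h3 : s.nvar nvNext = 0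
      · exact ⟨2, by rw [den_ite_pos _ _ (by simpa using h3)]; simp,
          fun l b => by simp [spanX, h1, h2, h3, decodeSpan]⟩
      · exact ⟨1, by rw [den_ite_neg _ _ (by simpa using h3)]; simp,
          fun l b => by simp [spanX, h1, h2, h3, decodeSpan]⟩
    · rw [den_ite_neg _ _ (by simpa using h2)]
      by_cases h3 : s.nvar nvNext = 0
      · exact ⟨4, by rw [den_ite_pos _ _ (by simpa using h3)]; simp,
          fun l b => by simp [spanX, h1, h2, h3, decodeSpan]⟩
      · exact ⟨3, by rw [den_ite_neg _ _ (by simpa using h3)]; simp,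
          fun l b => by simp [spanX, h1, h2, h3, decodeSpan]⟩
  obtain ⟨t, h1, h2⟩ := key
  rw [putXs]
  simp only [den_seq, h1]
  refine ⟨((setN_agreeOff _ _ _ _).trans (putN_agreeOff _ _ _ _)).trans
    ((putR_agreeOff _ _ _ _).trans (putR_agreeOff _ _ _ _)), ?_⟩
  rw [← h2]
  simp

theorem putYs_spec (s : State) :
    AgreeOff (s.nvar nvOut) s (putYs.den s) ∧
    ∀ g : ℕ → Curve, decodeSpan ((putYs.den s).narr 2 (s.nvar nvOut))
        (g ((putYs.den s).nvar nvLo)) (g ((putYs.den s).nvar nvHi)) =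
      spanY (s.rvar rvSig) (s.nvar nvCur ≠ s.nvar nvD) (g (s.nvar nvD)) (g (s.nvar nvCur)) := by
  have k1 : ∃ lo hi, (ite ((RExpr.var rvSig).lt (.const 0))
      (setN nvLo (.var nvCur) ;; setN nvHi (.var nvD))
      (setN nvLo (.var nvD) ;; setN nvHi (.var nvCur))).den s = (s.setN nvLo lo).setN nvHi hi ∧
      lo = (if s.rvar rvSig < 0 then s.nvar nvCur else s.nvar nvD) ∧
      hi = (if s.rvar rvSig < 0 then s.nvar nvD else s.nvar nvCur) := by
    by_cases h : s.rvar rvSig < 0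
    · exact ⟨_, _, by rw [den_ite_pos _ _ (by simpa using h)]; simp; rfl, by simp [h], by simp [h]⟩
    · exact ⟨_, _, by rw [den_ite_neg _ _ (by simpa using h)]; simp; rfl, by simp [h], by simp [h]⟩
  obtain ⟨lo, hi, e1, e2, e3⟩ := k1
  set s₁ := (s.setN nvLo lo).setN nvHi hi with hs₁
  have f1 : s₁.nvar nvCur = s.nvar nvCur := by simp [hs₁]
  have f2 : s₁.nvar nvD = s.nvar nvD := by simp [hs₁]
  have f3 : s₁.rvar rvSig = s.rvar rvSig := by simp [hs₁]
  have k2 : ∃ t, (ite ((RExpr.var rvSig).eq (.const 0)) (setN nvTag (.const 0))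
      (ite ((NExpr.var nvCur).eq (.var nvD))
        (ite ((RExpr.var rvSig).lt (.const 0)) (setN nvTag (.const 3)) (setN nvTag (.const 2)))
        (setN nvTag (.const 1)))).den s₁ = s₁.setN nvTag t ∧ ∀ g : ℕ → Curve,
        decodeSpan t (g lo) (g hi) = spanY (s.rvar rvSig) (s.nvar nvCur ≠ s.nvar nvD)
          (g (s.nvar nvD)) (g (s.nvar nvCur)) := by
    by_cases h1 : s.rvar rvSig = 0
    · exact ⟨0, by rw [den_ite_pos _ _ (by simpa [f3] using h1)]; simp,
        fun g => by simp [spanY, h1, decodeSpan, e2]⟩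
    rw [den_ite_neg _ _ (by simpa [f3] using h1)]
    by_cases h2 : s.nvar nvCur = s.nvar nvD
    · rw [den_ite_pos _ _ (by simpa [f1, f2] using h2)]
      by_cases h3 : s.rvar rvSig < 0
      · exact ⟨3, by rw [den_ite_pos _ _ (by simpa [f3] using h3)]; simp,
          fun g => by simp [spanY, h1, h2, h3, decodeSpan, e3]⟩
      · exact ⟨2, by rw [den_ite_neg _ _ (by simpa [f3] using h3)]; simp,
          fun g => by simp [spanY, h1, h2, h3, decodeSpan, e2]⟩
    · rw [den_ite_neg _ _ (by simpa [f1, f2] using h2)]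
      refine ⟨1, by simp, fun g => ?_⟩
      by_cases h3 : s.rvar rvSig < 0 <;> simp [spanY, h1, h2, h3, decodeSpan, e2, e3]
  obtain ⟨t, h1, h2⟩ := k2
  rw [putYs]
  simp only [den_seq, e1, h1]
  refine ⟨?_, fun g => ?_⟩
  · refine (((setN_agreeOff _ _ _ _).trans (setN_agreeOff _ _ _ _)).trans
      (setN_agreeOff s₁ nvTag _ t)).trans ?_
    exact putN_agreeOff _ _ _ _
  · rw [← h2]
    simp [hs₁]

/-- The output after a cell has been written. -/
theorem emit_spec {S : Scene} {s : State} (hT : Tables S s) :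
    outputCount (emit.den s) = outputCount s + 1 ∧
    (∀ k, k ≠ outputCount s → outputCell (emit.den s) k = outputCell s k) ∧
    outputCell (emit.den s) (outputCount s) =
      ⟨spanX (s.rvar rvRho) (s.nvar nvE < s.nvar nvK) (s.nvar nvNext ≠ 0) (s.rvar rvL)
          (s.rvar rvNext),
        spanY (s.rvar rvSig) (s.nvar nvCur ≠ s.nvar nvD)
          ((S.curve (s.nvar nvD)).piece (s.rvar rvX))
          ((S.curve (s.nvar nvCur)).piece (s.rvar rvX))⟩ := by
  rw [emit]
  simp only [den_seq]
  obtain ⟨x1, x2⟩ := putXs_spec s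
  set s₁ := putXs.den s with hs₁
  have o1 : s₁.nvar nvOut = s.nvar nvOut := den_nvar (by rfl) s
  obtain ⟨y1, y2⟩ := putYs_spec s₁
  set s₂ := putYs.den s₁ with hs₂
  have o2 : s₂.nvar nvOut = s.nvar nvOut := (den_nvar (by rfl) s₁).trans o1
  have hT₂ : Tables S s₂ := (hT.den (p := putXs) rfl).den (p := putYs) rfl
  obtain ⟨a1, a2⟩ := putCurve_spec hT₂ (tag := 3) (p := 6) (q := 7) (r := 8) (c := nvLo)
    (by norm_num) (by norm_num) (by norm_num) (by norm_num) (by norm_num)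
  set s₃ := (putCurve 3 6 7 8 nvLo).den s₂ with hs₃
  have o3 : s₃.nvar nvOut = s.nvar nvOut := (den_nvar (by rfl) s₂).trans o2
  have hT₃ : Tables S s₃ := hT₂.den rfl
  have x3 : s₃.rvar rvX = s.rvar rvX := (den_rvar (by rfl) s₂).trans
    ((den_rvar (by rfl) s₁).trans (den_rvar (by rfl) s))
  have xx : s₂.rvar rvX = s.rvar rvX := (den_rvar (by rfl) s₁).trans (den_rvar (by rfl) s)
  have hi3 : s₃.nvar nvHi = s₂.nvar nvHi := den_nvar (by rfl) s₂
  obtain ⟨b1, b2⟩ := putCurve_spec hT₃ (tag := 4) (p := 9) (q := 10) (r := 11) (c := nvHi)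
    (by norm_num) (by norm_num) (by norm_num) (by norm_num) (by norm_num)
  set s₄ := (putCurve 4 9 10 11 nvHi).den s₃ with hs₄
  have o4 : s₄.nvar nvOut = s.nvar nvOut := (den_nvar (by rfl) s₃).trans o3
  rw [o1] at y1 y2
  rw [o2, xx] at a2
  rw [o3, x3, hi3] at b2
  rw [o2] at a1
  rw [o3] at b1
  have hoff := ((x1.trans y1).trans a1).trans b1
  refine ⟨by simp [outputCount, o4], fun k hk => ?_, ?_⟩
  · simp only [outputCell, den_setN, State.setN_narr, State.setN_rarr]
    simp only [fun a => (hoff k hk a).1, fun a => (hoff k hk a).2]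
  · simp only [outputCell, den_setN, State.setN_narr, State.setN_rarr, outputCount]
    have n1 : s₄.narr 1 = s₁.narr 1 := (den_narr (by rfl) s₃).trans
      ((den_narr (by rfl) s₂).trans (den_narr (by rfl) s₁))
    have n2 : s₄.narr 2 = s₂.narr 2 := (den_narr (by rfl) s₃).trans (den_narr (by rfl) s₂)
    have n3 : s₄.narr 3 = s₃.narr 3 := den_narr (by rfl) s₃
    have r4 : s₄.rarr 4 = s₁.rarr 4 := (den_rarr (by rfl) s₃).trans
      ((den_rarr (by rfl) s₂).trans (den_rarr (by rfl) s₁))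
    have r5 : s₄.rarr 5 = s₁.rarr 5 := (den_rarr (by rfl) s₃).trans
      ((den_rarr (by rfl) s₂).trans (den_rarr (by rfl) s₁))
    have r6 : s₄.rarr 6 = s₃.rarr 6 := den_rarr (by rfl) s₃
    have r7 : s₄.rarr 7 = s₃.rarr 7 := den_rarr (by rfl) s₃
    have r8 : s₄.rarr 8 = s₃.rarr 8 := den_rarr (by rfl) s₃
    rw [n1, n2, n3, r4, r5, r6, r7, r8, x2, a2, b2,
      y2 (fun e => (S.curve e).piece (s.rvar rvX))]
    have z1 : s₁.nvar nvCur = s.nvar nvCur := den_nvar (by rfl) s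
    have z2 : s₁.nvar nvD = s.nvar nvD := den_nvar (by rfl) s
    have z3 : s₁.rvar rvSig = s.rvar rvSig := den_rvar (by rfl) s
    rw [z1, z2, z3]

open FProg

/-! ### Reporting all cells -/

namespace Scene
variable (S : Scene)

/-- The valid translations. -/
def Valid : Set Plane := {v | Orderable (S.P.Blocks (v 0) (v 1)) (Finset.range S.n)}

/-- The points with a given address. -/
def region (d k : ℕ) (ρ σ : ℝ) : Set Plane := {v | ∃ c, S.A.Addr d k ρ σ c (v 0) (v 1)}

variable {S}

/-- Two points with the same address are on the same side of every curve; the ends of all arcs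
are among the events of every row. -/
theorem sameSide {d k ρ σ c X Y c' X' Y'} (h : S.A.Addr d k ρ σ c X Y)
    (h' : S.A.Addr d k ρ σ c' X' Y') {e : ℕ} (he : e < S.A.m) :
    (S.curve e).SameSide X Y X' Y' := by
  have hl := h.sign_ev_eq h' (j := 11 * e + 9) (by unfold Arrangement.K; omega)
  have hr := h.sign_ev_eq h' (j := 11 * e + 10) (by unfold Arrangement.K; omega)
  rw [S.ev_left d h.d_lt e he] at hl
  rw [S.ev_right d h.d_lt e he] at hr
  have hv := h.sign_eq h' he
  rw [S.f_eq, S.f_eq] at hv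
  exact ⟨hv, hl, hr⟩

/-- Within a cell, the same discs block each other. -/
theorem blocks_iff {d k ρ σ c X Y c' X' Y'} (h : S.A.Addr d k ρ σ c X Y)
    (h' : S.A.Addr d k ρ σ c' X' Y') {a b : ℕ} (ha : a < S.n) (hb : b < S.n) (hab : a ≠ b) :
    S.P.Blocks X Y a b ↔ S.P.Blocks X' Y' a b := by
  refine Coords.blocks_congr S.apart ha hb hab fun i k hk => ?_
  obtain ⟨e, he, hc⟩ := S.complete a ha b hb i k hk
  rw [← hc]
  exact sameSide h h' he

theorem orderable_iff {d k ρ σ c X Y c' X' Y'} (h : S.A.Addr d k ρ σ c X Y)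
    (h' : S.A.Addr d k ρ σ c' X' Y') : Orderable (S.P.Blocks X Y) (Finset.range S.n) ↔
      Orderable (S.P.Blocks X' Y') (Finset.range S.n) := by
  simp only [orderable_range_iff]
  refine exists_congr fun τ => forall₃_congr fun i j hij => not_congr ?_
  exact blocks_iff h h' (τ i).2 (τ j).2 fun he => hij.ne (τ.injective (Fin.ext he))

theorem region_disjoint {d k d' k' : ℕ} {ρ σ ρ' σ' : ℝ} (hm : Arrangement.Mode ρ σ)
    (hm' : Arrangement.Mode ρ' σ') (hne : ¬ (d = d' ∧ k = k' ∧ ρ = ρ' ∧ σ = σ')) :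
    Disjoint (S.region d k ρ σ) (S.region d' k' ρ' σ') := by
  rw [Set.disjoint_left]
  rintro v ⟨c, hc⟩ ⟨c', hc'⟩
  exact hne (hc.unique hc' hm hm')

end Scene

/-- The cells in the output describe the valid translations in the set `U`. -/
structure Reported (S : Scene) (U : Set Plane) (s : State) : Prop where
  proper : ∀ k < outputCount s, (outputCell s k).IsProper
  disjoint : ∀ k < outputCount s, ∀ l < outputCount s, k ≠ l →
    Disjoint (outputCell s k).toSet (outputCell s l).toSet
  union_eq : ⋃ k ∈ Set.Iio (outputCount s), (outputCell s k).toSet = S.Valid ∩ U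
  same : ∀ k < outputCount s, ∀ v ∈ (outputCell s k).toSet, ∀ w ∈ (outputCell s k).toSet,
    ∀ a < S.n, ∀ b < S.n, a ≠ b → (S.P.Blocks (v 0) (v 1) a b ↔ S.P.Blocks (w 0) (w 1) a b)

namespace FProg

/-- The program does not write the output. -/
def keepsOutput (p : FProg) : Bool :=
  !p.wN.contains nvOut && !p.wNA.contains 1 && !p.wNA.contains 2 && !p.wNA.contains 3 &&
  !p.wNA.contains 4 && !p.wRA.contains 4 && !p.wRA.contains 5 && !p.wRA.contains 6 &&
  !p.wRA.contains 7 && !p.wRA.contains 8 && !p.wRA.contains 9 && !p.wRA.contains 10 &&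
  !p.wRA.contains 11

end FProg

theorem Reported.den {S : Scene} {U : Set Plane} {s : State} (h : Reported S U s) {p : FProg}
    (hp : p.keepsOutput = true) : Reported S U (p.den s) := by
  simp only [keepsOutput, Bool.and_eq_true, Bool.not_eq_eq_eq_not, Bool.not_true] at hp
  obtain ⟨⟨⟨⟨⟨⟨⟨⟨⟨⟨⟨⟨h0, h1⟩, h2⟩, h3⟩, h4⟩, h5⟩, h6⟩, h7⟩, h8⟩, h9⟩, h10⟩, h11⟩, h12⟩ := hp
  have hc : outputCount (p.den s) = outputCount s := den_nvar h0 s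
  have ho : outputCell (p.den s) = outputCell s := by
    funext k
    simp only [outputCell, den_narr h1, den_narr h2, den_narr h3, den_narr h4, den_rarr h5,
      den_rarr h6, den_rarr h7, den_rarr h8, den_rarr h9, den_rarr h10, den_rarr h11, den_rarr h12]
  obtain ⟨a1, a2, a3, a4⟩ := h
  exact ⟨by rwa [hc, ho], by rwa [hc, ho], by rwa [hc, ho], by rwa [hc, ho]⟩

theorem Reported.union {S : Scene} {U R : Set Plane} {s : State} (h : Reported S U s)
    (hR : S.Valid ∩ R = ∅) : Reported S (U ∪ R) s := by
  obtain ⟨a1, a2, a3, a4⟩ := h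
  exact ⟨a1, a2, by rw [a3, Set.inter_union_distrib_left, hR, Set.union_empty], a4⟩

/-- A new cell is added to the output. -/
theorem Reported.add {S : Scene} {U : Set Plane} {s s' : State} {c : Cell} (h : Reported S U s)
    (hcount : outputCount s' = outputCount s + 1)
    (hold : ∀ k, k ≠ outputCount s → outputCell s' k = outputCell s k)
    (hnew : outputCell s' (outputCount s) = c) (hproper : c.IsProper) (hU : Disjoint U c.toSet)
    (hvalid : c.toSet ⊆ S.Valid) (hsame : ∀ v ∈ c.toSet, ∀ w ∈ c.toSet, ∀ a < S.n, ∀ b < S.n,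
      a ≠ b → (S.P.Blocks (v 0) (v 1) a b ↔ S.P.Blocks (w 0) (w 1) a b)) :
    Reported S (U ∪ c.toSet) s' := by
  have hsub : ∀ k < outputCount s, (outputCell s k).toSet ⊆ U := by
    intro k hk v hv
    have : v ∈ ⋃ k ∈ Set.Iio (outputCount s), (outputCell s k).toSet := by
      simp only [Set.mem_iUnion]
      exact ⟨k, hk, hv⟩
    rw [h.union_eq] at this
    exact this.2
  have hcase : ∀ k < outputCount s', (k < outputCount s ∧ outputCell s' k = outputCell s k) ∨
      (k = outputCount s ∧ outputCell s' k = c) := by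
    intro k hk
    rw [hcount] at hk
    rcases Nat.lt_succ_iff_lt_or_eq.1 hk with hk | rfl
    · exact .inl ⟨hk, hold k hk.ne⟩
    · exact .inr ⟨rfl, hnew⟩
  refine ⟨fun k hk => ?_, fun k hk l hl hkl => ?_, ?_, fun k hk => ?_⟩
  · rcases hcase k hk with ⟨h1, h2⟩ | ⟨h1, h2⟩ <;> rw [h2]
    · exact h.proper k h1
    · exact hproper
  · rcases hcase k hk with ⟨h1, h2⟩ | ⟨h1, h2⟩ <;> rcases hcase l hl with ⟨h3, h4⟩ | ⟨h3, h4⟩ <;>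
      rw [h2, h4]
    · exact h.disjoint k h1 l h3 hkl
    · exact hU.mono_left (hsub k h1)
    · exact (hU.mono_left (hsub l h3)).symm
    · exact absurd (h1.trans h3.symm) hkl
  · ext v
    simp only [Set.mem_iUnion, Set.mem_Iio, Set.mem_inter_iff, Set.mem_union, exists_prop]
    constructor
    · rintro ⟨k, hk, hv⟩
      rcases hcase k hk with ⟨h1, h2⟩ | ⟨h1, h2⟩ <;> rw [h2] at hv
      · have : v ∈ ⋃ k ∈ Set.Iio (outputCount s), (outputCell s k).toSet := by
          simp only [Set.mem_iUnion]
          exact ⟨k, h1, hv⟩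
        rw [h.union_eq] at this
        exact ⟨this.1, .inl this.2⟩
      · exact ⟨hvalid hv, .inr hv⟩
    · rintro ⟨hv, hv' | hv'⟩
      · have : v ∈ ⋃ k ∈ Set.Iio (outputCount s), (outputCell s k).toSet := by
          rw [h.union_eq]; exact ⟨hv, hv'⟩
        simp only [Set.mem_iUnion, Set.mem_Iio, exists_prop] at this
        obtain ⟨k, hk, hvk⟩ := this
        exact ⟨k, by omega, by rw [hold k hk.ne]; exact hvk⟩
      · exact ⟨outputCount s, by omega, by rw [hnew]; exact hv'⟩
  · rcases hcase k hk with ⟨h1, h2⟩ | ⟨h1, h2⟩ <;> rw [h2]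
    · exact h.same k h1
    · exact hsame

/-- The cell that is written for an address, with the sample point `(x, y)` and the next event `b`,
if there is one. -/
theorem cell_spec {S : Scene} {d k c : ℕ} {ρ σ l x y b : ℝ} {hasNext : Prop}
    (hm : Arrangement.Mode ρ σ) (ha : S.A.Addr d k ρ σ c x y) (hs : S.A.Sampled d k ρ σ l c x)
    (hb : ∀ X, (hasNext → X < b) ↔
      ∀ j < S.A.K, (x < S.A.ev d j → X < S.A.ev d j) ∧ (x < S.A.ev c j → X < S.A.ev c j)) :
    (Cell.mk (spanX ρ (k < S.A.K) hasNext l b) (spanY σ (c ≠ d) ((S.curve d).piece x)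
      ((S.curve c).piece x))).toSet = S.region d k ρ σ ∧
    (Cell.mk (spanX ρ (k < S.A.K) hasNext l b) (spanY σ (c ≠ d) ((S.curve d).piece x)
      ((S.curve c).piece x))).IsProper := by
  have hcm := ha.next.lt ha.d_lt
  -- over the span, the graphs are the pieces, and a suitable ordinate gives a point of the cell
  have hX : ∀ X, X ∈ (spanX ρ (k < S.A.K) hasNext l b).toSet ↔
      (ρ = 0 → X = x) ∧ (ρ ≠ 0 → S.A.InSpan d k c x X) := by
    intro X
    rw [mem_spanX]
    refine and_congr (forall_congr' fun hρ => by rw [hs.start hρ])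
      (forall_congr' fun hρ => and_congr (forall_congr' fun hk => by rw [hs.left hk]) (hb X))
  have haddr : ∀ X Y, X ∈ (spanX ρ (k < S.A.K) hasNext l b).toSet →
      (S.A.Addr d k ρ σ c X Y ↔ (σ = 0 → Y = S.A.f d X) ∧ (σ ≠ 0 → 0 < σ * (Y - S.A.f d X)) ∧
        (σ ≠ 0 → c ≠ d → σ * (Y - S.A.f c X) < 0)) := by
    intro X Y hXs
    rw [hX] at hXs
    by_cases hρ : ρ = 0
    · subst hρ
      rw [ha.iff_at]
      exact ⟨fun h => h.2.2, fun h => ⟨rfl, hXs.1 rfl, h⟩⟩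
    · rw [ha.iff_inSpan hρ]
      exact ⟨fun h => h.2.2, fun h => ⟨rfl, hXs.2 hρ, h⟩⟩
  have hpoint : ∀ X ∈ (spanX ρ (k < S.A.K) hasNext l b).toSet, ∃ Y, S.A.Addr d k ρ σ c X Y := by
    intro X hXs
    -- the graphs `d` and `c` are in the same order as at the sample point
    have hn : σ ≠ 0 → c ≠ d → 0 < σ * (S.A.f c X - S.A.f d X) := by
      intro hσ hcd
      have h0 : S.A.Addr d k ρ 0 d x (S.A.f d x) :=
        ⟨ha.d_lt, ha.k_le, ha.canon, ⟨fun h => absurd rfl h, by simp⟩, fun _ => rfl,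
          fun h => absurd rfl h, fun h => absurd rfl h, ha.start,
          fun hρ => ⟨(ha.right hρ).1, fun j hj => ⟨((ha.right hρ).2 j hj).1,
            ((ha.right hρ).2 j hj).1⟩⟩, ha.first, fun h => by norm_num at h⟩
      have h1 : S.A.Addr d k ρ 0 d X (S.A.f d X) := by
        rw [hX] at hXs
        by_cases hρ : ρ = 0
        · subst hρ
          rw [h0.iff_at]
          exact ⟨rfl, hXs.1 rfl, fun _ => rfl, fun h => absurd rfl h, fun h => absurd rfl h⟩
        · rw [h0.iff_inSpan hρ]
          refine ⟨rfl, ⟨(hXs.2 hρ).1, fun j hj => ⟨((hXs.2 hρ).2 j hj).1,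
            ((hXs.2 hρ).2 j hj).1⟩⟩, fun _ => rfl, fun h => absurd rfl h, fun h => absurd rfl h⟩
      have h2 := h0.sign_eq h1 hcm
      rw [← neg_sub (S.A.f c x), ← neg_sub (S.A.f c X), Left.sign_neg, Left.sign_neg,
        neg_inj] at h2
      exact (sign_pos_iff h2).1 (ha.next.1 hcd).2
    rcases hm.2 with hσ | hσ | hσ
    · by_cases hcd : c = d
      · refine ⟨S.A.f d X - 1, (haddr X _ hXs).2 ⟨fun h => ?_, fun _ => ?_,
          fun _ h => absurd hcd h⟩⟩
        · rw [hσ] at h; norm_num at h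
        · rw [hσ]; linarith
      · have h1 := hn (by rw [hσ]; norm_num) hcd
        rw [hσ] at h1
        refine ⟨(S.A.f d X + S.A.f c X) / 2, (haddr X _ hXs).2 ⟨fun h => ?_, fun _ => ?_,
          fun _ _ => ?_⟩⟩
        · rw [hσ] at h; norm_num at h
        · rw [hσ]; linarith
        · rw [hσ]; linarith
    · exact ⟨S.A.f d X, (haddr X _ hXs).2 ⟨fun _ => rfl, fun h => absurd hσ h,
        fun h => absurd hσ h⟩⟩
    · by_cases hcd : c = d
      · refine ⟨S.A.f d X + 1, (haddr X _ hXs).2 ⟨fun h => ?_, fun _ => ?_,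
          fun _ h => absurd hcd h⟩⟩
        · rw [hσ] at h; norm_num at h
        · rw [hσ]; linarith
      · have h1 := hn (by rw [hσ]; norm_num) hcd
        rw [hσ] at h1
        refine ⟨(S.A.f d X + S.A.f c X) / 2, (haddr X _ hXs).2 ⟨fun h => ?_, fun _ => ?_,
          fun _ _ => ?_⟩⟩
        · rw [hσ] at h; norm_num at h
        · rw [hσ]; linarith
        · rw [hσ]; linarith
  have hpiece : ∀ X ∈ (spanX ρ (k < S.A.K) hasNext l b).toSet, ∀ e < S.A.m,
      X ∈ ((S.curve e).piece x).domain ∧ ((S.curve e).piece x).height X = S.A.f e X := by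
    intro X hXs e he
    obtain ⟨Y, hY⟩ := hpoint X hXs
    have h := Scene.sameSide ha hY he
    rw [S.f_eq]
    exact TotalCurve.piece_spec (S.legal e he) h.left h.right
  have hmem : ∀ X Y, X ∈ (spanX ρ (k < S.A.K) hasNext l b).toSet →
      (Y ∈ ((spanY σ (c ≠ d) ((S.curve d).piece x)
        ((S.curve c).piece x)).map (Curve.height X)).toSet ↔ S.A.Addr d k ρ σ c X Y) := by
    intro X Y hXs
    rw [haddr X Y hXs, mem_spanY hm.2, (hpiece X hXs d ha.d_lt).2, (hpiece X hXs c hcm).2]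
  refine ⟨?_, ⟨x, ?_⟩, fun X hXs => ⟨fun γ hγ => ?_, ?_⟩⟩
  · ext v
    simp only [Cell.toSet, Scene.region]
    constructor
    · rintro ⟨h1, h2⟩
      exact ⟨c, (hmem _ _ h1).1 h2⟩
    · rintro ⟨c', h'⟩
      have := h'.neighbour_eq ha
      subst this
      have h1 : v 0 ∈ (spanX ρ (k < S.A.K) hasNext l b).toSet := by
        rw [hX]
        refine ⟨fun hρ => ?_, fun hρ => ((ha.iff_inSpan hρ).1 h').2.1⟩
        rw [(h'.start hρ).2, (ha.start hρ).2]
      exact ⟨h1, (hmem _ _ h1).2 h'⟩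
  · rw [hX]
    exact ⟨fun _ => rfl, fun hρ => ((ha.iff_inSpan hρ).1 ha).2.1⟩
  · rcases ends_spanY hγ with rfl | rfl
    · exact (hpiece X hXs d ha.d_lt).1
    · exact (hpiece X hXs c hcm).1
  · obtain ⟨Y, hY⟩ := hpoint X hXs
    exact ⟨Y, (hmem X Y hXs).2 hY⟩

theorem HoldsNext.lt_iff {S : Scene} {s : State} {d c : ℕ}
    (h : HoldsNext s (fun z => ∃ j < S.A.K, z = S.A.ev d j ∨ z = S.A.ev c j)) (X : ℝ) :
    (s.nvar nvNext ≠ 0 → X < s.rvar rvNext) ↔ ∀ j < S.A.K,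
      (s.rvar rvX < S.A.ev d j → X < S.A.ev d j) ∧
        (s.rvar rvX < S.A.ev c j → X < S.A.ev c j) := by
  rcases h with ⟨h1, h2⟩ | ⟨h1, h2, ⟨j, hj, h3⟩, h4⟩
  · refine ⟨fun _ j hj => ⟨fun h => ?_, fun h => ?_⟩, fun _ h => absurd h1 h⟩
    · exact absurd h (h2 _ ⟨j, hj, .inl rfl⟩)
    · exact absurd h (h2 _ ⟨j, hj, .inr rfl⟩)
  · constructor
    · intro h i hi
      have h5 := h (by rw [h1]; exact one_ne_zero)
      exact ⟨fun h6 => h5.trans_le (h4 _ ⟨i, hi, .inl rfl⟩ h6),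
        fun h6 => h5.trans_le (h4 _ ⟨i, hi, .inr rfl⟩ h6)⟩
    · intro h _
      rcases h3 with h3 | h3 <;> rw [h3] at h2 ⊢
      · exact (h j hj).1 h2
      · exact (h j hj).2 h2

/-- The program reports the cell of an address if it exists and consists of valid translations. -/
theorem report_spec {S : Scene} {U : Set Plane} {s : State} (hT : Tables S s)
    (hd : s.nvar nvD < S.A.m) (hk : s.nvar nvE ≤ S.A.K)
    (hl : s.nvar nvE < S.A.K → s.rvar rvL = S.A.ev (s.nvar nvD) (s.nvar nvE))
    (hl' : s.nvar nvE = S.A.K → s.rvar rvL = S.low) {ρ σ : ℤ} (hρ : ρ = 0 ∨ ρ = 1)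
    (hσ : σ = -1 ∨ σ = 0 ∨ σ = 1) (hR : Reported S U s)
    (hU : Disjoint U (S.region (s.nvar nvD) (s.nvar nvE) ρ σ)) :
    Reported S (U ∪ S.region (s.nvar nvD) (s.nvar nvE) ρ σ) ((report ρ σ).den s) := by
  have hm : Arrangement.Mode ρ σ := by
    refine ⟨by rcases hρ with rfl | rfl <;> simp, by rcases hσ with rfl | rfl | rfl <;> simp⟩
  rw [report]
  simp only [den_seq]
  have q := sample_spec hT hd hk hl hl' hρ (σ := σ)
  set s₁ := (sample ρ σ).den s with hs₁
  have hT₁ : Tables S s₁ := hT.den rfl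
  have a1 : s₁.rvar rvRho = ρ := by
    rw [hs₁, sample]
    simp only [den_seq]
    rw [den_rvar (by rfl), den_rvar (by rfl), den_rvar (by rfl)]
    simp
  have a2 : s₁.rvar rvSig = σ := by
    rw [hs₁, sample]
    simp only [den_seq]
    rw [den_rvar (by rfl), den_rvar (by rfl), den_rvar (by rfl)]
    simp
  have a3 : s₁.nvar nvD = s.nvar nvD := den_nvar (by rfl) s
  have a4 : s₁.nvar nvE = s.nvar nvE := den_nvar (by rfl) s
  have a5 : s₁.rvar rvL = s.rvar rvL := den_rvar (by rfl) s
  rw [← a3, ← a4, ← a5] at q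
  rw [← a3, ← a4] at hU ⊢
  have hR₁ : Reported S U s₁ := hR.den rfl
  clear_value s₁
  obtain ⟨y0, y1, y2⟩ := sampleY_spec hT₁ (by rw [a2]; exact q.next)
  rw [a2] at y0 y1 y2
  set s₂ := sampleY.den s₁ with hs₂
  have hT₂ : Tables S s₂ := hT₁.den rfl
  have b0 : s₂.nvar = s₁.nvar := by funext j; exact den_nvar (by rfl) s₁
  have b1 : ∀ j, j ≠ rvY → s₂.rvar j = s₁.rvar j :=
    fun j hj => den_rvar (by simp [sampleY, wR, hj]) s₁
  have ht := testAddress_spec hT₂ hm.2 ((b1 _ (by norm_num)).trans a1)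
    ((b1 _ (by norm_num)).trans a2)
    (by rw [b0, b1 _ (by norm_num), b1 _ (by norm_num)]; exact q)
  rw [b0, b1 _ (by norm_num), b1 _ (by norm_num)] at ht
  set s₃ := testAddress.den s₂ with hs₃
  have hT₃ : Tables S s₃ := hT₂.den rfl
  have c1 : ∀ j, s₃.rvar j = s₂.rvar j := fun j => den_rvar (by rfl) s₂
  have c2 : s₃.nvar nvD = s₁.nvar nvD := (den_nvar (by rfl) s₂).trans (by rw [b0])
  have c3 : s₃.nvar nvCur = s₁.nvar nvCur := (den_nvar (by rfl) s₂).trans (by rw [b0])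
  have c4 : s₃.nvar nvE = s₁.nvar nvE := (den_nvar (by rfl) s₂).trans (by rw [b0])
  have hnx := findNext_spec hT₃ (by rw [c2]; exact q.d_lt)
    (by rw [c3]; exact q.next.lt q.d_lt)
  rw [c2, c3] at hnx
  set s₄ := findNext.den s₃ with hs₄
  have hT₄ : Tables S s₄ := hT₃.den rfl
  have d1 : ∀ j, j ≠ rvNext → s₄.rvar j = s₂.rvar j := fun j hj =>
    (den_rvar (by simp [findNext, updNext, wR, hj]) s₃).trans (c1 j)
  have hv := testValid_spec hT₄
  set s₅ := testValid.den s₄ with hs₅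
  have hT₅ : Tables S s₅ := hT₄.den rfl
  have hR₅ : Reported S U s₅ :=
    (((hR₁.den (p := sampleY) rfl).den (p := testAddress) rfl).den (p := findNext) rfl).den
      (p := testValid) rfl
  have e1 : ∀ j, s₅.rvar j = s₄.rvar j := fun j => den_rvar (by rfl) s₄
  have e2 : s₅.nvar nvD = s₁.nvar nvD :=
    (den_nvar (by rfl) s₄).trans ((den_nvar (by rfl) s₃).trans c2)
  have e3 : s₅.nvar nvCur = s₁.nvar nvCur :=
    (den_nvar (by rfl) s₄).trans ((den_nvar (by rfl) s₃).trans c3)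
  have e4 : s₅.nvar nvE = s₁.nvar nvE :=
    (den_nvar (by rfl) s₄).trans ((den_nvar (by rfl) s₃).trans c4)
  have e5 : s₅.nvar nvOk = s₃.nvar nvOk := (den_nvar (by rfl) s₄).trans (den_nvar (by rfl) s₃)
  have e6 : s₅.nvar nvNext = s₄.nvar nvNext := den_nvar (by rfl) s₄
  rw [← e5] at ht
  have x4 : s₄.rvar rvX = s₁.rvar rvX := (d1 _ (by norm_num)).trans (b1 _ (by norm_num))
  have y4 : s₄.rvar rvY = s₂.rvar rvY := d1 _ (by norm_num)
  by_cases hok : s₅.nvar nvOk = 0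
  · rw [den_ite_neg _ _ (by simp [hok]), den_skip]
    refine hR₅.union ?_
    rw [Set.eq_empty_iff_forall_notMem]
    rintro v ⟨-, c, hc⟩
    exact ht.2 (q.tests hc) hok
  have hA := q.addr (ht.1 hok) y0 y1 y2
  by_cases hval : s₅.nvar nvValid = 0
  · rw [den_ite_neg _ _ (by simp [hval]), den_skip]
    refine hR₅.union ?_
    rw [Set.eq_empty_iff_forall_notMem]
    rintro v ⟨hv', c, hc⟩
    refine hv.2 ?_ hval
    rw [x4, y4]
    exact (Scene.orderable_iff hc hA).1 hv'
  rw [den_ite_pos _ _ (by simp [hok, hval])]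
  have hnext : ∀ X, (s₅.nvar nvNext ≠ 0 → X < s₅.rvar rvNext) ↔ ∀ j < S.A.K,
      (s₁.rvar rvX < S.A.ev (s₁.nvar nvD) j → X < S.A.ev (s₁.nvar nvD) j) ∧
        (s₁.rvar rvX < S.A.ev (s₁.nvar nvCur) j → X < S.A.ev (s₁.nvar nvCur) j) := by
    intro X
    rw [e6, e1, ← x4]
    exact hnx.lt_iff X
  obtain ⟨hset, hproper⟩ := cell_spec hm hA q hnext
  obtain ⟨o1, o2, o3⟩ := emit_spec hT₅
  have r1 : s₅.rvar rvRho = ρ := by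
    rw [e1, d1 _ (by norm_num), b1 _ (by norm_num), a1]
  have r2 : s₅.rvar rvSig = σ := by
    rw [e1, d1 _ (by norm_num), b1 _ (by norm_num), a2]
  have r3 : s₅.rvar rvL = s₁.rvar rvL := by
    rw [e1, d1 _ (by norm_num), b1 _ (by norm_num)]
  have r4 : s₅.rvar rvX = s₁.rvar rvX := by rw [e1, x4]
  rw [r1, r2, r3, r4, e2, e3, e4, hT₅.K_eq] at o3
  have hfin := hR₅.add o1 o2 o3 hproper (by rw [hset]; exact hU) ?_ ?_
  · rwa [hset] at hfin
  · rw [hset]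
    rintro v ⟨c, hc⟩
    have h1 := hv.1 hval
    rw [x4, y4] at h1
    exact (Scene.orderable_iff hA hc).1 h1
  · rw [hset]
    rintro v ⟨c, hc⟩ w ⟨c', hc'⟩ a ha b hb hab
    exact Scene.blocks_iff hc hc' ha hb hab

/-- The points whose address has the curve `d` and the event `k`. -/
def Scene.regionAt (S : Scene) (d k : ℕ) : Set Plane :=
  {v | ∃ ρ σ c, Arrangement.Mode ρ σ ∧ S.A.Addr d k ρ σ c (v 0) (v 1)}

theorem reportAll_spec {S : Scene} {U : Set Plane} {s : State} (hT : Tables S s)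
    (hd : s.nvar nvD < S.A.m) (hk : s.nvar nvE ≤ S.A.K) (hR : Reported S U s)
    (hU : Disjoint U (S.regionAt (s.nvar nvD) (s.nvar nvE))) :
    Reported S (U ∪ S.regionAt (s.nvar nvD) (s.nvar nvE)) (reportAll.den s) := by
  rw [reportAll, den_seq]
  set s₀ := (ite ((NExpr.var nvE).lt (.var nvK)) (setR rvL (evE nvD (.var nvE)))
    (setR rvL (.var rvMin))).den s with hs₀
  have hT₀ : Tables S s₀ := hT.den rfl
  have hR₀ : Reported S U s₀ := hR.den rfl
  have d0 : s₀.nvar nvD = s.nvar nvD := den_nvar (by rfl) s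
  have k0 : s₀.nvar nvE = s.nvar nvE := den_nvar (by rfl) s
  have l0 : s.nvar nvE < S.A.K → s₀.rvar rvL = S.A.ev (s.nvar nvD) (s.nvar nvE) := by
    intro h
    rw [hs₀, den_ite_pos _ _ (by simpa [hT.K_eq] using h), den_setR, State.setR_rvar, if_pos rfl,
      eval_evE hT (c := nvD) (e := .var nvE) hd h]
    rfl
  have l0' : s.nvar nvE = S.A.K → s₀.rvar rvL = S.low := by
    intro h
    rw [hs₀, den_ite_neg _ _ (by simp [hT.K_eq, h])]
    simpa using hT.low_eq
  generalize s.nvar nvD = d at *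
  generalize s.nvar nvE = k at *
  clear_value s₀
  -- one more kind of cell is reported
  have step : ∀ (ρ σ : ℤ) (V : Set Plane) (s' : State), (ρ = 0 ∨ ρ = 1) →
      (σ = -1 ∨ σ = 0 ∨ σ = 1) → (Tables S s' ∧ s'.nvar nvD = d ∧ s'.nvar nvE = k ∧
        s'.rvar rvL = s₀.rvar rvL ∧ Reported S V s') → Disjoint V (S.region d k ρ σ) →
      (Tables S ((report ρ σ).den s') ∧ ((report ρ σ).den s').nvar nvD = d ∧
        ((report ρ σ).den s').nvar nvE = k ∧
        ((report ρ σ).den s').rvar rvL = s₀.rvar rvL ∧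
        Reported S (V ∪ S.region d k ρ σ) ((report ρ σ).den s')) := by
    rintro ρ σ V s' hρ hσ ⟨h1, h2, h3, h4, h5⟩ h6
    refine ⟨h1.den (by rfl), (den_nvar (by rfl) s').trans h2, (den_nvar (by rfl) s').trans h3,
      (den_rvar (by rfl) s').trans h4, ?_⟩
    have := report_spec h1 (by rw [h2]; exact hd) (by rw [h3]; exact hk)
      (by rw [h2, h3, h4]; exact l0) (by rw [h3, h4]; exact l0') hρ hσ h5
      (by rw [h2, h3]; exact h6)
    rwa [h2, h3] at this
  have hUr : ∀ ρ σ : ℝ, Arrangement.Mode ρ σ → Disjoint U (S.region d k ρ σ) := by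
    intro ρ σ hm
    exact hU.mono_right fun v hv => by
      obtain ⟨c, hc⟩ := hv
      exact ⟨ρ, σ, c, hm, hc⟩
  have hdis : ∀ ρ σ ρ' σ' : ℝ, Arrangement.Mode ρ σ → Arrangement.Mode ρ' σ' →
      ¬ (ρ = ρ' ∧ σ = σ') → Disjoint (S.region d k ρ σ) (S.region d k ρ' σ') :=
    fun ρ σ ρ' σ' h1 h2 h3 => Scene.region_disjoint h1 h2 fun h => h3 h.2.2
  simp only [den_seq]
  have g1 := step 0 (-1) U s₀ (by simp) (by simp) ⟨hT₀, d0, k0, rfl, hR₀⟩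
    (hUr _ _ (by simp [Arrangement.Mode]))
  have g2 := step 0 0 _ _ (by simp) (by simp) g1 (by
    simp only [Set.disjoint_union_left]
    refine ⟨hUr _ _ ?_, hdis _ _ _ _ ?_ ?_ ?_⟩ <;> norm_num [Arrangement.Mode])
  have g3 := step 0 1 _ _ (by simp) (by simp) g2 (by
    simp only [Set.disjoint_union_left]
    refine ⟨⟨hUr _ _ ?_, hdis _ _ _ _ ?_ ?_ ?_⟩, hdis _ _ _ _ ?_ ?_ ?_⟩ <;>
      norm_num [Arrangement.Mode])
  have g4 := step 1 (-1) _ _ (by simp) (by simp) g3 (by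
    simp only [Set.disjoint_union_left]
    refine ⟨⟨⟨hUr _ _ ?_, hdis _ _ _ _ ?_ ?_ ?_⟩, hdis _ _ _ _ ?_ ?_ ?_⟩,
      hdis _ _ _ _ ?_ ?_ ?_⟩ <;> norm_num [Arrangement.Mode])
  have g5 := step 1 0 _ _ (by simp) (by simp) g4 (by
    simp only [Set.disjoint_union_left]
    refine ⟨⟨⟨⟨hUr _ _ ?_, hdis _ _ _ _ ?_ ?_ ?_⟩, hdis _ _ _ _ ?_ ?_ ?_⟩,
      hdis _ _ _ _ ?_ ?_ ?_⟩, hdis _ _ _ _ ?_ ?_ ?_⟩ <;> norm_num [Arrangement.Mode])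
  have g6 := step 1 1 _ _ (by simp) (by simp) g5 (by
    simp only [Set.disjoint_union_left]
    refine ⟨⟨⟨⟨⟨hUr _ _ ?_, hdis _ _ _ _ ?_ ?_ ?_⟩, hdis _ _ _ _ ?_ ?_ ?_⟩,
      hdis _ _ _ _ ?_ ?_ ?_⟩, hdis _ _ _ _ ?_ ?_ ?_⟩, hdis _ _ _ _ ?_ ?_ ?_⟩ <;>
      norm_num [Arrangement.Mode])
  have hfin := g6.2.2.2.2
  convert hfin using 1
  simp only [Set.union_assoc]
  congr 1
  ext v
  simp only [Scene.regionAt, Scene.region, Set.mem_union, Int.cast_zero, Int.cast_one,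
    Int.cast_neg]
  constructor
  · rintro ⟨ρ, σ, c, ⟨rfl | rfl, rfl | rfl | rfl⟩, hc⟩
    · exact .inl ⟨c, hc⟩
    · exact .inr (.inl ⟨c, hc⟩)
    · exact .inr (.inr (.inl ⟨c, hc⟩))
    · exact .inr (.inr (.inr (.inl ⟨c, hc⟩)))
    · exact .inr (.inr (.inr (.inr (.inl ⟨c, hc⟩))))
    · exact .inr (.inr (.inr (.inr (.inr ⟨c, hc⟩))))
  · rintro (⟨c, hc⟩ | ⟨c, hc⟩ | ⟨c, hc⟩ | ⟨c, hc⟩ | ⟨c, hc⟩ | ⟨c, hc⟩)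
    · exact ⟨_, _, c, by simp [Arrangement.Mode], hc⟩
    · exact ⟨_, _, c, by simp [Arrangement.Mode], hc⟩
    · exact ⟨_, _, c, by simp [Arrangement.Mode], hc⟩
    · exact ⟨_, _, c, by simp [Arrangement.Mode], hc⟩
    · exact ⟨_, _, c, by simp [Arrangement.Mode], hc⟩
    · exact ⟨_, _, c, by simp [Arrangement.Mode], hc⟩

theorem Scene.regionAt_disjoint (S : Scene) {d k d' k' : ℕ} (h : ¬ (d = d' ∧ k = k')) :
    Disjoint (S.regionAt d k) (S.regionAt d' k') := by
  rw [Set.disjoint_left]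
  rintro v ⟨ρ, σ, c, hm, hc⟩ ⟨ρ', σ', c', hm', hc'⟩
  have := hc.unique hc' hm hm'
  exact h ⟨this.1, this.2.1⟩

set_option maxRecDepth 10000 in
/-- Since every point has an address, the program reports all valid translations. -/
theorem reportCells_spec {S : Scene} {s : State} (hT : Tables S s) (hR : Reported S ∅ s) :
    Reported S Set.univ (reportCells.den s) := by
  have := for_rule (i := nvD) (b := nvM) (p := .count nvE nvKs reportAll) (by rfl) s
    (fun d s' => Reported S (⋃ d' ∈ Set.Iio d, ⋃ k' ∈ Set.Iio (S.A.K + 1), S.regionAt d' k') s')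
    ?_ ?_
  · rw [hT.m_eq] at this
    rw [reportCells]
    convert this using 1
    rw [eq_comm, Set.eq_univ_iff_forall]
    intro v
    obtain ⟨d, k, ρ, σ, c, hm, hc⟩ := S.A.exists_addr (v 0) (v 1)
    simp only [Set.mem_iUnion]
    exact ⟨d, hc.d_lt, k, Nat.lt_succ_of_le hc.k_le, ρ, σ, c, hm, hc⟩
  · have e : (⋃ d' ∈ Set.Iio 0, ⋃ k' ∈ Set.Iio (S.A.K + 1), S.regionAt d' k') = ∅ := by simp
    rw [e]
    exact hR.den (p := setN nvD (.const 0)) rfl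
  · intro d hd s' hR' hi ha
    rw [hT.m_eq] at hd
    have hT' : Tables S s' := hT.of_agree ha (by rfl)
    refine Reported.den (p := setN nvD (.const (d + 1))) ?_ rfl
    have inner := for_rule (i := nvE) (b := nvKs) (p := reportAll) (by rfl) s'
      (fun k s'' => Reported S ((⋃ d' ∈ Set.Iio d, ⋃ k' ∈ Set.Iio (S.A.K + 1),
        S.regionAt d' k') ∪ ⋃ k' ∈ Set.Iio k, S.regionAt d k') s'') ?_ ?_
    · rw [hT'.Ks_eq] at inner
      convert inner using 1
      ext v
      simp only [Set.mem_union, Set.mem_iUnion, Set.mem_Iio, exists_prop]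
      constructor
      · rintro ⟨d', hd', h⟩
        rcases Nat.lt_succ_iff_lt_or_eq.1 hd' with hd' | rfl
        · exact .inl ⟨d', hd', h⟩
        · exact .inr h
      · rintro (⟨d', hd', h⟩ | h)
        · exact ⟨d', by omega, h⟩
        · exact ⟨d, by omega, h⟩
    · have e : (⋃ k' ∈ Set.Iio 0, S.regionAt d k') = ∅ := by simp
      rw [e, Set.union_empty]
      exact hR'.den (p := setN nvE (.const 0)) rfl
    · intro k hk s'' hR'' hi' ha'
      rw [hT'.Ks_eq] at hk
      have hT'' : Tables S s'' := hT'.of_agree ha' (by rfl)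
      have hd'' : s''.nvar nvD = d := (ha'.nvar _ (by rfl)).trans hi
      refine Reported.den (p := setN nvE (.const (k + 1))) ?_ rfl
      have := reportAll_spec hT'' (by rw [hd'']; exact hd) (by rw [hi']; omega) hR'' ?_
      · rw [hd'', hi'] at this
        convert this using 1
        rw [Set.union_assoc]
        congr 1
        ext v
        simp only [Set.mem_union, Set.mem_iUnion, Set.mem_Iio, exists_prop]
        constructor
        · rintro ⟨k', hk', h⟩
          rcases Nat.lt_succ_iff_lt_or_eq.1 hk' with hk' | rfl
          · exact .inl ⟨k', hk', h⟩
          · exact .inr h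
        · rintro (⟨k', hk', h⟩ | h)
          · exact ⟨k', by omega, h⟩
          · exact ⟨k, by omega, h⟩
      · rw [hd'', hi', Set.disjoint_union_left]
        simp only [Set.disjoint_iUnion_left, Set.mem_Iio]
        exact ⟨fun d' hd' k' _ => S.regionAt_disjoint (by omega),
          fun k' hk' => S.regionAt_disjoint (by omega)⟩


/-! ### Building the tables -/

open FProg

/-- The curves that the table of curves holds. -/
def State.table (s : State) : List TotalCurve := (List.range (s.nvar nvM)).map s.curveAt

theorem State.length_table (s : State) : s.table.length = s.nvar nvM := by simp [State.table]

theorem State.mem_table {s : State} {c : TotalCurve} :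
    c ∈ s.table ↔ ∃ e < s.nvar nvM, s.curveAt e = c := by
  simp [State.table]

theorem table_congr {s s' : State} (h : s'.nvar nvM = s.nvar nvM)
    (h1 : s'.rarr raSlope = s.rarr raSlope) (h2 : s'.rarr raIcpt = s.rarr raIcpt)
    (h3 : s'.rarr raCtr = s.rarr raCtr) (h4 : s'.rarr raHalf = s.rarr raHalf) :
    s'.table = s.table := by
  have hc : s'.curveAt = s.curveAt := by
    funext e
    simp only [State.curveAt, h1, h2, h3, h4]
  rw [State.table, State.table, h, hc]

theorem addCurve_spec {s : State} {a b c d : RExpr}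
    (hb : ∀ s', s'.rvar = s.rvar → b.eval s' = b.eval s)
    (hc : ∀ s', s'.rvar = s.rvar → c.eval s' = c.eval s)
    (hd : ∀ s', s'.rvar = s.rvar → d.eval s' = d.eval s) :
    ((addCurve a b c d).den s).table =
      s.table ++ [⟨a.eval s, b.eval s, c.eval s, d.eval s⟩] := by
  have e : (addCurve a b c d).den s = (((((s.putR raSlope (s.nvar nvM) (a.eval s)).putR raIcpt
      (s.nvar nvM) (b.eval s)).putR raCtr (s.nvar nvM) (c.eval s)).putR raHalf (s.nvar nvM)
      (d.eval s)).setN nvM (s.nvar nvM + 1)) := by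
    have hb' := hb (s.putR raSlope (s.nvar nvM) (a.eval s)) rfl
    have hc' := hc ((s.putR raSlope (s.nvar nvM) (a.eval s)).putR raIcpt (s.nvar nvM)
      (b.eval s)) rfl
    have hd' := hd (((s.putR raSlope (s.nvar nvM) (a.eval s)).putR raIcpt (s.nvar nvM)
      (b.eval s)).putR raCtr (s.nvar nvM) (c.eval s)) rfl
    simp only [addCurve, den_seq, den_putR, den_setN, NExpr.eval_var, NExpr.eval_add,
      NExpr.eval_const, State.putR_nvar, hb', hc', hd']
  rw [e]
  simp only [State.table, State.setN_nvar, if_pos, List.range_succ, List.map_append,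
    List.map_cons, List.map_nil]
  congr 1
  · refine List.map_congr_left fun i hi => ?_
    have hne : i ≠ s.nvar nvM := by
      have := List.mem_range.1 hi
      omega
    simp [State.curveAt, hne]
  · simp [State.curveAt]

theorem addLine_spec {s : State} {α β γ : RExpr}
    (hβ : ∀ x, β.eval (s.setR rvAl x) = β.eval s)
    (hγ : ∀ x y, γ.eval ((s.setR rvAl x).setR rvBe y) = γ.eval s) :
    ((addLine α β γ).den s).table =
      s.table ++ [TotalCurve.ofLine (α.eval s) (β.eval s) (γ.eval s)] := by
  simp only [addLine, den_seq, den_setR, hβ, hγ]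
  rw [addCurve_spec (fun s' h => by simp [h]) (fun s' h => by simp [h]) (fun s' h => by simp)]
  simp [State.table, State.curveAt, TotalCurve.ofLine]

theorem addHits_spec (s : State) : (addHits.den s).table = s.table ++
    (List.range 5).map (hitCurve (s.rvar rvUx) (s.rvar rvUy) (s.rvar rvWx) (s.rvar rvWy)) := by
  simp only [addHits, den_seq]
  rw [addCurve_spec (fun s' h => by simp [h]) (fun s' h => by simp [h]) (fun s' h => by simp),
    addCurve_spec (fun s' h => by simp [h]) (fun s' h => by simp [h]) (fun s' h => by simp),
    addLine_spec (fun x => by simp) (fun x y => by simp),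
    addLine_spec (fun x => by simp) (fun x y => by simp),
    addLine_spec (fun x => by simp) (fun x y => by simp)]
  have h5 : List.range 5 = [0, 1, 2, 3, 4] := rfl
  simp [h5, addLine, addCurve, hitCurve, TotalCurve.ofCircle, State.table, State.curveAt]

theorem isLegal_hitCurve (ux uy wx wy : ℝ) (k : ℕ) : (hitCurve ux uy wx wy k).IsLegal := by
  unfold hitCurve
  split
  · exact TotalCurve.isLegal_ofLine _ _ _
  · exact TotalCurve.isLegal_ofLine _ _ _
  · exact TotalCurve.isLegal_ofLine _ _ _
  · exact TotalCurve.isLegal_ofCircle _ _ (.inl rfl)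
  · exact TotalCurve.isLegal_ofCircle _ _ (.inr rfl)

/-- Each pair of discs contributes ten curves to the table. -/
theorem addPair_spec (s : State) :
    ((setStart ;; addHits ;; setTarget ;; addHits).den s).table = s.table ++
      (List.range 5).map (s.coords.curve (s.nvar nvA) (s.nvar nvB) false) ++
      (List.range 5).map (s.coords.curve (s.nvar nvA) (s.nvar nvB) true) := by
  simp only [den_seq]
  set s₁ := setStart.den s with hs₁
  set s₂ := addHits.den s₁ with hs₂
  set s₃ := setTarget.den s₂ with hs₃
  have r0 : s₂.rarr 0 = s.rarr 0 := (den_rarr rfl s₁).trans (den_rarr rfl s)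
  have r1 : s₂.rarr 1 = s.rarr 1 := (den_rarr rfl s₁).trans (den_rarr rfl s)
  have r2 : s₂.rarr 2 = s.rarr 2 := (den_rarr rfl s₁).trans (den_rarr rfl s)
  have r3 : s₂.rarr 3 = s.rarr 3 := (den_rarr rfl s₁).trans (den_rarr rfl s)
  have n0 : s₂.narr 0 = s.narr 0 := (den_narr rfl s₁).trans (den_narr rfl s)
  have a0 : s₂.nvar nvA = s.nvar nvA := (den_nvar rfl s₁).trans (den_nvar rfl s)
  have b0 : s₂.nvar nvB = s.nvar nvB := (den_nvar rfl s₁).trans (den_nvar rfl s)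
  have t1 : s₁.table = s.table := table_congr (den_nvar rfl s) (den_rarr rfl s) (den_rarr rfl s)
    (den_rarr rfl s) (den_rarr rfl s)
  have t3 : s₃.table = s₂.table := table_congr (den_nvar rfl s₂) (den_rarr rfl s₂)
    (den_rarr rfl s₂) (den_rarr rfl s₂) (den_rarr rfl s₂)
  have h1 : hitCurve (s₁.rvar rvUx) (s₁.rvar rvUy) (s₁.rvar rvWx) (s₁.rvar rvWy) =
      s.coords.curve (s.nvar nvA) (s.nvar nvB) false := by
    simp [hs₁, setStart, startE, targetE, Coords.curve, State.coords]
  have h3 : hitCurve (s₃.rvar rvUx) (s₃.rvar rvUy) (s₃.rvar rvWx) (s₃.rvar rvWy) =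
      s.coords.curve (s.nvar nvA) (s.nvar nvB) true := by
    simp [hs₃, setTarget, startE, targetE, Coords.curve, State.coords, r0, r1, r2, r3, n0, a0, b0]
  rw [addHits_spec s₃, t3, hs₂, addHits_spec s₁, t1, h1, h3]

/-- The table of curves after the curves of some pairs of discs have been added. -/
structure Collected (n : ℕ) (P : Coords) (D : ℕ → ℕ → Prop) (N : ℕ) (s : State) : Prop where
  n_eq : s.nvar nvN = n
  coords_eq : s.coords = P
  length_eq : s.table.length = 1 + 10 * N
  legal : ∀ c ∈ s.table, c.IsLegal
  complete : ∀ a b, D a b → ∀ i, ∀ k < 5, P.curve a b i k ∈ s.table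

theorem Collected.congr {n : ℕ} {P : Coords} {D D' : ℕ → ℕ → Prop} {N : ℕ} {s s' : State}
    (h : Collected n P D N s) (hD : ∀ a b, D' a b → D a b) (h0 : s'.nvar nvN = s.nvar nvN)
    (h1 : s'.nvar nvM = s.nvar nvM) (h2 : s'.rarr = s.rarr) (h3 : s'.narr = s.narr) :
    Collected n P D' N s' := by
  have ht : s'.table = s.table := table_congr h1 (by rw [h2]) (by rw [h2]) (by rw [h2]) (by rw [h2])
  refine ⟨h0.trans h.n_eq, ?_, ?_, ?_, ?_⟩
  · rw [← h.coords_eq, State.coords, State.coords, h2, h3]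
  · rw [ht, h.length_eq]
  · rw [ht]; exact h.legal
  · rw [ht]; exact fun a b hab => h.complete a b (hD a b hab)

theorem Collected.addPair {n : ℕ} {P : Coords} {D : ℕ → ℕ → Prop} {N : ℕ} {s : State}
    (h : Collected n P D N s) :
    Collected n P (fun a b => D a b ∨ a = s.nvar nvA ∧ b = s.nvar nvB) (N + 1)
      ((setStart ;; addHits ;; setTarget ;; addHits).den s) := by
  have ha := agree_den (setStart ;; addHits ;; setTarget ;; addHits) s
  have ht := addPair_spec s
  rw [h.coords_eq] at ht
  have hl : ∀ a b i k, (P.curve a b i k).IsLegal := by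
    rintro a b (_ | _) k <;> exact isLegal_hitCurve _ _ _ _ _
  refine ⟨(ha.nvar _ rfl).trans h.n_eq, ?_, ?_, ?_, ?_⟩
  · rw [← h.coords_eq, State.coords, State.coords, ha.narr _ rfl, ha.rarr _ rfl, ha.rarr _ rfl,
      ha.rarr _ rfl, ha.rarr _ rfl]
  · rw [ht]
    simp only [List.length_append, List.length_map, List.length_range, h.length_eq]
    ring
  · rw [ht]
    intro c hc
    simp only [List.mem_append, List.mem_map] at hc
    rcases hc with (hc | ⟨k, -, rfl⟩) | ⟨k, -, rfl⟩
    · exact h.legal c hc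
    · exact hl _ _ _ _
    · exact hl _ _ _ _
  · rintro a b hab i k hk
    rw [ht]
    simp only [List.mem_append, List.mem_map, List.mem_range]
    rcases hab with hab | ⟨rfl, rfl⟩
    · exact .inl (.inl (h.complete a b hab i k hk))
    · cases i
      · exact .inl (.inr ⟨k, hk, rfl⟩)
      · exact .inr ⟨k, hk, rfl⟩

theorem buildCurves_spec {n : ℕ} {P : Coords} {s : State} (hn : s.nvar nvN = n)
    (hP : s.coords = P) (hs : (s.curveAt 0).IsLegal) :
    Collected n P (fun a b => a < n ∧ b < n) (n * n) (buildCurves.den s) := by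
  rw [buildCurves, den_seq, den_setN]
  set s₁ := s.setN nvM ((NExpr.const 1).eval s) with hs₁
  have hn₁ : s₁.nvar nvN = n := by simp [hs₁, hn]
  have h₁ : Collected n P (fun a _ => a < 0) (0 * n) s₁ := by
    have ht : s₁.table = [s.curveAt 0] := by simp [hs₁, State.table, State.curveAt]
    refine ⟨hn₁, hP, by simp [ht], ?_, fun a b h => absurd h (Nat.not_lt_zero a)⟩
    rw [ht]
    simpa using hs
  have := for_rule (i := nvA) (b := nvN)
    (p := .count nvB nvN (setStart ;; addHits ;; setTarget ;; addHits)) rfl s₁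
    (fun a s' => Collected n P (fun a' b => a' < a ∧ b < n) (a * n) s') ?_ ?_
  · rwa [hn₁] at this
  · exact h₁.congr (fun a b h => h.1) rfl rfl rfl rfl
  · intro a ha s' h hi hag
    have inner := for_rule (i := nvB) (b := nvN)
      (p := setStart ;; addHits ;; setTarget ;; addHits) rfl s'
      (fun b s'' => Collected n P (fun a' b' => (a' < a ∧ b' < n) ∨ a' = a ∧ b' < b)
        (a * n + b) s'') ?_ ?_
    · rw [h.n_eq] at inner
      generalize (FProg.count nvB nvN
        (setStart ;; addHits ;; setTarget ;; addHits)).den s' = s₃ at inner ⊢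
      have := inner.congr (s' := s₃.setN nvA (a + 1))
        (D' := fun a' b => a' < a + 1 ∧ b < n) (fun a' b' h => by omega) rfl rfl rfl rfl
      rwa [show (a + 1) * n = a * n + n by ring]
    · exact h.congr (fun a b h => by omega) rfl rfl rfl rfl
    · intro b hb s'' h'' hi'' hag''
      have hA : s''.nvar nvA = a := (hag''.nvar _ rfl).trans hi
      have := h''.addPair
      rw [hA, hi''] at this
      generalize (setStart ;; addHits ;; setTarget ;; addHits).den s'' = s₃ at this ⊢
      exact this.congr (fun a' b' h => by omega) rfl rfl rfl rfl

/-! #### The table of events -/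

theorem eval_eventE (s : State) {t : ℕ} (ht : t < 11) :
    (eventE t).eval s = (s.curveAt (s.nvar nvD)).event (s.curveAt (s.nvar nvF)) t := by
  interval_cases t <;>
    simp [eventE, curveE, lineCircleE, circleCircleE, TotalCurve.event, TotalCurve.lineCircle,
      TotalCurve.circleCircle, State.curveAt]

/-- The table of events has been filled, according to the function `G`, up to the current
position. -/
def FilledBy (G : ℕ → ℝ) (s : State) : Prop := ∀ i < s.nvar nvBase, s.rarr raEv i = G i

theorem addEvent_spec {G : ℕ → ℝ} {s : State} (h : FilledBy G s) {t : ℕ}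
    (hG : (eventE t).eval s = G (s.nvar nvBase)) :
    FilledBy G ((addEvent t).den s) ∧ ((addEvent t).den s).nvar nvBase = s.nvar nvBase + 1 := by
  refine ⟨fun i hi => ?_, by simp [addEvent]⟩
  simp only [addEvent, den_seq, den_putR, den_setN, hG] at hi ⊢
  simp only [NExpr.eval_var, NExpr.eval_add, NExpr.eval_const, State.putR_nvar, State.setN_nvar,
    if_pos, State.setN_rarr, State.putR_rarr] at hi ⊢
  rcases Nat.lt_succ_iff_lt_or_eq.1 hi with hi | rfl
  · rw [Function.update_of_ne hi.ne, h i hi]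
  · rw [Function.update_self]

theorem addEvents_spec {G : ℕ → ℝ} {s : State} (h : FilledBy G s)
    (hG : ∀ t < 11, (s.curveAt (s.nvar nvD)).event (s.curveAt (s.nvar nvF)) t =
      G (s.nvar nvBase + t)) :
    FilledBy G (addEvents.den s) ∧ (addEvents.den s).nvar nvBase = s.nvar nvBase + 11 := by
  have step : ∀ t < 11, ∀ s', (FilledBy G s' ∧ s'.nvar nvBase = s.nvar nvBase + t ∧
      s'.nvar nvD = s.nvar nvD ∧ s'.nvar nvF = s.nvar nvF ∧ s'.curveAt = s.curveAt) →
      (FilledBy G ((addEvent t).den s') ∧ ((addEvent t).den s').nvar nvBase =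
        s.nvar nvBase + (t + 1) ∧ ((addEvent t).den s').nvar nvD = s.nvar nvD ∧
        ((addEvent t).den s').nvar nvF = s.nvar nvF ∧
        ((addEvent t).den s').curveAt = s.curveAt) := by
    rintro t ht s' ⟨h1, h2, h3, h4, h5⟩
    obtain ⟨g1, g2⟩ := addEvent_spec (t := t) h1 (by
      rw [eval_eventE s' ht, h2, h3, h4, h5, hG t ht])
    refine ⟨g1, by rw [g2, h2, add_assoc], by simp [addEvent, h3], by simp [addEvent, h4], ?_⟩
    rw [← h5]
    funext i
    simp [addEvent, State.curveAt]
  have g := step 10 (by norm_num) _ <| step 9 (by norm_num) _ <| step 8 (by norm_num) _ <|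
    step 7 (by norm_num) _ <| step 6 (by norm_num) _ <| step 5 (by norm_num) _ <|
    step 4 (by norm_num) _ <| step 3 (by norm_num) _ <| step 2 (by norm_num) _ <|
    step 1 (by norm_num) _ <| step 0 (by norm_num) s ⟨h, rfl, rfl, rfl, rfl⟩
  simp only [addEvents, den_seq]
  exact ⟨g.1, g.2.1⟩

theorem buildEvents_spec {s : State} {m : ℕ} (hm : s.nvar nvM = m) {d e t : ℕ} (hd : d < m)
    (he : e < m) (ht : t < 11) :
    (buildEvents.den s).evAt d (11 * e + t) = (s.curveAt d).event (s.curveAt e) t := by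
  -- the position `11 m d + 11 e + t` belongs to the event `t` of the curves `d` and `e`
  let G : ℕ → ℝ := fun i => (s.curveAt (i / (11 * m))).event (s.curveAt (i % (11 * m) / 11))
    (i % (11 * m) % 11)
  have hG : ∀ d e t, e < m → t < 11 →
      G (d * (11 * m) + 11 * e + t) = (s.curveAt d).event (s.curveAt e) t := by
    intro d e t he ht
    have h1 : (d * (11 * m) + 11 * e + t) / (11 * m) = d := by
      rw [add_assoc, add_comm, Nat.add_mul_div_right _ _ (by omega),
        Nat.div_eq_of_lt (by omega), zero_add]
    have h2 : (d * (11 * m) + 11 * e + t) % (11 * m) = 11 * e + t := by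
      rw [add_assoc, add_comm, Nat.add_mul_mod_self_right, Nat.mod_eq_of_lt (by omega)]
    simp only [G, h1, h2]
    rw [show (11 * e + t) / 11 = e by omega, show (11 * e + t) % 11 = t by omega]
  have key : FilledBy G (buildEvents.den s) ∧ (buildEvents.den s).nvar nvBase = m * (11 * m) ∧
      ∀ d < m, (buildEvents.den s).narr naRow d = d * (11 * m) := by
    rw [buildEvents, den_seq, den_setN]
    set s₁ := s.setN nvBase ((NExpr.const 0).eval s) with hs₁
    have hm₁ : s₁.nvar nvM = m := by simp [hs₁, hm]
    have := for_rule (i := nvD) (b := nvM)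
      (p := putN naRow (.var nvD) (.var nvBase) ;; .count nvF nvM addEvents) rfl s₁
      (fun d s' => FilledBy G s' ∧ s'.nvar nvBase = d * (11 * m) ∧
        ∀ d' < d, s'.narr naRow d' = d' * (11 * m)) ?_ ?_
    · rwa [hm₁] at this
    · refine ⟨fun i hi => ?_, by simp [hs₁], fun d hd => absurd hd (Nat.not_lt_zero d)⟩
      simp [hs₁] at hi
    · rintro d hd s' ⟨h1, h2, h3⟩ hi ha
      rw [den_seq, den_putN]
      set s₂ := s'.putN naRow ((NExpr.var nvD).eval s') ((NExpr.var nvBase).eval s') with hs₂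
      have hm₂ : s₂.nvar nvM = m := (ha.nvar _ rfl).trans hm₁
      have inner := for_rule (i := nvF) (b := nvM) (p := addEvents) rfl s₂
        (fun e s'' => FilledBy G s'' ∧ s''.nvar nvBase = d * (11 * m) + 11 * e) ?_ ?_
      · rw [hm₂] at inner
        refine ⟨inner.1, ?_, ?_⟩
        · rw [State.setN_nvar, if_neg (by norm_num), inner.2]; ring
        · intro d' hd'
          rw [State.setN_narr, den_narr rfl]
          simp only [hs₂, State.putN_narr, if_pos, NExpr.eval_var, hi, h2]
          rcases Nat.lt_succ_iff_lt_or_eq.1 hd' with hd' | rfl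
          · rw [Function.update_of_ne hd'.ne, h3 d' hd']
          · rw [Function.update_self]
      · exact ⟨h1, by simpa [hs₂] using h2⟩
      · rintro e he s'' ⟨g1, g2⟩ gi ga
        rw [hm₂] at he
        have hD : s''.nvar nvD = d := (ga.nvar _ rfl).trans hi
        have hc : s''.curveAt = s.curveAt := by
          funext i
          rw [State.curveAt, State.curveAt]
          simp only [ga.rarr 12 rfl, ga.rarr 13 rfl, ga.rarr 14 rfl, ga.rarr 15 rfl]
          simp only [hs₂, State.putN_rarr, ha.rarr 12 rfl, ha.rarr 13 rfl, ha.rarr 14 rfl,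
            ha.rarr 15 rfl]
          simp [hs₁]
        obtain ⟨f1, f2⟩ := addEvents_spec g1 (fun t ht => by
          rw [hD, gi, hc, g2, hG d e t he ht])
        generalize addEvents.den s'' = s₃ at f1 f2 ⊢
        refine ⟨f1, ?_⟩
        rw [State.setN_nvar, if_neg (by norm_num), f2, g2]
        ring
  obtain ⟨h1, h2, h3⟩ := key
  have h4 : d * (11 * m) + 11 * e + t < m * (11 * m) := by
    have : (d + 1) * (11 * m) ≤ m * (11 * m) := Nat.mul_le_mul_right _ hd
    rw [add_mul] at this
    omega
  rw [State.evAt, h3 d hd, ← hG d e t he ht, ← h1 _ (by rw [h2]; exact h4), add_assoc]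

/-- The number `rvMin` is to the left of all events. -/
theorem findMin_spec {s : State} {m K : ℕ} (hm : s.nvar nvM = m) (hK : s.nvar nvK = K) :
    ∀ d < m, ∀ j < K, (findMin.den s).rvar rvMin < s.evAt d j := by
  rw [findMin, den_seq, den_setR]
  set s₁ := s.setR rvMin ((RExpr.const 0).eval s) with hs₁
  have := for_rule (i := nvD) (b := nvM) (p := .count nvJ nvK
      (ite ((evE nvD (.var nvJ) - .const 1).lt (.var rvMin))
        (setR rvMin (evE nvD (.var nvJ) - .const 1)) skip)) rfl s₁
    (fun d s' => ∀ d' < d, ∀ j < K, s'.rvar rvMin < s.evAt d' j) ?_ ?_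
  · rwa [show s₁.nvar nvM = m from hm] at this
  · exact fun d hd => absurd hd (Nat.not_lt_zero d)
  · intro d hd s' h hi ha
    have hK' : s'.nvar nvK = K := (ha.nvar _ rfl).trans hK
    have inner := for_rule (i := nvJ) (b := nvK)
      (p := ite ((evE nvD (.var nvJ) - .const 1).lt (.var rvMin))
        (setR rvMin (evE nvD (.var nvJ) - .const 1)) skip) rfl s'
      (fun j s'' => (∀ d' < d, ∀ j < K, s''.rvar rvMin < s.evAt d' j) ∧
        ∀ j' < j, s''.rvar rvMin < s.evAt d j') ?_ ?_
    · rw [hK'] at inner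
      intro d' hd' j hj
      rw [State.setN_rvar]
      rcases Nat.lt_succ_iff_lt_or_eq.1 hd' with hd' | rfl
      · exact inner.1 d' hd' j hj
      · exact inner.2 j hj
    · exact ⟨h, fun j hj => absurd hj (Nat.not_lt_zero j)⟩
    · rintro j hj s'' ⟨g1, g2⟩ gi ga
      have hD : s''.nvar nvD = d := (ga.nvar _ rfl).trans hi
      have hev : (evE nvD (.var nvJ)).eval s'' = s.evAt d j := by
        simp only [evE, RExpr.eval_get, NExpr.eval_add, NExpr.eval_get, NExpr.eval_var, hD, gi,
          State.evAt, ga.narr naRow rfl, ga.rarr raEv rfl, ha.narr naRow rfl, ha.rarr raEv rfl]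
        rfl
      set p := ite ((evE nvD (.var nvJ) - .const 1).lt (.var rvMin))
        (setR rvMin (evE nvD (.var nvJ) - .const 1)) skip with hp
      have hx : (p.den s'').rvar rvMin ≤ s''.rvar rvMin ∧
          (p.den s'').rvar rvMin < s.evAt d j := by
        by_cases hc : ((evE nvD (.var nvJ) - .const 1).lt (.var rvMin)).holds s''
        · rw [hp, den_ite_pos _ _ hc]
          simp only [RExpr.holds_lt, RExpr.eval_sub, RExpr.eval_var, RExpr.eval_const, hev,
            Int.cast_one] at hc
          simp only [den_setR, State.setR_rvar, if_pos, RExpr.eval_sub, RExpr.eval_const, hev,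
            Int.cast_one]
          exact ⟨hc.le, by linarith⟩
        · rw [hp, den_ite_neg _ _ hc, den_skip]
          simp only [RExpr.holds_lt, RExpr.eval_sub, RExpr.eval_var, RExpr.eval_const, hev,
            Int.cast_one] at hc
          exact ⟨le_rfl, by linarith⟩
      simp only [State.setN_rvar]
      refine ⟨fun d' hd' j' hj' => hx.1.trans_lt (g1 d' hd' j' hj'), fun j' hj' => ?_⟩
      rcases Nat.lt_succ_iff_lt_or_eq.1 hj' with hj' | rfl
      · exact hx.1.trans_lt (g2 j' hj')
      · exact hx.2

/-- When all curves have been collected, the rest of the tables describes a scene. -/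
theorem exists_scene {n N : ℕ} {P : Coords} {s : State} (hP : P.Apart n)
    (hs : Collected n P (fun a b => a < n ∧ b < n) N s) :
    ∃ S : Scene, S.n = n ∧ S.P = P ∧
      Tables S (findMin.den (buildEvents.den (setSizes.den s))) := by
  obtain ⟨m, hm⟩ : ∃ m, m = s.nvar nvM := ⟨_, rfl⟩
  have hpos : 0 < m := by
    have := hs.length_eq
    rw [s.length_table, ← hm] at this
    omega
  set s₁ := setSizes.den s with hs₁
  have m₁ : s₁.nvar nvM = m := hm.symm
  have K₁ : s₁.nvar nvK = 11 * m := by simp [hs₁, setSizes, hm]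
  set s₂ := buildEvents.den s₁ with hs₂
  have m₂ : s₂.nvar nvM = m := (den_nvar rfl s₁).trans m₁
  have K₂ : s₂.nvar nvK = 11 * m := (den_nvar rfl s₁).trans K₁
  have c₁ : s₁.curveAt = s.curveAt := rfl
  have hev : ∀ d < m, ∀ e < m, ∀ t < 11,
      s₂.evAt d (11 * e + t) = (s.curveAt d).event (s.curveAt e) t := by
    intro d hd e he t ht
    rw [hs₂, buildEvents_spec m₁ hd he ht, c₁]
  have hleg : ∀ e < m, (s.curveAt e).IsLegal := fun e he =>
    hs.legal _ (State.mem_table.2 ⟨e, by rwa [← hm], rfl⟩)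
  set s₃ := findMin.den s₂ with hs₃
  have c₃ : s₃.curveAt = s.curveAt := by
    rw [← c₁]
    funext e
    simp only [State.curveAt, hs₃, hs₂, den_rarr (p := findMin) (j := 12) rfl,
      den_rarr (p := findMin) (j := 13) rfl, den_rarr (p := findMin) (j := 14) rfl,
      den_rarr (p := findMin) (j := 15) rfl, den_rarr (p := buildEvents) (j := 12) rfl,
      den_rarr (p := buildEvents) (j := 13) rfl, den_rarr (p := buildEvents) (j := 14) rfl,
      den_rarr (p := buildEvents) (j := 15) rfl]
  have e₃ : ∀ d j, s₃.evAt d j = s₂.evAt d j := by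
    intro d j
    rw [State.evAt, State.evAt, hs₃, den_narr rfl, den_rarr rfl]
  have P₃ : s₃.coords = P := by
    rw [← hs.coords_eq, State.coords, State.coords, hs₃, hs₂]
    simp only [den_rarr (p := findMin) (j := 0) rfl, den_rarr (p := findMin) (j := 1) rfl,
      den_rarr (p := findMin) (j := 2) rfl, den_rarr (p := findMin) (j := 3) rfl,
      den_rarr (p := buildEvents) (j := 0) rfl, den_rarr (p := buildEvents) (j := 1) rfl,
      den_rarr (p := buildEvents) (j := 2) rfl, den_rarr (p := buildEvents) (j := 3) rfl,
      den_narr (p := findMin) (j := 0) rfl, den_narr (p := buildEvents) (j := 0) rfl]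
    rfl
  refine ⟨
    { A :=
        { m := m
          f := fun e x => (s.curveAt e).val x
          ev := s₂.evAt
          pos := hpos
          sep := fun d hd e he a b hab h => TotalCurve.sign_eq_of_event (hleg d hd) (hleg e he) hab
            fun t ht => by rw [← hev d hd e he t ht]; exact h t ht }
      n := n
      P := P
      curve := s.curveAt
      low := s₃.rvar rvMin
      f_eq := fun _ _ => rfl
      legal := hleg
      ev_left := fun d hd e he => hev d hd e he 9 (by norm_num)
      ev_right := fun d hd e he => hev d hd e he 10 (by norm_num)
      low_lt := findMin_spec m₂ K₂
      apart := hP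
      complete := fun a ha b hb i k hk => by
        obtain ⟨e, he, h⟩ := State.mem_table.1 (hs.complete a b ⟨ha, hb⟩ i k hk)
        exact ⟨e, he.trans_eq hm.symm, h⟩ }, rfl, rfl, ?_⟩
  constructor
  · exact (den_nvar rfl s₂).trans ((den_nvar rfl s₁).trans hs.n_eq)
  · exact (den_nvar rfl s₂).trans m₂
  · exact (den_nvar rfl s₂).trans K₂
  · exact (den_nvar rfl s₂).trans (den_nvar rfl s₁)
  · exact (den_nvar rfl s₂).trans ((den_nvar rfl s₁).trans (by simp [hs₁, setSizes, hm,
      Arrangement.K]))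
  · exact fun e => congrFun c₃ e
  · exact fun d _ j _ => e₃ d j
  · exact P₃
  · rfl

open FProg

/-! ### Correctness and running time -/

theorem Reported.reportsValidTranslations {n : ℕ} {I : LabeledInstance n} {S : Scene} {s : State}
    (hn : S.n = n) (hP : S.P = (inputState I).coords) (h : Reported S Set.univ s) :
    ReportsValidTranslations I s := by
  refine ⟨h.proper, h.disjoint, ?_, fun k hk v hv w hw σ => ?_⟩
  · rw [h.union_eq, Set.inter_univ]
    ext v
    rw [mem_validTranslations_iff, ← hP, ← hn]
    rfl
  · rw [isItinerary_iff, isItinerary_iff, ← hP]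
    refine forall₃_congr fun i j hij => not_congr ?_
    exact h.same k hk v hv w hw _ (by rw [hn]; exact (σ i).2) _ (by rw [hn]; exact (σ j).2)
      fun e => hij.ne (σ.injective (Fin.ext e))

theorem reported_empty {S : Scene} {s : State} (h : outputCount s = 0) : Reported S ∅ s :=
  ⟨by simp [h], by simp [h], by simp [h], by simp [h]⟩

/-- The loop bounds of the main part are of the orders that its running time presupposes: there are
`1 + 10 n ^ 2` curves with `11 + 110 n ^ 2` events each, so that the factor `200` suffices. -/
theorem nvar_le_order {n : ℕ} {S : Scene} {s : State} (hn : S.n = n)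
    (hm : S.A.m = 1 + 10 * (n * n)) (hT : Tables S s) :
    ∀ b ∈ mainPart.bounds, s.nvar b ≤ 200 * (n + 1) ^ order b := by
  have hb : ∀ b ∈ mainPart.bounds, b = nvN ∨ b = nvM ∨ b = nvK ∨ b = nvEleven ∨ b = nvKs := by
    decide
  have hN := hT.n_eq
  have hM := hT.m_eq
  have hK := hT.K_eq
  have hE := hT.eleven_eq
  have hKs := hT.Ks_eq
  rw [Arrangement.K] at hK hKs
  intro b hmem
  rcases hb b hmem with rfl | rfl | rfl | rfl | rfl <;> simp only [order] <;> nlinarith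

end DiscReconfig

open DiscReconfig DiscReconfig.FProg in
theorem mainTheorem1 :
    ∃ (prog : DiscReconfig.Prog) (C : ℕ),
      ∀ (n : ℕ) (I : DiscReconfig.LabeledInstance n),
        ∃ (t : ℕ) (s : DiscReconfig.State),
          DiscReconfig.Exec prog (DiscReconfig.inputState I) t s ∧
          t ≤ C * (n ^ 6 + 1) ∧
          DiscReconfig.ReportsValidTranslations I s := by
  obtain ⟨c₁, h₁⟩ := exec_compile order 200 buildCurves wf_buildCurves bounds_buildCurves
  obtain ⟨c₂, h₂⟩ := exec_compile order 200 setSizes rfl (by decide)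
  obtain ⟨c₃, h₃⟩ := exec_compile order 200 mainPart wf_mainPart bounds_mainPart
  refine ⟨.seq buildCurves.compile (.seq setSizes.compile mainPart.compile),
    64 * (c₁ + c₂ + c₃), fun n I => ?_⟩
  have hn : (inputState I).nvar 0 = n := rfl
  have hcurves := buildCurves_spec hn rfl (.inl (by simp [State.curveAt, inputState]))
  have hout : outputCount (findMin.den (buildEvents.den (setSizes.den
      (buildCurves.den (inputState I))))) = 0 := by
    rw [outputCount, den_nvar rfl, den_nvar rfl, den_nvar rfl, den_nvar rfl]
    rfl
  obtain ⟨S, hSn, hSP, hT⟩ := exists_scene (apart_inputState I) hcurves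
  have hm : S.A.m = 1 + 10 * (n * n) := by
    rw [← hT.m_eq, ← hcurves.length_eq, State.length_table, den_nvar rfl, den_nvar rfl,
      den_nvar rfl]
  obtain ⟨t₁, e₁, b₁⟩ := h₁ (inputState I) (n + 1) (by omega) (by
    have hb : ∀ b ∈ buildCurves.bounds, b = 0 := by decide
    intro b hmem
    rw [hb b hmem, hn]
    simp only [order, pow_one]
    omega)
  obtain ⟨t₂, e₂, b₂⟩ := h₂ (buildCurves.den (inputState I)) (n + 1) (by omega) (by
    intro b hmem
    simp [setSizes, bounds] at hmem)
  obtain ⟨t₃, e₃, b₃⟩ := h₃ (setSizes.den (buildCurves.den (inputState I))) (n + 1) (by omega) (by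
    intro b hmem
    have hw : ∀ b ∈ mainPart.bounds,
        findMin.wN.contains b = false ∧ buildEvents.wN.contains b = false := by decide
    have := nvar_le_order hSn hm hT b hmem
    rwa [den_nvar (hw b hmem).1, den_nvar (hw b hmem).2] at this)
  refine ⟨t₁ + (t₂ + t₃), _, .seq e₁ (.seq e₂ e₃), ?_, ?_⟩
  · -- in `n + 1`, which is positive even without discs, the time is bounded by a power
    have hpow : (n + 1) ^ 6 ≤ 64 * (n ^ 6 + 1) := by
      rcases Nat.eq_zero_or_pos n with rfl | hpos
      · norm_num
      · calc (n + 1) ^ 6 ≤ (2 * n) ^ 6 := Nat.pow_le_pow_left (by omega) 6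
          _ = 64 * n ^ 6 := by ring
          _ ≤ _ := by omega
    have hle : ∀ k ≤ 6, (n + 1) ^ k ≤ 64 * (n ^ 6 + 1) := fun k hk =>
      (Nat.pow_le_pow_right (by omega) hk).trans hpow
    have d₁ := Nat.mul_le_mul_left c₁ (hle (buildCurves.deg order) (by rw [deg_buildCurves]; omega))
    have d₂ := Nat.mul_le_mul_left c₂ (hle (setSizes.deg order) (by decide))
    have d₃ := Nat.mul_le_mul_left c₃ (hle (mainPart.deg order) (by rw [deg_mainPart]))
    calc t₁ + (t₂ + t₃) ≤ c₁ * (64 * (n ^ 6 + 1)) + (c₂ * (64 * (n ^ 6 + 1)) +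
          c₃ * (64 * (n ^ 6 + 1))) := by omega
      _ = _ := by ring
  · refine Reported.reportsValidTranslations hSn hSP ?_
    rw [mainPart, den_seq, den_seq]
    exact reportCells_spec hT (reported_empty hout)
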